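/- Let $m\ge 1$ be an integer, $n=2m+2$, $\rho>1$, and let $\mathcal W^{\ge0}_{\mathbb R}$ be the Banach space of power series $f(\lambda)=\sum_{k\ge0}f_k\lambda^k$ with real coefficients and $\|f\|_\rho=\sum_k|f_k|\rho^k<\infty$; write $f^0=f_0$. For parameters $\mathbf x=(r,a,b,c)\in\mathbb R\times(\mathcal W^{\ge0}_{\mathbb R})^3$ and $t\in\mathbb R$ put $p_j=e^{2\pi i j/n}$, $D=\mathrm{diag}(e^{i\pi m/n},e^{-i\pi m/n})$, $$A_0(\lambda)=\begin{pmatrix}a(\lambda)&\lambda^{-1}b(\lambda)\\ \lambda c(\lambda)&-a(\lambda)\end{pmatrix},\qquad A_{j+1}(\lambda)=D^{-1}A_j(-\lambda)D\quad(0\le j\le n-2),$$ $$\eta_t^{\mathbf x}=\begin{pmatrix}0&0\\ mr z^{m-1}dz&0\end{pmatrix}+t\sum_{j=0}^{n-1}A_j(\lambda)\frac{dz}{z-p_j}.$$ Let $\Phi_t$ be the solution of $d\Phi_t=\Phi_t\,\eta_t^{\mathbf x}$, $\Phi_t(0)=\mathrm{Id}$, and let $M(t)=M(t,\mathbf x)(\lambda)$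 be its monodromy along the loop $\gamma_0$ based at $0$ that runs once counterclockwise along the circle through $0$ centred at $\frac{1}{2\cos(\pi/n)}$ (which encloses $p_0=1$ and no other $p_j$). Let $\widetilde M(t)=\frac1t\log M(t)$ for small $t\ne0$ and $\widetilde M(0)=M'(0)$ (for fixed $\mathbf x$), and let $f^*(\lambda)=\overline{f(1/\overline\lambda)}$. Consider the equations $$\widetilde M_{11}+\widetilde M_{11}^*=0,\quad \widetilde M_{21}+\widetilde M_{12}^*=0\ \text{ on } S^1,\qquad \widetilde M_{12}|_{\lambda=1}=\widetilde M_{12}|_{\lambda=-1}=0,\qquad (a^0)^2+b^0c^0=1, \tag{1}$$ and let $\mathbf x_0$ be given by $r=1$, $a=\lambda$, $b=\frac{\lambda^2-1}{2}$, $c=-2$. Then there are $\varepsilon,\delta>0$ such that for every real $t$ with $|t|<\varepsilon$ the equations (1) have exactly one solution $\mathbf x(t)=(r(t),a(t),b(t),c(t))$ in the $\delta$-ball around $\mathbf x_0$. One has $\mathbf x(0)=\mathbf x_0$, the map $t\mapsto\mathbf x(t)$ is differentiable at $t=0$ with respect to $\|\cdot\|_\rho$, and $$a'(0)=(1-\lambda^2)\kappa_m,\qquad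 b'(0)=(\lambda-\lambda^3)\kappa_m,\qquad c'(0)=0,\qquad r'(0)=0,$$ where $\displaystyle \kappa_m=\frac n2\int_0^1\frac{(1-x^m)^2}{1-x^n}\,dx$. -/

import Mathlib

open Polynomial

noncomputable section

namespace LawsonDPW

/-! ### Loop spaces -/

/-- Coefficient sequences of the power series `∑ fₖ λᵏ` with real coefficients and
`∑ |fₖ| ρᵏ < ∞`. -/
def wienerSubmodule (ρ : ℝ) : Submodule ℝ (ℕ → ℝ) where
  carrier := {f | Summable fun k => |f k| * |ρ| ^ k}
  zero_mem' := by simp [summable_zero]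
  add_mem' := by
    intro f g hf hg
    refine Summable.of_nonneg_of_le (fun k => by positivity) (fun k => ?_) (hf.add hg)
    rw [← add_mul]
    exact mul_le_mul_of_nonneg_right (abs_add_le _ _) (by positivity)
  smul_mem' := by
    intro c f hf
    refine (hf.mul_left |c|).congr fun k => ?_
    simp [abs_mul, mul_assoc]

/-- The space `𝒲^{≥0}_ℝ` of loops `f(λ) = ∑_{k ≥ 0} fₖ λᵏ` with real Fourier coefficients and
finite norm `‖f‖_ρ = ∑ |fₖ| ρᵏ`. -/
def W (ρ : ℝ) : Type := wienerSubmodule ρ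

namespace W

variable {ρ : ℝ}

instance : AddCommGroup (W ρ) := inferInstanceAs (AddCommGroup (wienerSubmodule ρ))

instance : Module ℝ (W ρ) := inferInstanceAs (Module ℝ (wienerSubmodule ρ))

/-- The `k`-th Fourier coefficient. -/
def coeff (f : W ρ) (k : ℕ) : ℝ := f.1 k

theorem summable (f : W ρ) : Summable fun k => |f.coeff k| * |ρ| ^ k := f.2

@[ext]
theorem ext {f g : W ρ} (h : ∀ k, f.coeff k = g.coeff k) : f = g := Subtype.ext (funext h)

@[simp] theorem coeff_zero (k : ℕ) : (0 : W ρ).coeff k = 0 := rfl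

@[simp] theorem coeff_add (f g : W ρ) (k : ℕ) : (f + g).coeff k = f.coeff k + g.coeff k := rfl

@[simp] theorem coeff_smul (c : ℝ) (f : W ρ) (k : ℕ) : (c • f).coeff k = c * f.coeff k := rfl

/-- The norm `‖f‖_ρ = ∑ |fₖ| ρᵏ` (here `ρ > 1`, so `|ρ| = ρ`). -/
instance : Norm (W ρ) := ⟨fun f => ∑' k, |f.coeff k| * |ρ| ^ k⟩

theorem norm_def (f : W ρ) : ‖f‖ = ∑' k, |f.coeff k| * |ρ| ^ k := rfl

theorem core [hρ : Fact (1 < ρ)] : NormedSpace.Core ℝ (W ρ) where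
  norm_nonneg f := tsum_nonneg fun k => by positivity
  norm_smul c f := by
    simp only [norm_def, coeff_smul, abs_mul, mul_assoc, tsum_mul_left, Real.norm_eq_abs]
  norm_triangle f g := by
    simp only [norm_def]
    rw [← f.summable.tsum_add g.summable]
    refine (f + g).summable.tsum_le_tsum (fun k => ?_) (f.summable.add g.summable)
    rw [← add_mul, coeff_add]
    exact mul_le_mul_of_nonneg_right (abs_add_le _ _) (by positivity)
  norm_eq_zero_iff f := by
    constructor
    · intro h
      rw [norm_def] at h
      have h0 := (hasSum_zero_iff_of_nonneg (fun k => by positivity)).1 (h ▸ f.summable.hasSum)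
      ext k
      have hk := congrFun h0 k
      have hpos : 0 < |ρ| ^ k := pow_pos (abs_pos.2 (by linarith [hρ.out])) k
      simpa [hpos.ne'] using hk
    · rintro rfl
      simp [norm_def]

instance [Fact (1 < ρ)] : NormedAddCommGroup (W ρ) := NormedAddCommGroup.ofCore core

instance [Fact (1 < ρ)] : NormedSpace ℝ (W ρ) := NormedSpace.ofCore core

/-- A real polynomial in `λ`, as an element of `𝒲^{≥0}_ℝ`. -/
def ofPoly (p : ℝ[X]) : W ρ :=
  ⟨p.coeff, by
    refine summable_of_ne_finset_zero (s := p.support) fun k hk => ?_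
    simp [Polynomial.notMem_support_iff.1 hk]⟩

/-- The value `f(λ) = ∑ fₖ λᵏ`. -/
def eval (f : W ρ) (l : ℂ) : ℂ := ∑' k, (f.coeff k : ℂ) * l ^ k

end W

/-! ### The potential -/

/-- Complex `2 × 2` matrices. -/
abbrev Mat := Matrix (Fin 2) (Fin 2) ℂ

/-- The parameter vector `(r, a, b, c)`. -/
abbrev Params (ρ : ℝ) := ℝ × W ρ × W ρ × W ρ

/-- The punctures `p_j = exp (2πi j / n)`, `n = 2m + 2`. -/
def puncture (m j : ℕ) : ℂ := Complex.exp (2 * Real.pi * Complex.I * j / (2 * m + 2))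

/-- `D = diag (exp (iπm/n), exp (-iπm/n))`, `n = 2m + 2`. -/
def matD (m : ℕ) : Mat :=
  !![Complex.exp (Complex.I * Real.pi * m / (2 * m + 2)), 0;
     0, Complex.exp (-(Complex.I * Real.pi * m / (2 * m + 2)))]

/-- The residue matrices: `A₀(λ) = (a, λ⁻¹ b; λ c, -a)` and `A_{j+1}(λ) = D⁻¹ A_j(-λ) D`. -/
def matA {ρ : ℝ} (m : ℕ) (x : Params ρ) : ℕ → ℂ → Mat
  | 0, l => !![x.2.1.eval l, l⁻¹ * x.2.2.1.eval l; l * x.2.2.2.eval l, -x.2.1.eval l]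
  | j + 1, l => (matD m)⁻¹ * matA m x j (-l) * matD m

/-- The coefficient of `dz` in the potential
`η_t^x = (0, 0; m r z^{m-1}, 0) dz + t ∑_{j < n} A_j(λ) dz / (z - p_j)`. -/
def potential {ρ : ℝ} (m : ℕ) (t : ℝ) (x : Params ρ) (l z : ℂ) : Mat :=
  !![0, 0; m * x.1 * z ^ (m - 1), 0] +
    (t : ℂ) • ∑ j ∈ Finset.range (2 * m + 2), (z - puncture m j)⁻¹ • matA m x j l

/-! ### The monodromy -/

/-- `Y` is the continuation along `γ : [0, 1] → ℂ` of the solution of `dΦ = Φ η` that is the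
identity at `γ 0`. -/
def IsSolutionAlong (η : ℂ → Mat) (γ : ℝ → ℂ) (Y : ℝ → Mat) : Prop :=
  Y 0 = 1 ∧ ∀ s ∈ Set.Icc (0 : ℝ) 1, ∀ i j,
    HasDerivWithinAt (fun u => Y u i j) (deriv γ s * (Y s * η (γ s)) i j) (Set.Icc 0 1) s

open Classical in
/-- The monodromy along the loop `γ` of the solution of `dΦ = Φ η` that is the identity at the base
point: the value at the end of `γ` of its continuation along `γ` (which exists and is unique when
`η` is continuous along the smooth loop `γ`). -/
def monodromy (η : ℂ → Mat) (γ : ℝ → ℂ) : Mat :=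
  if h : ∃ Y, IsSolutionAlong η γ Y then h.choose 1 else 1

/-- The generator `γ₀` of the fundamental group with base point `0`: the circle through `0`
centred on the positive real axis and passing through `exp (± iπ/n)`, `n = 2m + 2`, run through
once counterclockwise. It encloses the point `exp (iθ)` of the unit circle if and only if
`cos θ > cos (π/n)`, hence `p₀ = 1` and no other puncture. -/
def loop (m : ℕ) (s : ℝ) : ℂ :=
  ((1 / (2 * Real.cos (Real.pi / (2 * m + 2))) : ℝ) : ℂ) *
    (1 - Complex.exp (2 * Real.pi * Complex.I * s))

/-- `M(t)(λ)`, the monodromy of `Φ_t` along `γ₀`, for the parameter `x`. -/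
def M {ρ : ℝ} (m : ℕ) (t : ℝ) (x : Params ρ) (l : ℂ) : Mat :=
  monodromy (potential m t x l) (loop m)

/-- The principal logarithm of a matrix close to the identity. -/
def matLog (B : Mat) : Mat := ∑' k : ℕ, ((-1) ^ k / ((k : ℂ) + 1)) • (B - 1) ^ (k + 1)

/-- `M̃(t) = (1/t) log M(t)` for `t ≠ 0`, extended by `M̃(0) = M'(0)`. -/
def Mtilde {ρ : ℝ} (m : ℕ) (t : ℝ) (x : Params ρ) (l : ℂ) : Mat :=
  if t = 0 then Matrix.of fun i j => deriv (fun s : ℝ => M m s x l i j) 0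
  else (t : ℂ)⁻¹ • matLog (M m t x l)

/-! ### The monodromy problem -/

/-- The involution `f*(λ) = conj (f (1 / conj λ))`. -/
def starLoop (f : ℂ → ℂ) (l : ℂ) : ℂ := starRingEnd ℂ (f (1 / starRingEnd ℂ l))

/-- `ℱ(t, x) = (M̃₁₁ + M̃₁₁*) / (2πi)`. -/
def F {ρ : ℝ} (m : ℕ) (t : ℝ) (x : Params ρ) (l : ℂ) : ℂ :=
  1 / (2 * Real.pi * Complex.I) *
    (Mtilde m t x l 0 0 + starLoop (fun w => Mtilde m t x w 0 0) l)

/-- `𝒢(t, x) = (M̃₂₁ + M̃₁₂*) / (2πi)`. -/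
def G {ρ : ℝ} (m : ℕ) (t : ℝ) (x : Params ρ) (l : ℂ) : ℂ :=
  1 / (2 * Real.pi * Complex.I) *
    (Mtilde m t x l 1 0 + starLoop (fun w => Mtilde m t x w 0 1) l)

/-- `ℋ₁(t, x) = M̃₁₂(λ = 1) / (2πi)`. -/
def H₁ {ρ : ℝ} (m : ℕ) (t : ℝ) (x : Params ρ) : ℂ :=
  1 / (2 * Real.pi * Complex.I) * Mtilde m t x 1 0 1

/-- `ℋ₂(t, x) = M̃₁₂(λ = -1) / (2πi)`. -/
def H₂ {ρ : ℝ} (m : ℕ) (t : ℝ) (x : Params ρ) : ℂ :=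
  1 / (2 * Real.pi * Complex.I) * Mtilde m t x (-1) 0 1

/-- `𝒦(x) = (a⁰)² + b⁰ c⁰`. -/
def K {ρ : ℝ} (x : Params ρ) : ℝ :=
  x.2.1.coeff 0 ^ 2 + x.2.2.1.coeff 0 * x.2.2.2.coeff 0

/-- The normalised monodromy problem `ℱ = 0`, `𝒢 = 0` (as loops on the unit circle),
`ℋ₁ = ℋ₂ = 0`, `𝒦 = 1`. -/
def SolvesMonodromyProblem {ρ : ℝ} (m : ℕ) (t : ℝ) (x : Params ρ) : Prop :=
  (∀ l : ℂ, ‖l‖ = 1 → F m t x l = 0) ∧ (∀ l : ℂ, ‖l‖ = 1 → G m t x l = 0) ∧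
    H₁ m t x = 0 ∧ H₂ m t x = 0 ∧ K x = 1

/-- The initial value `r = 1`, `a = λ`, `b = (λ² - 1)/2`, `c = -2`. -/
def x₀ (ρ : ℝ) : Params ρ :=
  (1, W.ofPoly X, W.ofPoly (C (1 / 2) * (X ^ 2 - 1)), W.ofPoly (C (-2)))

/-- `κ_m = (n/2) ∫₀¹ (1 - xᵐ)² / (1 - xⁿ) dx`, `n = 2m + 2`. -/
def kappa (m : ℕ) : ℝ :=
  ((2 * m + 2 : ℝ) / 2) * ∫ x in (0 : ℝ)..1, (1 - x ^ m) ^ 2 / (1 - x ^ (2 * m + 2))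

end LawsonDPW

end

/-!
The gauge `g = (1, 0; r zᵐ, 1)` removes the part of the potential that does not vanish with `t`.
The monodromy is therefore the transport of a potential proportional to `t`, and `(2πi)⁻¹ M̃`
extends across `t = 0` to a strictly differentiable function of `(t, x)` with values in the `2 × 2`
matrices over the Wiener algebra.

At `t = 0` this function is the residue of the potential at `p₀ = 1` conjugated by `g(1)`. The
derivative of the equations in `x` at `x₀` can be computed from this explicitly. It is an
isomorphism, so that the implicit function theorem yields the curve of solutions.

The velocity of the curve needs the `t`-derivative at `x₀`, the second term of the Magnus expansion:
an antisymmetrised iterated integral of length two along the loop. By the shuffle relation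
(integration by parts), antisymmetrising against a form whose total integral vanishes amounts to
integrating its primitive, and the only such form that occurs is `n (1 - zᵐ)² dz / (zⁿ - 1)`. This
form is regular at `z = 1`, so Cauchy's formula evaluates its primitive there, which is `-2 κ_m`.
-/

noncomputable section

namespace LawsonDPW

open unitInterval

/-! ### Parallel transport in a Banach algebra -/

/-- The Banach algebra of continuous functions on `[0, 1]` with values in `𝒜`. It is a synonym of
`C(I, 𝒜)` because the ring and module lemmas of Mathlib fail to unify with the instances on
`C(I, 𝒜)` at the transparency used by `rw` and `simp`. -/
def PathAlgebra (𝒜 : Type*) [NormedRing 𝒜] : Type _ := C(I, 𝒜)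

namespace PathAlgebra

variable {𝒜 : Type*} [NormedRing 𝒜]

instance : NormedRing (PathAlgebra 𝒜) := inferInstanceAs (NormedRing C(I, 𝒜))

instance [NormedAlgebra ℂ 𝒜] : NormedAlgebra ℂ (PathAlgebra 𝒜) :=
  inferInstanceAs (NormedAlgebra ℂ C(I, 𝒜))

instance [CompleteSpace 𝒜] : CompleteSpace (PathAlgebra 𝒜) :=
  inferInstanceAs (CompleteSpace C(I, 𝒜))

instance : FunLike (PathAlgebra 𝒜) I 𝒜 := inferInstanceAs (FunLike C(I, 𝒜) I 𝒜)

@[ext]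
theorem ext {u v : PathAlgebra 𝒜} (h : ∀ s, u s = v s) : u = v := ContinuousMap.ext h

protected theorem continuous (u : PathAlgebra 𝒜) : Continuous u :=
  ContinuousMap.continuous (X := I) u

@[simp]
theorem add_apply (u v : PathAlgebra 𝒜) (s : I) : (u + v) s = u s + v s := rfl

@[simp]
theorem mul_apply (u v : PathAlgebra 𝒜) (s : I) : (u * v) s = u s * v s := rfl

@[simp]
theorem one_apply (s : I) : (1 : PathAlgebra 𝒜) s = 1 := rfl

theorem norm_apply_le (u : PathAlgebra 𝒜) (s : I) : ‖u s‖ ≤ ‖u‖ :=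
  ContinuousMap.norm_coe_le_norm (α := I) u s

theorem norm_le (u : PathAlgebra 𝒜) {C : ℝ} (hC : 0 ≤ C) (h : ∀ s, ‖u s‖ ≤ C) : ‖u‖ ≤ C :=
  (ContinuousMap.norm_le (α := I) u hC).2 h

variable [NormedAlgebra ℂ 𝒜]

@[simp]
theorem smul_apply (c : ℂ) (u : PathAlgebra 𝒜) (s : I) : (c • u) s = c • u s := rfl

/-- Evaluation of a path at the parameter `s`. -/
def evalCLM (s : I) : PathAlgebra 𝒜 →L[ℂ] 𝒜 :=
  LinearMap.mkContinuous ⟨⟨fun u => u s, fun _ _ => rfl⟩, fun _ _ => rfl⟩ 1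
    (fun u => by rw [one_mul]; exact u.norm_apply_le s)

theorem sum_apply {ι : Type*} (t : Finset ι) (f : ι → PathAlgebra 𝒜) (s : I) :
    (∑ j ∈ t, f j) s = ∑ j ∈ t, f j s :=
  map_sum (evalCLM s) f t

end PathAlgebra

section Volterra

variable {𝒜 : Type*} [NormedRing 𝒜] [NormedAlgebra ℂ 𝒜]

/-- The Volterra operator `u ↦ (s ↦ ∫₀ˢ u)` on continuous functions on `[0, 1]`. -/
def volterra (𝒜 : Type*) [NormedRing 𝒜] [NormedAlgebra ℂ 𝒜] : PathAlgebra 𝒜 →L[ℂ] PathAlgebra 𝒜 :=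
  LinearMap.mkContinuous
    { toFun := fun u => (⟨fun s => ∫ x in (0 : ℝ)..s, Set.IccExtend zero_le_one u x,
        (intervalIntegral.continuous_primitive
          (fun _ _ => u.continuous.Icc_extend'.intervalIntegrable _ _) 0).comp
          continuous_subtype_val⟩ : C(I, 𝒜))
      map_add' := fun u v => PathAlgebra.ext fun _ =>
        intervalIntegral.integral_add (u.continuous.Icc_extend'.intervalIntegrable _ _)
          (v.continuous.Icc_extend'.intervalIntegrable _ _)
      map_smul' := fun c _ => PathAlgebra.ext fun _ => intervalIntegral.integral_smul c _ }
    1 fun u => by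
      rw [one_mul]
      refine PathAlgebra.norm_le _ (norm_nonneg u) fun s => ?_
      have h := intervalIntegral.norm_integral_le_of_norm_le_const (a := 0) (b := (s : ℝ))
        (f := Set.IccExtend zero_le_one u) (C := ‖u‖) fun _ _ => u.norm_apply_le _
      rw [sub_zero, abs_of_nonneg s.2.1] at h
      exact h.trans (mul_le_of_le_one_right (norm_nonneg u) s.2.2)

theorem volterra_apply (u : PathAlgebra 𝒜) (s : I) :
    volterra 𝒜 u s = ∫ x in (0 : ℝ)..s, Set.IccExtend zero_le_one u x := rfl

theorem norm_volterra_le : ‖volterra 𝒜‖ ≤ 1 := LinearMap.mkContinuous_norm_le _ zero_le_one _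

theorem hasDerivWithinAt_volterra [CompleteSpace 𝒜] (u : PathAlgebra 𝒜) {s : ℝ}
    (hs : s ∈ Set.Icc (0 : ℝ) 1) :
    HasDerivWithinAt (Set.IccExtend zero_le_one (volterra 𝒜 u)) (u ⟨s, hs⟩) (Set.Icc 0 1) s := by
  have hu : Continuous (Set.IccExtend zero_le_one u) := u.continuous.Icc_extend'
  have h := intervalIntegral.integral_hasDerivAt_right (hu.intervalIntegrable 0 s)
    (hu.stronglyMeasurableAtFilter _ _) hu.continuousAt
  rw [Set.IccExtend_of_mem _ _ hs] at h
  refine h.hasDerivWithinAt.congr_of_mem (fun y hy => ?_) hs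
  rw [Set.IccExtend_of_mem _ _ hy, volterra_apply]

/-- The total integral `∫₀¹ u`. -/
def totalIntegral (𝒜 : Type*) [NormedRing 𝒜] [NormedAlgebra ℂ 𝒜] : PathAlgebra 𝒜 →L[ℂ] 𝒜 :=
  (PathAlgebra.evalCLM 1).comp (volterra 𝒜)

theorem totalIntegral_apply (u : PathAlgebra 𝒜) : totalIntegral 𝒜 u = volterra 𝒜 u 1 := rfl

theorem volterra_eq_integral {u : PathAlgebra 𝒜} {f : ℝ → 𝒜} (h : ∀ s : I, u s = f s) (s : I) :
    volterra 𝒜 u s = ∫ x in (0 : ℝ)..s, f x := by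
  refine intervalIntegral.integral_congr fun x hx => ?_
  rw [Set.uIcc_of_le s.2.1] at hx
  rw [Set.IccExtend_of_mem _ _ ⟨hx.1, hx.2.trans s.2.2⟩, h]

theorem totalIntegral_eq_integral {u : PathAlgebra 𝒜} {f : ℝ → 𝒜} (h : ∀ s : I, u s = f s) :
    totalIntegral 𝒜 u = ∫ x in (0 : ℝ)..1, f x :=
  volterra_eq_integral h 1

end Volterra

section Transport

variable {𝒜 : Type*} [NormedRing 𝒜] [NormedAlgebra ℂ 𝒜]

/-- The operator `u ↦ (s ↦ ∫₀ˢ u B)`, whose fixed points modulo constants are the solutions of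
`U' = U B`, as a continuous linear function of `B`. -/
def transportOp (𝒜 : Type*) [NormedRing 𝒜] [NormedAlgebra ℂ 𝒜] :
    PathAlgebra 𝒜 →L[ℂ] PathAlgebra 𝒜 →L[ℂ] PathAlgebra 𝒜 :=
  (ContinuousLinearMap.compL ℂ _ _ _ (volterra 𝒜)).comp
    (ContinuousLinearMap.mul ℂ (PathAlgebra 𝒜)).flip

theorem transportOp_apply (B u : PathAlgebra 𝒜) : transportOp 𝒜 B u = volterra 𝒜 (u * B) := rfl

theorem norm_transportOp_apply_le (B : PathAlgebra 𝒜) : ‖transportOp 𝒜 B‖ ≤ ‖B‖ :=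
  ContinuousLinearMap.opNorm_le_bound _ (norm_nonneg B) fun u => calc
    ‖volterra 𝒜 (u * B)‖ ≤ ‖u * B‖ :=
      (volterra 𝒜).le_of_opNorm_le norm_volterra_le _ |>.trans_eq (one_mul _)
    _ ≤ ‖B‖ * ‖u‖ := (norm_mul_le u B).trans_eq (mul_comm _ _)

/-- The solution of `U' = U B`, `U(0) = 1`, for small `B`, as the Neumann series of
`transportOp 𝒜 B` applied to `1`. -/
def transport (B : PathAlgebra 𝒜) : PathAlgebra 𝒜 := Ring.inverse (1 - transportOp 𝒜 B) 1

theorem transport_zero : transport (0 : PathAlgebra 𝒜) = 1 := by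
  simp only [transport, map_zero, sub_zero, Ring.inverse_one, one_apply_eq_self]

/-- The difference quotient `(U(1) - 1) / t` of the solution of `U' = t U B`, `U(0) = 1`, which
extends to `t = 0` by `∫₀¹ B`. -/
def transportQuot (t : ℂ) (B : PathAlgebra 𝒜) : 𝒜 := totalIntegral 𝒜 (transport (t • B) * B)

theorem transportQuot_zero_left (B : PathAlgebra 𝒜) : transportQuot 0 B = totalIntegral 𝒜 B := by
  rw [transportQuot, zero_smul, transport_zero, one_mul]

variable [CompleteSpace 𝒜]

theorem transport_eq {B : PathAlgebra 𝒜} (hB : ‖B‖ < 1) :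
    transport B = 1 + volterra 𝒜 (transport B * B) := by
  have hu : IsUnit (1 - transportOp 𝒜 B) :=
    isUnit_one_sub_of_norm_lt_one ((norm_transportOp_apply_le B).trans_lt hB)
  exact sub_eq_iff_eq_add.1 <|
    congrArg (fun T : PathAlgebra 𝒜 →L[ℂ] PathAlgebra 𝒜 => T 1) (Ring.mul_inverse_cancel _ hu)

theorem transport_apply_zero {B : PathAlgebra 𝒜} (hB : ‖B‖ < 1) : transport B 0 = 1 := by
  rw [transport_eq hB, PathAlgebra.add_apply, volterra_apply, Set.Icc.coe_zero,
    intervalIntegral.integral_same, add_zero, PathAlgebra.one_apply]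

theorem hasDerivWithinAt_transport {B : PathAlgebra 𝒜} (hB : ‖B‖ < 1) {s : ℝ}
    (hs : s ∈ Set.Icc (0 : ℝ) 1) :
    HasDerivWithinAt (Set.IccExtend zero_le_one (transport B))
      (transport B ⟨s, hs⟩ * B ⟨s, hs⟩) (Set.Icc 0 1) s := by
  refine ((hasDerivWithinAt_volterra (transport B * B) hs).const_add 1).congr_of_mem
    (fun y hy => ?_) hs
  rw [Set.IccExtend_of_mem _ _ hy, Set.IccExtend_of_mem _ _ hy]
  exact congrArg (fun u : PathAlgebra 𝒜 => u ⟨y, hy⟩) (transport_eq hB)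

theorem hasStrictFDerivAt_transport_zero :
    HasStrictFDerivAt (transport : PathAlgebra 𝒜 → PathAlgebra 𝒜) (volterra 𝒜) 0 := by
  have h1 := (transportOp 𝒜).hasStrictFDerivAt (x := 0) |>.const_sub 1
  have h2 := hasStrictFDerivAt_ringInverse (𝕜 := ℂ) (1 : (PathAlgebra 𝒜 →L[ℂ] PathAlgebra 𝒜)ˣ)
  rw [show ((1 : (PathAlgebra 𝒜 →L[ℂ] PathAlgebra 𝒜)ˣ) : PathAlgebra 𝒜 →L[ℂ] PathAlgebra 𝒜) =
      1 - transportOp 𝒜 0 by simp only [map_zero, sub_zero, Units.val_one]] at h2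
  refine ((h2.comp 0 h1).clm_apply (hasStrictFDerivAt_const (1 : PathAlgebra 𝒜) 0)).congr_fderiv ?_
  ext1 H
  simp [transportOp_apply]

theorem transport_smul_apply_one {t : ℂ} {B : PathAlgebra 𝒜} (h : ‖t • B‖ < 1) :
    transport (t • B) 1 = 1 + t • transportQuot t B := by
  conv_lhs => rw [transport_eq h, mul_smul_comm, map_smul]
  rfl

theorem hasStrictFDerivAt_transportQuot (B : PathAlgebra 𝒜) :
    HasStrictFDerivAt (fun p : ℂ × PathAlgebra 𝒜 => transportQuot p.1 p.2)
      ((totalIntegral 𝒜).comp (ContinuousLinearMap.snd ℂ ℂ (PathAlgebra 𝒜)) +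
        (ContinuousLinearMap.fst ℂ ℂ (PathAlgebra 𝒜)).smulRight
          (totalIntegral 𝒜 (volterra 𝒜 B * B)))
      (0, B) := by
  have hsmul :=
    (hasStrictFDerivAt_fst (𝕜 := ℂ) (p := ((0 : ℂ), B))).fun_smul hasStrictFDerivAt_snd
  have htransport := hasStrictFDerivAt_transport_zero (𝒜 := 𝒜)
  rw [← zero_smul ℂ B] at htransport
  have h := (totalIntegral 𝒜).hasStrictFDerivAt.comp (0, B)
    ((htransport.comp ((0 : ℂ), B) hsmul).fun_mul' hasStrictFDerivAt_snd)
  refine h.congr_fderiv ?_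
  ext p <;> simp [transport_zero]

end Transport

/-! ### The logarithm in a Banach algebra -/

section Log

/-- The Taylor coefficients of `log (1 + z) / z`. -/
def logQuotCoeff (k : ℕ) : ℂ := (-1) ^ k / ((k : ℂ) + 1)

theorem norm_logQuotCoeff (k : ℕ) : ‖logQuotCoeff k‖ = ((k : ℝ) + 1)⁻¹ := by
  rw [logQuotCoeff, norm_div, norm_pow, norm_neg, norm_one, one_pow, one_div, ← Nat.cast_succ,
    Complex.norm_natCast, Nat.cast_succ]

theorem norm_logQuotCoeff_le_one (k : ℕ) : ‖logQuotCoeff k‖ ≤ 1 := by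
  rw [norm_logQuotCoeff]
  exact inv_le_one_of_one_le₀ (le_add_of_nonneg_left k.cast_nonneg)

theorem tendsto_norm_logQuotCoeff_succ_div :
    Filter.Tendsto (fun k => ‖logQuotCoeff k.succ‖ / ‖logQuotCoeff k‖) Filter.atTop (nhds 1) := by
  refine ((Filter.tendsto_add_atTop_iff_nat 1).2 (tendsto_natCast_div_add_atTop (1 : ℝ))).congr
    fun k => ?_
  simp only [norm_logQuotCoeff, Nat.cast_succ]
  field_simp

/-- The power series of `log (1 + X) / X`, which is `1` rather than undefined at `X = 0`. -/
def logQuot {𝒜 : Type*} [NormedRing 𝒜] [NormedAlgebra ℂ 𝒜] (X : 𝒜) : 𝒜 :=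
  ∑' k : ℕ, logQuotCoeff k • X ^ k

theorem logQuot_zero {𝒜 : Type*} [NormedRing 𝒜] [NormedAlgebra ℂ 𝒜] : logQuot (0 : 𝒜) = 1 := by
  rw [logQuot, tsum_eq_single 0 fun k hk => by rw [zero_pow hk, smul_zero]]
  simp [logQuotCoeff]

variable {𝒜 : Type*} [NormedRing 𝒜] [NormedAlgebra ℂ 𝒜]

theorem norm_neg_smul_lt_one {X : 𝒜} (hX : ‖X‖ < 1) {s : ℝ} (hs : s ∈ Set.Icc (0 : ℝ) 1) :
    ‖-((s : ℂ) • X)‖ < 1 := by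
  rw [norm_neg, norm_smul, Complex.norm_real, Real.norm_eq_abs, abs_of_nonneg hs.1]
  exact (mul_le_of_le_one_left (norm_nonneg _) hs.2).trans_lt hX

variable [CompleteSpace 𝒜]

theorem hasFPowerSeriesAt_logQuot : HasFPowerSeriesAt (logQuot : 𝒜 → 𝒜)
    (FormalMultilinearSeries.ofScalars 𝒜 logQuotCoeff) 0 := by
  have hradius : (1 : ENNReal) ≤ (FormalMultilinearSeries.ofScalars 𝒜 logQuotCoeff).radius := by
    simpa using FormalMultilinearSeries.inv_le_ofScalars_radius_of_tendsto (E := 𝒜)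
      logQuotCoeff (r := 1) one_ne_zero (by simpa using tendsto_norm_logQuotCoeff_succ_div)
  have hsum : (FormalMultilinearSeries.ofScalars 𝒜 logQuotCoeff).sum = (logQuot : 𝒜 → 𝒜) :=
    FormalMultilinearSeries.ofScalarsSum_eq_tsum logQuotCoeff
  rw [← hsum]
  exact (FormalMultilinearSeries.hasFPowerSeriesOnBall _
    (one_pos.trans_le hradius)).hasFPowerSeriesAt

theorem hasStrictFDerivAt_logQuot_zero :
    HasStrictFDerivAt (logQuot : 𝒜 → 𝒜) (-(1 / 2 : ℂ) • ContinuousLinearMap.id ℂ 𝒜) 0 := by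
  refine hasFPowerSeriesAt_logQuot.hasStrictFDerivAt.congr_fderiv ?_
  ext X
  simp [FormalMultilinearSeries.ofScalars, logQuotCoeff]
  norm_num

theorem summable_logQuot {X : 𝒜} (hX : ‖X‖ < 1) : Summable fun k => logQuotCoeff k • X ^ k := by
  rw [← summable_nat_add_iff 1]
  refine Summable.of_norm_bounded
    ((summable_geometric_of_lt_one (norm_nonneg X) hX).mul_right ‖X‖) fun k => ?_
  rw [norm_smul, ← pow_succ]
  exact (mul_le_of_le_one_left (norm_nonneg _) (norm_logQuotCoeff_le_one _)).trans
    (norm_pow_le' X k.succ_pos)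

theorem mul_logQuot_eq_tsum {X : 𝒜} (hX : ‖X‖ < 1) :
    X * logQuot X = ∑' k : ℕ, logQuotCoeff k • X ^ (k + 1) := by
  rw [logQuot, ← (summable_logQuot hX).tsum_mul_left]
  exact tsum_congr fun k => by rw [mul_smul_comm, pow_succ']

theorem map_logQuot {ℬ F : Type*} [NormedRing ℬ] [NormedAlgebra ℂ ℬ] [FunLike F 𝒜 ℬ]
    [RingHomClass F 𝒜 ℬ] (φ : F) (hφ : Continuous φ) {X : 𝒜} (hX : ‖X‖ < 1) :
    φ (logQuot X) = logQuot (φ X) := by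
  have hreal (k : ℕ) : logQuotCoeff k = (((-1) ^ k / (k + 1) : ℝ) : ℂ) := by
    simp [logQuotCoeff]
  refine ((summable_logQuot hX).hasSum.map φ hφ).tsum_eq.symm.trans (tsum_congr fun k => ?_)
  rw [Function.comp_apply, hreal, Complex.coe_smul, Complex.coe_smul, map_real_smul φ hφ, map_pow]

theorem isUnit_one_add_smul {X : 𝒜} (hX : ‖X‖ < 1) {s : ℝ} (hs : s ∈ Set.Icc (0 : ℝ) 1) :
    IsUnit (1 + (s : ℂ) • X) := by
  simpa using isUnit_one_sub_of_norm_lt_one (norm_neg_smul_lt_one hX hs)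

theorem mul_inverse_one_add_smul {X : 𝒜} (hX : ‖X‖ < 1) {s : ℝ} (hs : s ∈ Set.Icc (0 : ℝ) 1) :
    X * Ring.inverse (1 + (s : ℂ) • X) = ∑' k : ℕ, (-(s : ℂ)) ^ k • X ^ (k + 1) := by
  have hlt := norm_neg_smul_lt_one hX hs
  have hinverse : Ring.inverse (1 + (s : ℂ) • X) = ∑' k : ℕ, (-((s : ℂ) • X)) ^ k := by
    rw [← sub_neg_eq_add, NormedRing.inverse_one_sub _ hlt]
    rfl
  rw [hinverse, ← (summable_geometric_of_norm_lt_one hlt).tsum_mul_left]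
  exact tsum_congr fun k => by rw [← neg_smul, _root_.smul_pow, mul_smul_comm, pow_succ']

theorem integral_neg_pow_smul (Y : 𝒜) (k : ℕ) :
    ∫ s in (0 : ℝ)..1, (-(s : ℂ)) ^ k • Y = logQuotCoeff k • Y := by
  have hpow : ∀ s : ℝ, (-(s : ℂ)) ^ k = (-1) ^ k * ((s ^ k : ℝ) : ℂ) := fun s => by
    rw [neg_pow, Complex.ofReal_pow]
  rw [intervalIntegral.integral_smul_const]
  simp_rw [hpow]
  rw [intervalIntegral.integral_const_mul, intervalIntegral.integral_ofReal, integral_pow,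
    logQuotCoeff]
  simp [div_eq_mul_inv]

theorem mul_logQuot_eq_integral {X : 𝒜} (hX : ‖X‖ < 1) :
    X * logQuot X = ∫ s in (0 : ℝ)..1, X * Ring.inverse (1 + (s : ℂ) • X) := by
  let f : ℕ → C(ℝ, 𝒜) := fun k => ⟨fun s => (-(s : ℂ)) ^ k • X ^ (k + 1), by fun_prop⟩
  have hf : Summable fun k => ‖(f k).restrict (⟨Set.uIcc (0 : ℝ) 1, isCompact_uIcc⟩ :
      TopologicalSpace.Compacts ℝ)‖ := by
    refine Summable.of_nonneg_of_le (fun k => norm_nonneg _) (fun k => ?_)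
      ((summable_geometric_of_lt_one (norm_nonneg X) hX).mul_right ‖X‖)
    refine (ContinuousMap.norm_le _ (by positivity)).2 fun ⟨s, hs⟩ => ?_
    obtain ⟨hs0, hs1⟩ : s ∈ Set.Icc (0 : ℝ) 1 := by rwa [← Set.uIcc_of_le zero_le_one]
    calc ‖(-(s : ℂ)) ^ k • X ^ (k + 1)‖ = s ^ k * ‖X ^ (k + 1)‖ := by
          rw [norm_smul, norm_pow, norm_neg, Complex.norm_real, Real.norm_of_nonneg hs0]
      _ ≤ ‖X‖ ^ (k + 1) := (mul_le_of_le_one_left (norm_nonneg _) (pow_le_one₀ hs0 hs1)).trans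
          (norm_pow_le' X k.succ_pos)
      _ = ‖X‖ ^ k * ‖X‖ := pow_succ _ _
  calc X * logQuot X = ∑' k, ∫ s in (0 : ℝ)..1, f k s := by
        rw [mul_logQuot_eq_tsum hX]
        exact tsum_congr fun k => (integral_neg_pow_smul _ k).symm
    _ = ∫ s in (0 : ℝ)..1, ∑' k, f k s :=
        intervalIntegral.tsum_intervalIntegral_eq_of_summable_norm hf
    _ = ∫ s in (0 : ℝ)..1, X * Ring.inverse (1 + (s : ℂ) • X) :=
        intervalIntegral.integral_congr fun s hs =>
          (mul_inverse_one_add_smul hX (by rwa [← Set.uIcc_of_le zero_le_one])).symm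

theorem mul_inverse_one_add_smul_of_mul_eq_one {X Z : 𝒜} (hX : ‖X‖ < 1) (hZ : ‖Z‖ < 1)
    (h : (1 + X) * (1 + Z) = 1) {s : ℝ} (hs : s ∈ Set.Icc (0 : ℝ) 1) :
    Z * Ring.inverse (1 + (s : ℂ) • Z) =
      -(X * Ring.inverse (1 + ((1 - s : ℝ) : ℂ) • X)) := by
  have hu := isUnit_one_add_smul hX (s := 1 - s) ⟨by linarith [hs.2], by linarith [hs.1]⟩
  have hXZ : X * (1 + Z) = -Z := by
    have hsub : X * (1 + Z) = (1 + X) * (1 + Z) - (1 + Z) := by noncomm_ring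
    rw [hsub, h]
    abel
  have hfactor : 1 + (s : ℂ) • Z = (1 + ((1 - s : ℝ) : ℂ) • X) * (1 + Z) := by
    rw [add_mul, one_mul, smul_mul_assoc, hXZ]
    push_cast
    module
  symm
  rw [Ring.eq_mul_inverse_iff_mul_eq _ _ _ (isUnit_one_add_smul hZ hs), hfactor, neg_mul,
    mul_assoc, ← mul_assoc (Ring.inverse _), Ring.inverse_mul_cancel _ hu, one_mul, hXZ, neg_neg]

/-- With the integral formula for the logarithm, `log (1 + X)⁻¹ = -log (1 + X)` is the substitution
`s ↦ 1 - s`. -/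
theorem mul_logQuot_of_mul_eq_one {X Z : 𝒜} (hX : ‖X‖ < 1) (hZ : ‖Z‖ < 1)
    (h : (1 + X) * (1 + Z) = 1) : Z * logQuot Z = -(X * logQuot X) := by
  have hcongr : ∀ s ∈ Set.uIcc (0 : ℝ) 1, Z * Ring.inverse (1 + (s : ℂ) • Z) =
      -(X * Ring.inverse (1 + ((1 - s : ℝ) : ℂ) • X)) := fun s hs =>
    mul_inverse_one_add_smul_of_mul_eq_one hX hZ h (by rwa [← Set.uIcc_of_le zero_le_one])
  rw [mul_logQuot_eq_integral hX, mul_logQuot_eq_integral hZ,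
    intervalIntegral.integral_congr hcongr, intervalIntegral.integral_neg,
    intervalIntegral.integral_comp_sub_left (fun s : ℝ => X * Ring.inverse (1 + (s : ℂ) • X)) 1,
    sub_self, sub_zero]

/-- The quotient `log U(1) / t` for the solution of `U' = t U B`, `U(0) = 1`, which extends to
`t = 0` by `∫₀¹ B`. -/
def logTransport (t : ℂ) (B : PathAlgebra 𝒜) : 𝒜 :=
  transportQuot t B * logQuot (t • transportQuot t B)

omit [CompleteSpace 𝒜] in
theorem logTransport_zero_left (B : PathAlgebra 𝒜) : logTransport 0 B = totalIntegral 𝒜 B := by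
  rw [logTransport, zero_smul, logQuot_zero, mul_one, transportQuot_zero_left]

/-- The `t`-derivative at `0` of `logTransport t B`: the second term of the Magnus expansion. -/
def magnusTerm (B : PathAlgebra 𝒜) : 𝒜 :=
  totalIntegral 𝒜 (volterra 𝒜 B * B) - (1 / 2 : ℂ) • (totalIntegral 𝒜 B * totalIntegral 𝒜 B)

theorem hasStrictFDerivAt_logTransport (B : PathAlgebra 𝒜) :
    HasStrictFDerivAt (fun p : ℂ × PathAlgebra 𝒜 => logTransport p.1 p.2)
      ((totalIntegral 𝒜).comp (ContinuousLinearMap.snd ℂ ℂ (PathAlgebra 𝒜)) +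
        (ContinuousLinearMap.fst ℂ ℂ (PathAlgebra 𝒜)).smulRight (magnusTerm B)) (0, B) := by
  have hquot := hasStrictFDerivAt_transportQuot B
  have hsmul := (hasStrictFDerivAt_fst (𝕜 := ℂ) (p := ((0 : ℂ), B))).fun_smul hquot
  have hlog := hasStrictFDerivAt_logQuot_zero (𝒜 := 𝒜)
  rw [← zero_smul ℂ (transportQuot 0 B)] at hlog
  refine (hquot.fun_mul' (hlog.comp ((0 : ℂ), B) hsmul)).congr_fderiv ?_
  ext
  · simp [transportQuot_zero_left, logQuot_zero, magnusTerm]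
    module
  · simp [transportQuot_zero_left, logQuot_zero]

end Log

/-! ### Uniqueness of solutions and of Fourier coefficients -/

section ODE

theorem eqOn_Icc_of_hasDerivWithinAt_clm_apply {E : Type*} [NormedAddCommGroup E]
    [NormedSpace ℝ E] {a b : ℝ} {L : ℝ → E →L[ℝ] E} (hL : ContinuousOn L (Set.Icc a b))
    {u v : ℝ → E} (hu : ∀ s ∈ Set.Icc a b, HasDerivWithinAt u (L s (u s)) (Set.Icc a b) s)
    (hv : ∀ s ∈ Set.Icc a b, HasDerivWithinAt v (L s (v s)) (Set.Icc a b) s) (h : u a = v a) :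
    Set.EqOn u v (Set.Icc a b) := by
  obtain ⟨C, hC⟩ := isCompact_Icc.exists_bound_of_continuousOn hL
  have hlip : ∀ s ∈ Set.Ico a b, LipschitzOnWith C.toNNReal (L s) Set.univ := fun s hs =>
    ((L s).lipschitz.weaken (by
      simpa using Real.toNNReal_le_toNNReal (hC s ⟨hs.1, hs.2.le⟩))).lipschitzOnWith
  have hright : ∀ {w : ℝ → E},
      (∀ s ∈ Set.Icc a b, HasDerivWithinAt w (L s (w s)) (Set.Icc a b) s) →
      ∀ s ∈ Set.Ico a b, HasDerivWithinAt w (L s (w s)) (Set.Ici s) s := fun hw s hs =>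
    (hw s ⟨hs.1, hs.2.le⟩).mono_of_mem_nhdsWithin (Icc_mem_nhdsGE_of_mem hs)
  exact ODE_solution_unique_of_mem_Icc_right hlip
    (fun s hs => (hu s hs).continuousWithinAt) (hright hu) (fun _ _ => Set.mem_univ _)
    (fun s hs => (hv s hs).continuousWithinAt) (hright hv) (fun _ _ => Set.mem_univ _) h

open scoped Matrix.Norms.Elementwise in
theorem eqOn_Icc_of_hasDerivWithinAt_matrix_mul {ι : Type*} [Fintype ι] {a b : ℝ}
    {A Y Z : ℝ → Matrix ι ι ℂ} (hA : ∀ i j, ContinuousOn (fun s => A s i j) (Set.Icc a b))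
    (hY : ∀ s ∈ Set.Icc a b, ∀ i j,
      HasDerivWithinAt (fun u => Y u i j) ((Y s * A s) i j) (Set.Icc a b) s)
    (hZ : ∀ s ∈ Set.Icc a b, ∀ i j,
      HasDerivWithinAt (fun u => Z u i j) ((Z s * A s) i j) (Set.Icc a b) s)
    (h : Y a = Z a) : Set.EqOn Y Z (Set.Icc a b) := by
  classical
  let mulRightCLM : Matrix ι ι ℂ →ₗ[ℝ] Matrix ι ι ℂ →L[ℝ] Matrix ι ι ℂ :=
    LinearMap.toContinuousLinearMap.toLinearMap ∘ₗ (LinearMap.mul ℝ (Matrix ι ι ℂ)).flip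
  have hL : ContinuousOn (fun s => mulRightCLM (A s)) (Set.Icc a b) :=
    mulRightCLM.continuous_of_finiteDimensional.comp_continuousOn
      (continuousOn_pi.2 fun i => continuousOn_pi.2 fun j => hA i j)
  exact eqOn_Icc_of_hasDerivWithinAt_clm_apply hL
    (fun s hs => hasDerivWithinAt_pi.2 fun i => hasDerivWithinAt_pi.2 fun j => hY s hs i j)
    (fun s hs => hasDerivWithinAt_pi.2 fun i => hasDerivWithinAt_pi.2 fun j => hZ s hs i j) h

end ODE

section Fourier

theorem eq_fourierCoeff_of_hasSum {T : ℝ} [hT : Fact (0 < T)] {f : ℤ → ℂ}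
    {g : C(AddCircle T, ℂ)} (h : HasSum (fun k => f k • fourier k) g) (n : ℤ) :
    f n = fourierCoeff g n := by
  let coeffCLM : C(AddCircle T, ℂ) →L[ℂ] ℂ := (innerSL ℂ (fourierLp 2 n)).comp
    (ContinuousMap.toLp (E := ℂ) 2 AddCircle.haarAddCircle ℂ)
  have hcoeff : ∀ u, coeffCLM u = fourierCoeff u n := fun u => by
    rw [← fourierCoeff_toLp, ← fourierBasis_repr, HilbertBasis.repr_apply_apply, coe_fourierBasis]
    rfl
  have hterm : ∀ k, coeffCLM (f k • fourier k) = if k = n then f n else 0 := fun k => by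
    rw [map_smul, hcoeff, fourierCoeff_fourier, Pi.single_apply]
    aesop
  have hsum := (h.mapL coeffCLM).tsum_eq
  rwa [tsum_congr hterm, tsum_ite_eq, hcoeff] at hsum

theorem eq_zero_of_tsum_mul_zpow_eq_zero {f : ℤ → ℂ} (hf : Summable fun k => ‖f k‖)
    (h : ∀ l : ℂ, ‖l‖ = 1 → ∑' k, f k * l ^ k = 0) : f = 0 := by
  have : Fact ((0 : ℝ) < 1) := ⟨one_pos⟩
  have hsummable : Summable fun k : ℤ => f k • (fourier k : C(AddCircle (1 : ℝ), ℂ)) :=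
    Summable.of_norm (hf.congr fun k => by rw [norm_smul, fourier_norm, mul_one])
  have hzero : ∑' k : ℤ, f k • (fourier k : C(AddCircle (1 : ℝ), ℂ)) = 0 := by
    ext x
    rw [← ContinuousMap.tsum_apply hsummable, ContinuousMap.zero_apply,
      ← h (AddCircle.toCircle x) (Circle.norm_coe _)]
    exact tsum_congr fun k => by
      rw [ContinuousMap.smul_apply, fourier_apply, AddCircle.toCircle_zsmul, Circle.coe_zpow,
        smul_eq_mul]
  funext n
  have hsum := hsummable.hasSum
  rw [hzero] at hsum
  rw [eq_fourierCoeff_of_hasSum hsum n]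
  simp [fourierCoeff]

end Fourier

/-! ### The loop and the punctures -/

section RootsOfUnity

variable {K : Type*} [Field K] {ζ : K} {n : ℕ}

theorem sum_range_primitiveRoot_pow_pow (hζ : IsPrimitiveRoot ζ n) (e : ℕ) :
    ∑ j ∈ Finset.range n, (ζ ^ j) ^ e = if n ∣ e then (n : K) else 0 := by
  simp_rw [← pow_mul, mul_comm _ e, pow_mul]
  split_ifs with h
  · simp [(hζ.pow_eq_one_iff_dvd e).2 h]
  · rw [geom_sum_eq fun h' => h ((hζ.pow_eq_one_iff_dvd e).1 h'), ← pow_mul, mul_comm e, pow_mul,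
      hζ.pow_eq_one, one_pow, sub_self, zero_div]

theorem inv_sub_mul_pow_sub_one {w z : K} (hw : w ^ n = 1) (hz : z ^ n ≠ 1) :
    (z - w)⁻¹ * (z ^ n - 1) = ∑ i ∈ Finset.range n, z ^ i * w ^ (n - 1 - i) := by
  have hne : z - w ≠ 0 := fun h => hz (sub_eq_zero.1 h ▸ hw)
  rw [← hw, ← geom_sum₂_mul, mul_comm, mul_assoc, mul_inv_cancel₀ hne, mul_one]

theorem sum_primitiveRoot_pow_mul_inv_sub (hζ : IsPrimitiveRoot ζ n) {k : ℕ} (hk : k < n) {z : K}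
    (hz : z ^ n ≠ 1) :
    ∑ j ∈ Finset.range n, (ζ ^ j) ^ (k + 1) * (z - ζ ^ j)⁻¹ = n * z ^ k / (z ^ n - 1) := by
  have hterm : ∀ j, (ζ ^ j) ^ (k + 1) * (z - ζ ^ j)⁻¹ * (z ^ n - 1) =
      ∑ i ∈ Finset.range n, z ^ i * (ζ ^ j) ^ (k + 1 + (n - 1 - i)) := fun j => by
    have hw : (ζ ^ j) ^ n = 1 := by rw [pow_right_comm, hζ.pow_eq_one, one_pow]
    rw [mul_assoc, inv_sub_mul_pow_sub_one hw hz, Finset.mul_sum]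
    exact Finset.sum_congr rfl fun i _ => by rw [pow_add _ (k + 1), mul_left_comm]
  have hdvd : ∀ i < n, n ∣ k + 1 + (n - 1 - i) ↔ i = k := fun i hi => by
    refine ⟨fun ⟨d, hd⟩ => ?_, fun h => ⟨1, by omega⟩⟩
    have hd1 : n * d < n * 2 := by omega
    obtain rfl : d = 1 := by
      have := lt_of_mul_lt_mul_left hd1 n.zero_le
      interval_cases d <;> omega
    omega
  rw [eq_div_iff (sub_ne_zero.2 hz), Finset.sum_mul, Finset.sum_congr rfl fun j _ => hterm j,
    Finset.sum_comm]
  simp_rw [← Finset.mul_sum, sum_range_primitiveRoot_pow_pow hζ]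
  rw [Finset.sum_eq_single_of_mem k (Finset.mem_range.2 hk) fun i hi hik => by
    rw [if_neg (mt (hdvd i (Finset.mem_range.1 hi)).1 hik), mul_zero],
    if_pos ((hdvd k hk).2 rfl), mul_comm]

end RootsOfUnity

section Punctures

theorem puncture_zero (m : ℕ) : puncture m 0 = 1 := by simp [puncture]

theorem puncture_ne_zero (m j : ℕ) : puncture m j ≠ 0 := Complex.exp_ne_zero _

theorem puncture_eq_pow (m j : ℕ) : puncture m j = puncture m 1 ^ j := by
  rw [puncture, puncture, ← Complex.exp_nat_mul]
  congr 1
  push_cast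
  ring

theorem isPrimitiveRoot_puncture_one (m : ℕ) : IsPrimitiveRoot (puncture m 1) (2 * m + 2) := by
  convert Complex.isPrimitiveRoot_exp (2 * m + 2) (by omega) using 1
  simp [puncture]

theorem puncture_succ (m j : ℕ) : puncture m (j + 1) = puncture m j * puncture m 1 := by
  rw [puncture_eq_pow, puncture_eq_pow m j, pow_succ]

theorem puncture_pow_card (m j : ℕ) : puncture m j ^ (2 * m + 2) = 1 := by
  rw [puncture_eq_pow, pow_right_comm, (isPrimitiveRoot_puncture_one m).pow_eq_one, one_pow]

theorem puncture_mod_card (m j : ℕ) : puncture m (j % (2 * m + 2)) = puncture m j := by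
  rw [puncture_eq_pow, puncture_eq_pow m j, ← pow_mod_orderOf _ j,
    ← (isPrimitiveRoot_puncture_one m).eq_orderOf]

theorem pow_card_eq_one_iff {m : ℕ} {z : ℂ} : z ^ (2 * m + 2) = 1 ↔ ∃ j, z = puncture m j := by
  refine ⟨fun h => ?_, fun ⟨j, h⟩ => h ▸ puncture_pow_card m j⟩
  obtain ⟨j, -, hj⟩ := (isPrimitiveRoot_puncture_one m).eq_pow_of_pow_eq_one h
  exact ⟨j, by rw [puncture_eq_pow, hj]⟩

theorem puncture_eq_exp_ofReal_mul_I (m j : ℕ) :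
    puncture m j = Complex.exp (((2 * Real.pi * j / (2 * m + 2) : ℝ) : ℂ) * Complex.I) := by
  rw [puncture]
  congr 1
  push_cast
  ring

theorem norm_puncture (m j : ℕ) : ‖puncture m j‖ = 1 := by
  rw [puncture_eq_exp_ofReal_mul_I, Complex.norm_exp_ofReal_mul_I]

theorem sum_puncture_pow_mul_inv_sub {m k : ℕ} (hk : k < 2 * m + 2) {z : ℂ}
    (hz : z ^ (2 * m + 2) ≠ 1) :
    ∑ j ∈ Finset.range (2 * m + 2), puncture m j ^ (k + 1) * (z - puncture m j)⁻¹ =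
      ((2 * m + 2 : ℕ) : ℂ) * z ^ k / (z ^ (2 * m + 2) - 1) := by
  have h := sum_primitiveRoot_pow_mul_inv_sub (isPrimitiveRoot_puncture_one m) hk hz
  simpa only [← puncture_eq_pow] using h

end Punctures

section LoopGeometry

theorem norm_exp_ofReal_mul_I_sub_ofReal_sq (c θ : ℝ) :
    ‖Complex.exp (θ * Complex.I) - c‖ ^ 2 = 1 - 2 * c * Real.cos θ + c ^ 2 := by
  rw [← Complex.normSq_eq_norm_sq, Complex.normSq_apply, Complex.sub_re, Complex.sub_im,
    Complex.exp_ofReal_mul_I_re, Complex.exp_ofReal_mul_I_im, Complex.ofReal_re, Complex.ofReal_im]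
  linear_combination Real.sin_sq_add_cos_sq θ

/-- The centre, equal to the radius, of the circle `γ₀`. -/
def loopRadius (m : ℕ) : ℝ := 1 / (2 * Real.cos (Real.pi / (2 * m + 2)))

variable {m : ℕ}

theorem cos_pi_div_card_pos (hm : 1 ≤ m) : 0 < Real.cos (Real.pi / (2 * m + 2)) := by
  have hm' : (1 : ℝ) ≤ m := by exact_mod_cast hm
  refine Real.cos_pos_of_mem_Ioo ⟨?_, ?_⟩
  · have : 0 < Real.pi / (2 * m + 2) := by positivity
    linarith [Real.pi_pos]
  · exact div_lt_div_of_pos_left Real.pi_pos two_pos (by linarith)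

theorem loopRadius_pos (hm : 1 ≤ m) : 0 < loopRadius m :=
  one_div_pos.2 (mul_pos two_pos (cos_pi_div_card_pos hm))

theorem two_mul_loopRadius_mul_cos (hm : 1 ≤ m) :
    2 * loopRadius m * Real.cos (Real.pi / (2 * m + 2)) = 1 := by
  have hcos := mul_ne_zero two_ne_zero (cos_pi_div_card_pos hm).ne'
  rw [loopRadius, mul_right_comm, mul_one_div_cancel hcos]

theorem cos_puncture_arg_lt {j : ℕ} (hj : 1 ≤ j) (hj' : j < 2 * m + 2) :
    Real.cos (2 * Real.pi * j / (2 * m + 2)) < Real.cos (Real.pi / (2 * m + 2)) := by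
  have hupper : ∀ i : ℕ, 1 ≤ i → i ≤ m + 1 →
      Real.cos (2 * Real.pi * i / (2 * m + 2)) < Real.cos (Real.pi / (2 * m + 2)) := by
    intro i hi hi'
    have h1 : (1 : ℝ) ≤ i := by exact_mod_cast hi
    have h2 : (i : ℝ) ≤ m + 1 := by exact_mod_cast hi'
    refine Real.cos_lt_cos_of_nonneg_of_le_pi (by positivity) ?_ ?_
    · rw [div_le_iff₀ (by positivity)]
      nlinarith [Real.pi_pos]
    · rw [div_lt_div_iff_of_pos_right (by positivity)]
      nlinarith [Real.pi_pos]
  rcases le_or_gt j (m + 1) with h | h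
  · exact hupper j hj h
  · have hreflect : 2 * Real.pi * ((2 * m + 2 - j : ℕ) : ℝ) / (2 * m + 2) =
        2 * Real.pi - 2 * Real.pi * j / (2 * m + 2) := by
      rw [Nat.cast_sub hj'.le]
      push_cast
      field_simp
    rw [← Real.cos_two_pi_sub, ← hreflect]
    exact hupper (2 * m + 2 - j) (by omega) (by omega)

theorem loopRadius_lt_norm_puncture_sub (hm : 1 ≤ m) {j : ℕ} (hj : 1 ≤ j) (hj' : j < 2 * m + 2) :
    loopRadius m < ‖puncture m j - loopRadius m‖ := by
  have hpos := loopRadius_pos hm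
  refine lt_of_pow_lt_pow_left₀ 2 (norm_nonneg _) ?_
  rw [puncture_eq_exp_ofReal_mul_I, norm_exp_ofReal_mul_I_sub_ofReal_sq]
  nlinarith [cos_puncture_arg_lt hj hj', two_mul_loopRadius_mul_cos hm]

theorem one_mem_ball_loopRadius (hm : 1 ≤ m) :
    (1 : ℂ) ∈ Metric.ball (loopRadius m : ℂ) (loopRadius m) := by
  have hpos := loopRadius_pos hm
  have hcos : Real.cos (Real.pi / (2 * m + 2)) < 1 := by
    rw [← Real.cos_zero]
    exact Real.cos_lt_cos_of_nonneg_of_le_pi le_rfl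
      (div_le_self Real.pi_pos.le (by linarith [m.cast_nonneg (α := ℝ)])) (by positivity)
  have hsq := norm_exp_ofReal_mul_I_sub_ofReal_sq (loopRadius m) 0
  rw [Complex.ofReal_zero, zero_mul, Complex.exp_zero, Real.cos_zero] at hsq
  rw [Metric.mem_ball, dist_eq_norm]
  refine lt_of_pow_lt_pow_left₀ 2 hpos.le ?_
  rw [hsq]
  nlinarith [two_mul_loopRadius_mul_cos hm]

theorem ne_puncture_of_mem_closedBall (hm : 1 ≤ m) {j : ℕ} (hj : 1 ≤ j) (hj' : j < 2 * m + 2)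
    {z : ℂ} (hz : z ∈ Metric.closedBall (loopRadius m : ℂ) (loopRadius m)) :
    z ≠ puncture m j := by
  rintro rfl
  rw [Metric.mem_closedBall, dist_eq_norm] at hz
  exact (loopRadius_lt_norm_puncture_sub hm hj hj').not_ge hz

variable (m)

theorem loop_zero : loop m 0 = 0 := by simp [loop]

theorem loop_one : loop m 1 = 0 := by simp [loop, Complex.exp_two_pi_mul_I]

theorem loop_eq_circleMap (s : ℝ) :
    loop m s = circleMap (loopRadius m) (loopRadius m) (2 * Real.pi * s + Real.pi) := by
  rw [loop, ← loopRadius, circleMap]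
  push_cast
  rw [add_mul, Complex.exp_add, Complex.exp_pi_mul_I]
  ring_nf

theorem hasDerivAt_loop (s : ℝ) :
    HasDerivAt (loop m) (2 * Real.pi *
      deriv (circleMap (loopRadius m) (loopRadius m)) (2 * Real.pi * s + Real.pi)) s := by
  have harg : HasDerivAt (fun s : ℝ => 2 * Real.pi * s + Real.pi) (2 * Real.pi) s := by
    simpa using ((hasDerivAt_id s).const_mul (2 * Real.pi)).add_const Real.pi
  have hcircle := (differentiable_circleMap (loopRadius m : ℂ) (loopRadius m)
    (2 * Real.pi * s + Real.pi)).hasDerivAt.scomp s harg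
  rw [Complex.real_smul, Complex.ofReal_mul, Complex.ofReal_ofNat] at hcircle
  exact hcircle.congr_of_eventuallyEq (.of_forall (loop_eq_circleMap m))

theorem continuous_loop : Continuous (loop m) :=
  continuous_iff_continuousAt.2 fun s => (hasDerivAt_loop m s).continuousAt

theorem continuous_deriv_loop : Continuous (deriv (loop m)) := by
  simp_rw [funext fun s => (hasDerivAt_loop m s).deriv, deriv_circleMap]
  fun_prop

theorem integral_deriv_loop_mul (f : ℂ → ℂ) :
    ∫ s in (0 : ℝ)..1, deriv (loop m) s * f (loop m s) =
      ∮ z in C(loopRadius m, loopRadius m), f z := by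
  let g : ℝ → ℂ := fun θ => deriv (circleMap (loopRadius m) (loopRadius m)) θ •
    f (circleMap (loopRadius m) (loopRadius m) θ)
  have hg : Function.Periodic g (2 * Real.pi) := fun θ => by
    simp only [g, deriv_circleMap, periodic_circleMap _ _ θ]
  have hintegrand : ∀ s : ℝ, deriv (loop m) s * f (loop m s) =
      (2 * Real.pi) • g (2 * Real.pi * s + Real.pi) := fun s => by
    rw [(hasDerivAt_loop m s).deriv, loop_eq_circleMap, mul_assoc, Complex.real_smul,
      Complex.ofReal_mul, Complex.ofReal_ofNat]
    rfl
  simp_rw [hintegrand]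
  rw [intervalIntegral.integral_smul, intervalIntegral.smul_integral_comp_mul_add, mul_zero,
    mul_one, zero_add, add_comm (2 * Real.pi), hg.intervalIntegral_add_eq Real.pi 0, zero_add]
  rfl

variable {m}

theorem norm_loop_sub_loopRadius (hm : 1 ≤ m) (s : ℝ) :
    ‖loop m s - loopRadius m‖ = loopRadius m := by
  rw [loop_eq_circleMap, circleMap_sub_center, norm_circleMap_zero,
    abs_of_pos (loopRadius_pos hm)]

theorem loop_mem_closedBall (hm : 1 ≤ m) (s : ℝ) :
    loop m s ∈ Metric.closedBall (loopRadius m : ℂ) (loopRadius m) := by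
  rw [Metric.mem_closedBall, dist_eq_norm, norm_loop_sub_loopRadius hm]

theorem loop_ne_puncture (m j : ℕ) (s : ℝ) : loop m s ≠ puncture m j := by
  rcases Nat.eq_zero_or_pos m with rfl | hm
  -- For `m = 0` the radius is the junk value `1 / 0 = 0`, and the loop is constant.
  · have hloop : loop 0 s = 0 := by simp [loop]
    exact hloop ▸ (puncture_ne_zero 0 j).symm
  rw [← puncture_mod_card]
  have hlt : j % (2 * m + 2) < 2 * m + 2 := Nat.mod_lt _ (by omega)
  rcases Nat.eq_zero_or_pos (j % (2 * m + 2)) with hj | hj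
  · rw [hj, puncture_zero]
    intro h
    have hball := one_mem_ball_loopRadius hm
    rw [← h, Metric.mem_ball, dist_eq_norm, norm_loop_sub_loopRadius hm] at hball
    exact lt_irrefl _ hball
  · exact ne_puncture_of_mem_closedBall hm hj hlt (loop_mem_closedBall hm s)

theorem loop_pow_card_ne_one (m : ℕ) (s : ℝ) : loop m s ^ (2 * m + 2) ≠ 1 := fun h =>
  (pow_card_eq_one_iff.1 h).elim fun j => loop_ne_puncture m j s

end LoopGeometry

/-! ### Iterated integrals along the loop -/

section IteratedIntegrals

theorem totalIntegral_volterra_mul_add {𝒜 : Type*} [NormedRing 𝒜] [NormedAlgebra ℂ 𝒜]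
    [CompleteSpace 𝒜] (u v : PathAlgebra 𝒜) :
    totalIntegral 𝒜 (volterra 𝒜 u * v) + totalIntegral 𝒜 (u * volterra 𝒜 v) =
      totalIntegral 𝒜 u * totalIntegral 𝒜 v := by
  have hderiv : ∀ s ∈ Set.Ioo (0 : ℝ) 1, HasDerivAt
      (fun s => Set.IccExtend zero_le_one (volterra 𝒜 u) s *
        Set.IccExtend zero_le_one (volterra 𝒜 v) s)
      (Set.IccExtend zero_le_one (volterra 𝒜 u * v + u * volterra 𝒜 v) s) s := fun s hs => by
    have hs' := Set.Ioo_subset_Icc_self hs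
    have h := ((hasDerivWithinAt_volterra u hs').mul (hasDerivWithinAt_volterra v hs')).hasDerivAt
      (Icc_mem_nhds hs.1 hs.2)
    simp only [Set.IccExtend_of_mem _ _ hs'] at h ⊢
    rwa [PathAlgebra.add_apply, PathAlgebra.mul_apply, PathAlgebra.mul_apply, add_comm]
  have hcont : ∀ w : PathAlgebra 𝒜, Continuous (Set.IccExtend zero_le_one w) :=
    fun w => w.continuous.Icc_extend'
  have hint := intervalIntegral.integral_eq_sub_of_hasDerivAt_of_le zero_le_one
    ((hcont _).mul (hcont _)).continuousOn hderiv ((hcont _).intervalIntegrable _ _)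
  have hzero : volterra 𝒜 u 0 = 0 := by rw [volterra_apply]; exact intervalIntegral.integral_same
  rw [← map_add, totalIntegral_eq_integral fun s => (Set.IccExtend_val zero_le_one _ s).symm, hint,
    Pi.mul_apply, Pi.mul_apply, Set.IccExtend_of_mem _ _ (Set.right_mem_Icc.2 zero_le_one),
    Set.IccExtend_of_mem _ _ (Set.right_mem_Icc.2 zero_le_one),
    Set.IccExtend_of_mem _ _ (Set.left_mem_Icc.2 zero_le_one)]
  exact (congrArg _ (mul_eq_zero_of_left hzero _)).trans (sub_zero _)

/-- The iterated integral `∫₀¹ (∫₀ˢ u) v ds`. -/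
def iterInt (u v : PathAlgebra ℂ) : ℂ := totalIntegral ℂ (volterra ℂ u * v)

theorem iterInt_sub_iterInt_swap {u v : PathAlgebra ℂ} (hv : totalIntegral ℂ v = 0) :
    iterInt u v - iterInt v u = -2 * totalIntegral ℂ (volterra ℂ v * u) := by
  have h := totalIntegral_volterra_mul_add u v
  have hcomm : u * volterra ℂ v = volterra ℂ v * u := PathAlgebra.ext fun s => mul_comm _ _
  rw [hv, mul_zero, hcomm] at h
  rw [iterInt, iterInt]
  linear_combination h

end IteratedIntegrals

section LoopForms

variable {m : ℕ}

theorem circleIntegral_mul_inv_sub_puncture (hm : 1 ≤ m) {j : ℕ} (hj : j < 2 * m + 2) {f : ℂ → ℂ}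
    (hf : DifferentiableOn ℂ f (Metric.closedBall (loopRadius m : ℂ) (loopRadius m))) :
    ∮ z in C(loopRadius m, loopRadius m), f z * (z - puncture m j)⁻¹ =
      if j = 0 then 2 * Real.pi * Complex.I * f 1 else 0 := by
  split_ifs with h
  · simpa only [h, puncture_zero, smul_eq_mul, mul_comm (f _)] using
      hf.circleIntegral_sub_inv_smul (one_mem_ball_loopRadius hm)
  · have hne : ∀ z ∈ Metric.closedBall (loopRadius m : ℂ) (loopRadius m), z - puncture m j ≠ 0 :=
      fun z hz => sub_ne_zero.2
        (ne_puncture_of_mem_closedBall hm (Nat.one_le_iff_ne_zero.2 h) hj hz)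
    exact (hf.mul ((differentiableOn_id.sub_const _).inv hne)).diffContOnCl_ball
      subset_rfl |>.circleIntegral_eq_zero (loopRadius_pos hm).le

/-- The form `zᵏ dz / (z - p_j)` pulled back to `[0, 1]` by the loop. -/
def loopForm (m j k : ℕ) : PathAlgebra ℂ :=
  (⟨fun s => deriv (loop m) s * (loop m s ^ k * (loop m s - puncture m j)⁻¹),
    ((continuous_deriv_loop m).mul (((continuous_loop m).pow k).mul
      (((continuous_loop m).sub continuous_const).inv₀ fun s =>
        sub_ne_zero.2 (loop_ne_puncture m j s)))).comp continuous_subtype_val⟩ : C(I, ℂ))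

theorem loopForm_apply (m j k : ℕ) (s : I) :
    loopForm m j k s = deriv (loop m) s * (loop m s ^ k * (loop m s - puncture m j)⁻¹) := rfl

theorem totalIntegral_mul_loopForm (hm : 1 ≤ m) {j : ℕ} (hj : j < 2 * m + 2) {f : ℂ → ℂ}
    (hf : DifferentiableOn ℂ f (Metric.closedBall (loopRadius m : ℂ) (loopRadius m)))
    {u : PathAlgebra ℂ} (hu : ∀ s : I, u s = f (loop m s)) (k : ℕ) :
    totalIntegral ℂ (u * loopForm m j k) =
      if j = 0 then 2 * Real.pi * Complex.I * f 1 else 0 := by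
  have hCauchy := circleIntegral_mul_inv_sub_puncture hm hj
    (hf.mul (differentiable_id.pow k).differentiableOn)
  rw [Pi.mul_apply, Pi.pow_apply, id, one_pow, mul_one] at hCauchy
  rw [← hCauchy, ← integral_deriv_loop_mul]
  refine totalIntegral_eq_integral fun s => ?_
  rw [PathAlgebra.mul_apply, hu, loopForm_apply, Pi.mul_apply, Pi.pow_apply, id]
  ring

theorem totalIntegral_loopForm (hm : 1 ≤ m) {j : ℕ} (hj : j < 2 * m + 2) (k : ℕ) :
    totalIntegral ℂ (loopForm m j k) = if j = 0 then 2 * Real.pi * Complex.I else 0 := by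
  simpa only [one_mul, mul_one] using
    totalIntegral_mul_loopForm hm hj (differentiableOn_const 1) PathAlgebra.one_apply k

/-- The form `n zᵏ dz / (zⁿ - 1)`, `n = 2m + 2`, pulled back to `[0, 1]` by the loop; it is
encoded by its partial fractions. -/
def cyclotomicForm (m k : ℕ) : PathAlgebra ℂ :=
  ∑ j ∈ Finset.range (2 * m + 2), puncture m j • loopForm m j k

theorem sum_puncture_pow_smul_loopForm_apply {i : ℕ} (hi : i < 2 * m + 2) (k : ℕ) (s : I) :
    (∑ j ∈ Finset.range (2 * m + 2), puncture m j ^ (i + 1) • loopForm m j k) s =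
      deriv (loop m) s *
        (((2 * m + 2 : ℕ) : ℂ) * loop m s ^ (i + k) / (loop m s ^ (2 * m + 2) - 1)) := by
  calc _ = deriv (loop m) s * loop m s ^ k * ∑ j ∈ Finset.range (2 * m + 2),
          puncture m j ^ (i + 1) * (loop m s - puncture m j)⁻¹ := by
        rw [PathAlgebra.sum_apply, Finset.mul_sum]
        refine Finset.sum_congr rfl fun j _ => ?_
        rw [PathAlgebra.smul_apply, loopForm_apply, smul_eq_mul]
        ring
    _ = _ := by
        rw [sum_puncture_pow_mul_inv_sub hi (loop_pow_card_ne_one m s), pow_add]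
        ring

theorem cyclotomicForm_apply (m k : ℕ) (s : I) :
    cyclotomicForm m k s = deriv (loop m) s *
      (((2 * m + 2 : ℕ) : ℂ) * loop m s ^ k / (loop m s ^ (2 * m + 2) - 1)) := by
  simpa only [cyclotomicForm, zero_add, pow_one] using
    sum_puncture_pow_smul_loopForm_apply (m := m) (i := 0) (by omega) k s

theorem sum_puncture_pow_smul_loopForm {i : ℕ} (hi : i < 2 * m + 2) (k : ℕ) :
    ∑ j ∈ Finset.range (2 * m + 2), puncture m j ^ (i + 1) • loopForm m j k =
      cyclotomicForm m (i + k) :=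
  PathAlgebra.ext fun s => by
    rw [sum_puncture_pow_smul_loopForm_apply hi, cyclotomicForm_apply]

theorem totalIntegral_mul_cyclotomicForm (hm : 1 ≤ m) {f : ℂ → ℂ}
    (hf : DifferentiableOn ℂ f (Metric.closedBall (loopRadius m : ℂ) (loopRadius m)))
    {u : PathAlgebra ℂ} (hu : ∀ s : I, u s = f (loop m s)) (k : ℕ) :
    totalIntegral ℂ (u * cyclotomicForm m k) = 2 * Real.pi * Complex.I * f 1 := by
  have hterm : ∀ j ∈ Finset.range (2 * m + 2),
      totalIntegral ℂ (u * puncture m j • loopForm m j k) =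
        if j = 0 then 2 * Real.pi * Complex.I * f 1 else 0 := fun j hj => by
    rw [mul_smul_comm, map_smul, totalIntegral_mul_loopForm hm (Finset.mem_range.1 hj) hf hu]
    split_ifs with h
    · rw [h, puncture_zero, one_smul]
    · rw [smul_zero]
  rw [cyclotomicForm, Finset.mul_sum, map_sum, Finset.sum_congr rfl hterm,
    Finset.sum_ite_eq' _ 0, if_pos (Finset.mem_range.2 (by omega))]

end LoopForms

section Kappa

variable {m : ℕ}

/-- The function `n (1 - zᵐ)² / (zⁿ - 1)`, `n = 2m + 2`, whose integral over `[0, 1]` is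
`-2 κ_m`. It is encoded by its partial fractions, which give the right value at the removable
singularity `z = 1`. -/
def kappaForm (m : ℕ) (z : ℂ) : ℂ := ∑ j ∈ Finset.range (2 * m + 2),
  (puncture m j - 2 * puncture m j ^ (m + 1) + puncture m j ^ (2 * m + 1)) * (z - puncture m j)⁻¹

theorem kappaForm_eq_div {z : ℂ} (hz : z ^ (2 * m + 2) ≠ 1) :
    kappaForm m z =
      ((2 * m + 2 : ℕ) : ℂ) * (1 - 2 * z ^ m + z ^ (2 * m)) / (z ^ (2 * m + 2) - 1) := by
  have h0 := sum_puncture_pow_mul_inv_sub (k := 0) (by omega) hz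
  have hm := sum_puncture_pow_mul_inv_sub (k := m) (by omega) hz
  have h2m := sum_puncture_pow_mul_inv_sub (k := 2 * m) (by omega) hz
  simp only [zero_add, pow_one, pow_zero] at h0
  simp only [kappaForm, add_mul, sub_mul, Finset.sum_add_distrib, Finset.sum_sub_distrib,
    mul_assoc, ← Finset.mul_sum, h0, hm, h2m]
  ring

theorem kappaForm_ofReal {x : ℝ} (hx : x ∈ Set.Ioo (0 : ℝ) 1) :
    kappaForm m x = ((-((2 * m + 2 : ℝ) * ((1 - x ^ m) ^ 2 / (1 - x ^ (2 * m + 2)))) : ℝ) : ℂ) := by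
  have hlt : x ^ (2 * m + 2) < 1 := pow_lt_one₀ hx.1.le hx.2 (by omega)
  rw [kappaForm_eq_div (by exact_mod_cast hlt.ne), ← neg_sub 1 (x ^ (2 * m + 2) : ℂ), div_neg]
  push_cast
  ring

theorem differentiableAt_kappaForm {z : ℂ} (hz : ∀ j, 1 ≤ j → j < 2 * m + 2 → z ≠ puncture m j) :
    DifferentiableAt ℂ (kappaForm m) z := by
  refine DifferentiableAt.fun_sum fun j hj => ?_
  rcases Nat.eq_zero_or_pos j with rfl | h
  · have hcoeff : puncture m 0 - 2 * puncture m 0 ^ (m + 1) + puncture m 0 ^ (2 * m + 1) = 0 := by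
      rw [puncture_zero]
      ring
    simp_rw [hcoeff, zero_mul]
    exact differentiableAt_const _
  · have := sub_ne_zero.2 (hz j h (Finset.mem_range.1 hj))
    fun_prop (disch := assumption)

theorem continuousOn_kappaForm (hm : 1 ≤ m) :
    ContinuousOn (kappaForm m) (Metric.closedBall (loopRadius m : ℂ) (loopRadius m)) :=
  fun _ hz => (differentiableAt_kappaForm fun _ h1 h2 =>
    ne_puncture_of_mem_closedBall hm h1 h2 hz).continuousAt.continuousWithinAt

theorem exists_primitive_kappaForm (hm : 1 ≤ m) : ∃ h : ℂ → ℂ, h 0 = 0 ∧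
    ∀ z ∈ Metric.closedBall (loopRadius m : ℂ) (loopRadius m), HasDerivAt h (kappaForm m z) z := by
  let S : Set ℂ := ((Finset.Ico 1 (2 * m + 2)).image (puncture m) : Finset ℂ)
  have hS : IsOpen Sᶜ := (Finset.finite_toSet _).isClosed.isOpen_compl
  have hmem : ∀ z, z ∈ Sᶜ ↔ ∀ j, 1 ≤ j → j < 2 * m + 2 → z ≠ puncture m j := fun z => by
    simp [S, eq_comm]
  have hsub : Metric.closedBall (loopRadius m : ℂ) (loopRadius m) ⊆ Sᶜ := fun z hz =>
    (hmem z).2 fun _ h1 h2 => ne_puncture_of_mem_closedBall hm h1 h2 hz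
  obtain ⟨δ, hδ, hthick⟩ :=
    (isCompact_closedBall (loopRadius m : ℂ) (loopRadius m)).exists_thickening_subset_open hS hsub
  rw [thickening_closedBall hδ (loopRadius_pos hm).le] at hthick
  have hd : DifferentiableOn ℂ (kappaForm m) (Metric.ball (loopRadius m : ℂ) (δ + loopRadius m)) :=
    fun z hz => (differentiableAt_kappaForm ((hmem z).1 (hthick hz))).differentiableWithinAt
  obtain ⟨h, h0, hh⟩ := hd.isExactOn_ball.with_val_at 0 0
  exact ⟨h, h0, fun z hz => hh z (Metric.closedBall_subset_ball (by linarith) hz)⟩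

theorem ofReal_mem_closedBall_loopRadius (hm : 1 ≤ m) {x : ℝ} (hx : x ∈ Set.Icc (0 : ℝ) 1) :
    (x : ℂ) ∈ Metric.closedBall (loopRadius m : ℂ) (loopRadius m) := by
  have h1 := one_mem_ball_loopRadius hm
  rw [Metric.mem_ball, ← Complex.ofReal_one, Complex.dist_of_im_eq (by simp), Real.dist_eq,
    abs_lt] at h1
  rw [Metric.mem_closedBall, Complex.dist_of_im_eq (by simp), Real.dist_eq, abs_le]
  simp only [Complex.ofReal_re] at h1 ⊢
  constructor <;> linarith [hx.1, hx.2, h1.1, h1.2]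

theorem integral_kappaForm (m : ℕ) : ∫ x in (0 : ℝ)..1, kappaForm m x = -(2 * kappa m : ℝ) := by
  have hcongr : ∫ x in (0 : ℝ)..1, kappaForm m x = ∫ x in (0 : ℝ)..1,
      ((-((2 * m + 2 : ℝ) * ((1 - x ^ m) ^ 2 / (1 - x ^ (2 * m + 2)))) : ℝ) : ℂ) := by
    simp only [intervalIntegral.integral_of_le zero_le_one,
      MeasureTheory.integral_Ioc_eq_integral_Ioo]
    exact MeasureTheory.setIntegral_congr_fun measurableSet_Ioo fun x hx => kappaForm_ofReal hx
  rw [hcongr, intervalIntegral.integral_ofReal, intervalIntegral.integral_neg,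
    intervalIntegral.integral_const_mul, kappa]
  push_cast
  ring

theorem primitive_kappaForm_one (hm : 1 ≤ m) {h : ℂ → ℂ} (h0 : h 0 = 0)
    (hh : ∀ z ∈ Metric.closedBall (loopRadius m : ℂ) (loopRadius m),
      HasDerivAt h (kappaForm m z) z) : h 1 = -(2 * kappa m : ℝ) := by
  have hderiv : ∀ x ∈ Set.uIcc (0 : ℝ) 1, HasDerivAt (fun x : ℝ => h x) (kappaForm m x) x := by
    rw [Set.uIcc_of_le zero_le_one]
    exact fun x hx => (hh x (ofReal_mem_closedBall_loopRadius hm hx)).comp_ofReal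
  have hcont : ContinuousOn (fun x : ℝ => kappaForm m x) (Set.uIcc 0 1) := by
    rw [Set.uIcc_of_le zero_le_one]
    exact (continuousOn_kappaForm hm).comp Complex.continuous_ofReal.continuousOn
      fun x hx => ofReal_mem_closedBall_loopRadius hm hx
  have hint := intervalIntegral.integral_eq_sub_of_hasDerivAt hderiv hcont.intervalIntegrable
  rw [Complex.ofReal_one, Complex.ofReal_zero, h0, sub_zero] at hint
  rw [← hint, integral_kappaForm]

/-- The form `n (1 - zᵐ)² dz / (zⁿ - 1)`, `n = 2m + 2`, pulled back to `[0, 1]` by the loop. -/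
def kappaLoopForm (m : ℕ) : PathAlgebra ℂ :=
  cyclotomicForm m 0 - (2 : ℂ) • cyclotomicForm m m + cyclotomicForm m (2 * m)

theorem kappaLoopForm_apply (m : ℕ) (s : I) :
    kappaLoopForm m s = deriv (loop m) s * kappaForm m (loop m s) := by
  change cyclotomicForm m 0 s - 2 * cyclotomicForm m m s + cyclotomicForm m (2 * m) s = _
  rw [kappaForm_eq_div (loop_pow_card_ne_one m s)]
  simp only [cyclotomicForm_apply]
  ring

theorem volterra_kappaLoopForm (hm : 1 ≤ m) {h : ℂ → ℂ} (h0 : h 0 = 0)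
    (hh : ∀ z ∈ Metric.closedBall (loopRadius m : ℂ) (loopRadius m),
      HasDerivAt h (kappaForm m z) z) (s : I) :
    volterra ℂ (kappaLoopForm m) s = h (loop m s) := by
  have hderiv : ∀ s : ℝ, HasDerivAt (fun s => h (loop m s))
      (deriv (loop m) s * kappaForm m (loop m s)) s := fun s => by
    rw [mul_comm]
    exact (hh _ (loop_mem_closedBall hm s)).comp s
      (hasDerivAt_loop m s).differentiableAt.hasDerivAt
  have hcont : Continuous fun s : ℝ => deriv (loop m) s * kappaForm m (loop m s) :=
    (continuous_deriv_loop m).mul ((continuousOn_kappaForm hm).comp_continuous (continuous_loop m)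
      (loop_mem_closedBall hm))
  rw [volterra_eq_integral (f := fun s => deriv (loop m) s * kappaForm m (loop m s))
    (kappaLoopForm_apply m), intervalIntegral.integral_eq_sub_of_hasDerivAt
    (fun x _ => hderiv x) (hcont.intervalIntegrable _ _), loop_zero, h0, sub_zero]

theorem iterInt_cyclotomicForm_sub_swap (hm : 1 ≤ m) :
    iterInt (cyclotomicForm m m) (kappaLoopForm m) -
      iterInt (kappaLoopForm m) (cyclotomicForm m m) = 8 * Real.pi * Complex.I * kappa m := by
  obtain ⟨h, h0, hh⟩ := exists_primitive_kappaForm hm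
  have hdiff : DifferentiableOn ℂ h (Metric.closedBall (loopRadius m : ℂ) (loopRadius m)) :=
    fun z hz => (hh z hz).differentiableAt.differentiableWithinAt
  have hclosed : totalIntegral ℂ (kappaLoopForm m) = 0 := by
    rw [totalIntegral_apply, volterra_kappaLoopForm hm h0 hh]
    exact (congrArg h (loop_one m)).trans h0
  rw [iterInt_sub_iterInt_swap hclosed, totalIntegral_mul_cyclotomicForm hm hdiff
    (volterra_kappaLoopForm hm h0 hh), primitive_kappaForm_one hm h0 hh]
  push_cast
  ring

theorem iterInt_cyclotomicForm (hm : 1 ≤ m) :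
    iterInt (cyclotomicForm m m) (cyclotomicForm m (2 * m)) -
      iterInt (cyclotomicForm m (2 * m)) (cyclotomicForm m m) +
      (iterInt (cyclotomicForm m m) (cyclotomicForm m 0) -
      iterInt (cyclotomicForm m 0) (cyclotomicForm m m)) = 8 * Real.pi * Complex.I * kappa m := by
  rw [← iterInt_cyclotomicForm_sub_swap hm]
  simp only [iterInt, kappaLoopForm, mul_add, mul_sub, map_add, map_sub, add_mul, sub_mul, map_smul,
    smul_mul_assoc, mul_smul_comm]
  ring

end Kappa

/-! ### The Wiener algebra -/

section OneLift

variable {ι 𝕜 F : Type*} [RCLike 𝕜] [NormedAddCommGroup F] [NormedSpace 𝕜 F] [CompleteSpace F]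

theorem summable_norm_lp_one (x : lp (fun _ : ι => 𝕜) 1) : Summable fun k => ‖x k‖ := by
  simpa using (lp.memℓp x).summable (by simp)

theorem norm_lp_one_eq_tsum (x : lp (fun _ : ι => 𝕜) 1) : ‖x‖ = ∑' k, ‖x k‖ := by
  rw [lp.norm_eq_tsum_rpow (by simp)]
  simp

/-- The continuous linear map `x ↦ ∑ xₖ vₖ` on `ℓ¹` defined by a bounded family `v`. -/
def lpOneLift (v : ι → F) {K : ℝ} (hK : 0 ≤ K) (hv : ∀ k, ‖v k‖ ≤ K) :
    lp (fun _ : ι => 𝕜) 1 →L[𝕜] F :=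
  lp.tsumCLM 𝕜 ι F ∘L
    lp.mapCLM 1 (fun k => ContinuousLinearMap.toSpanSingleton 𝕜 (v k)) hK fun k =>
      (ContinuousLinearMap.norm_toSpanSingleton (v k)).trans_le (hv k)

variable {v : ι → F} {K : ℝ} (hK : 0 ≤ K) (hv : ∀ k, ‖v k‖ ≤ K)

theorem lpOneLift_apply (x : lp (fun _ : ι => 𝕜) 1) : lpOneLift v hK hv x = ∑' k, x k • v k := rfl

theorem norm_lpOneLift_le : ‖lpOneLift (𝕜 := 𝕜) v hK hv‖ ≤ K := by
  refine (ContinuousLinearMap.opNorm_comp_le _ _).trans ?_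
  simpa using mul_le_mul lp.norm_tsumCLM_le (lp.norm_mapCLM_le 1 _ hK _) (norm_nonneg _)
    zero_le_one

theorem lpOneLift_single [DecidableEq ι] (k : ι) :
    lpOneLift v hK hv (lp.single 1 k (1 : 𝕜)) = v k := by
  rw [lpOneLift_apply, tsum_eq_single k fun j hj => by rw [lp.single_apply_ne _ _ _ hj, zero_smul],
    lp.single_apply_self, one_smul]

end OneLift

namespace W

variable {ρ : ℝ}

theorem abs_coeff_le [hρ : Fact (1 < ρ)] (f : W ρ) (k : ℕ) : |f.coeff k| ≤ |f.coeff k| * |ρ| ^ k :=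
  le_mul_of_one_le_right (abs_nonneg _) (one_le_pow₀ (hρ.out.le.trans (le_abs_self ρ)))

theorem summable_norm_coeff [Fact (1 < ρ)] (f : W ρ) : Summable fun k => ‖(f.coeff k : ℂ)‖ :=
  .of_nonneg_of_le (fun _ => norm_nonneg _)
    (fun k => (Complex.norm_real _).trans_le (f.abs_coeff_le k)) f.summable

theorem summable_coeff_smul {F : Type*} [NormedAddCommGroup F] [NormedSpace ℝ F]
    [CompleteSpace F] {v : ℕ → F} (hv : ∀ k, ‖v k‖ ≤ |ρ| ^ k) (f : W ρ) :
    Summable fun k => f.coeff k • v k := by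
  refine .of_norm_bounded f.summable fun k => ?_
  rw [norm_smul, Real.norm_eq_abs]
  exact mul_le_mul_of_nonneg_left (hv k) (abs_nonneg _)

variable [hρ : Fact (1 < ρ)]

theorem abs_rho_pow_pos (k : ℕ) : 0 < |ρ| ^ k :=
  pow_pos (abs_pos.2 (zero_lt_one.trans hρ.out).ne') k

/-- The isometry of `W ρ` with `ℓ¹` given by the rescaled coefficients `fₖ ρᵏ`. -/
def toLp : W ρ ≃ₗᵢ[ℝ] lp (fun _ : ℕ => ℝ) 1 where
  toFun f := ⟨fun k => f.coeff k * |ρ| ^ k, by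
    refine (memℓp_gen_iff (by simp)).2 ?_
    simpa [abs_mul] using f.summable⟩
  invFun x := ⟨fun k => x k / |ρ| ^ k, by
    refine (summable_norm_lp_one x).congr fun k => ?_
    rw [abs_div, abs_of_pos (abs_rho_pow_pos k), div_mul_cancel₀ _ (abs_rho_pow_pos k).ne',
      Real.norm_eq_abs]⟩
  map_add' f g := by
    ext k
    exact add_mul _ _ _
  map_smul' c f := by
    ext k
    exact mul_assoc _ _ _
  left_inv f := by
    ext k
    exact mul_div_cancel_right₀ _ (abs_rho_pow_pos k).ne'
  right_inv x := by
    ext k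
    exact div_mul_cancel₀ _ (abs_rho_pow_pos k).ne'
  norm_map' f := by
    rw [norm_lp_one_eq_tsum, norm_def]
    refine tsum_congr fun k => ?_
    change |f.coeff k * |ρ| ^ k| = _
    rw [abs_mul, abs_of_pos (abs_rho_pow_pos k)]

theorem toLp_apply (f : W ρ) (k : ℕ) : toLp f k = f.coeff k * |ρ| ^ k := rfl

instance : CompleteSpace (W ρ) :=
  (completeSpace_congr (e := (toLp (ρ := ρ)).toEquiv)
    (toLp (ρ := ρ)).isometry.isUniformEmbedding).2 inferInstance

variable {F : Type*} [NormedAddCommGroup F] [NormedSpace ℝ F] [CompleteSpace F]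
  {v : ℕ → F} (hv : ∀ k, ‖v k‖ ≤ |ρ| ^ k)

/-- The continuous linear map `f ↦ ∑ fₖ vₖ` defined by a family `v` with `‖vₖ‖ ≤ ρᵏ`. -/
def lift (v : ℕ → F) (hv : ∀ k, ‖v k‖ ≤ |ρ| ^ k) : W ρ →L[ℝ] F :=
  (lpOneLift (𝕜 := ℝ) (fun k => (|ρ| ^ k)⁻¹ • v k) zero_le_one (fun k => by
    rw [norm_smul, norm_inv, norm_pow, Real.norm_eq_abs, abs_abs,
      inv_mul_le_iff₀ (abs_rho_pow_pos k), mul_one]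
    exact hv k)) ∘L (toLp (ρ := ρ)).toContinuousLinearEquiv

theorem lift_apply (f : W ρ) : lift v hv f = ∑' k, f.coeff k • v k := by
  change ∑' k, toLp f k • ((|ρ| ^ k)⁻¹ • v k) = _
  refine tsum_congr fun k => ?_
  rw [toLp_apply, smul_smul, mul_assoc, mul_inv_cancel₀ (abs_rho_pow_pos k).ne', mul_one]

theorem hasSum_lift (f : W ρ) : HasSum (fun k => f.coeff k • v k) (lift v hv f) :=
  lift_apply hv f ▸ (summable_coeff_smul hv f).hasSum

end W

/-- Laurent series `∑ fₖ λᵏ` with `∑ |fₖ| ρ^|k| < ∞`, encoded by the rescaled coefficients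
`fₖ ρ^|k|`. -/
abbrev Laurent := lp (fun _ : ℤ => ℂ) 1

section Laurent

variable (ρ : ℝ) [hρ : Fact (1 < ρ)]

theorem one_le_rho_pow (k : ℕ) : 1 ≤ ρ ^ k := one_le_pow₀ hρ.out.le

theorem norm_ofReal_rho_pow (k : ℕ) : ‖((ρ ^ k : ℝ) : ℂ)‖ = ρ ^ k :=
  (Complex.norm_real _).trans (abs_of_nonneg (zero_le_one.trans (one_le_rho_pow ρ k)))

theorem ofReal_rho_pow_ne_zero (k : ℕ) : ((ρ ^ k : ℝ) : ℂ) ≠ 0 :=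
  Complex.ofReal_ne_zero.2 (zero_lt_one.trans_le (one_le_rho_pow ρ k)).ne'

/-- The value of a Laurent series at a point of the unit circle. -/
def circleEval (l : Circle) : Laurent →L[ℂ] ℂ :=
  lpOneLift (fun k : ℤ => ((ρ ^ k.natAbs : ℝ) : ℂ)⁻¹ * (l : ℂ) ^ k) zero_le_one (fun k => by
    rw [norm_mul, norm_inv, norm_zpow, Circle.norm_coe, one_zpow, mul_one, norm_ofReal_rho_pow]
    exact inv_le_one_of_one_le₀ (one_le_rho_pow ρ _))

theorem circleEval_apply (l : Circle) (x : Laurent) :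
    circleEval ρ l x = ∑' k, ((ρ ^ k.natAbs : ℝ) : ℂ)⁻¹ * x k * (l : ℂ) ^ k :=
  (lpOneLift_apply _ _ x).trans (tsum_congr fun k => by rw [smul_eq_mul]; ring)

theorem circleEval_single (l : Circle) (k : ℤ) :
    circleEval ρ l (lp.single 1 k 1) = ((ρ ^ k.natAbs : ℝ) : ℂ)⁻¹ * (l : ℂ) ^ k :=
  lpOneLift_single _ _ _

theorem circleEval_one (l : Circle) : circleEval ρ l (lp.single 1 0 1) = 1 := by
  simp [circleEval_single]

theorem summable_norm_rescale (x : Laurent) :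
    Summable fun k => ‖((ρ ^ k.natAbs : ℝ) : ℂ)⁻¹ * x k‖ := by
  refine .of_nonneg_of_le (fun k => norm_nonneg _) (fun k => ?_) (summable_norm_lp_one x)
  rw [norm_mul, norm_inv, norm_ofReal_rho_pow]
  exact mul_le_of_le_one_left (norm_nonneg _) (inv_le_one_of_one_le₀ (one_le_rho_pow ρ _))

/-- The operators of multiplication by a Laurent series. The product of series is encoded by the
values on the unit circle: `T` is multiplication by `T 1`. -/
def wienerSubalgebra : Subalgebra ℂ (Laurent →L[ℂ] Laurent) where
  carrier := {T | ∀ (l : Circle) (x : Laurent),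
    circleEval ρ l (T x) = circleEval ρ l (T (lp.single 1 0 1)) * circleEval ρ l x}
  mul_mem' {S T} hS hT l x := by
    rw [mul_apply_eq_comp, mul_apply_eq_comp, hS l (T x),
      hS l (T (lp.single 1 0 1)), hT l x]
    ring
  add_mem' {S T} hS hT l x := by
    rw [add_apply, add_apply, map_add, map_add, hS l x,
      hT l x, add_mul]
  algebraMap_mem' c l x := by
    simp only [ContinuousLinearMap.algebraMap_apply, map_smul, circleEval_one, smul_eq_mul, mul_one]

theorem isClosed_wienerSubalgebra :
    IsClosed (wienerSubalgebra ρ : Set (Laurent →L[ℂ] Laurent)) := by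
  change IsClosed {T : Laurent →L[ℂ] Laurent | ∀ (l : Circle) (x : Laurent),
    circleEval ρ l (T x) = circleEval ρ l (T (lp.single 1 0 1)) * circleEval ρ l x}
  simp only [Set.ofPred_forall]
  exact isClosed_iInter fun l => isClosed_iInter fun x => isClosed_eq (by fun_prop) (by fun_prop)

/-- The Wiener algebra of Laurent series with `∑ |fₖ| ρ^|k| < ∞`, normed as an algebra of
multiplication operators. -/
def Wiener : Type := wienerSubalgebra ρ

instance : NormedRing (Wiener ρ) := inferInstanceAs (NormedRing (wienerSubalgebra ρ))

instance : NormedAlgebra ℂ (Wiener ρ) := inferInstanceAs (NormedAlgebra ℂ (wienerSubalgebra ρ))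

instance : CompleteSpace (Wiener ρ) :=
  (isClosed_wienerSubalgebra ρ).completeSpace_coe

end Laurent

namespace Wiener

variable {ρ : ℝ} [hρ : Fact (1 < ρ)]

/-- The Laurent series of an element of the Wiener algebra. -/
def toLaurent : Wiener ρ →L[ℂ] Laurent :=
  ContinuousLinearMap.apply ℂ Laurent (lp.single 1 0 1 : Laurent) ∘L
    (wienerSubalgebra ρ).toSubmodule.subtypeL

theorem norm_toLaurent_le (T : Wiener ρ) : ‖toLaurent T‖ ≤ ‖T‖ := by
  have h := (T.1 : Laurent →L[ℂ] Laurent).le_opNorm (lp.single 1 0 1)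
  rwa [lp.norm_single (by simp), norm_one, mul_one] at h

/-- Evaluation at a point of the unit circle. -/
def eval (l : Circle) : Wiener ρ →A[ℂ] ℂ where
  __ := AlgHom.ofLinearMap (circleEval ρ l ∘L toLaurent : Wiener ρ →L[ℂ] ℂ).toLinearMap
    (circleEval_one ρ l) fun S T => S.2 l (T.1 (lp.single 1 0 1))
  cont := (circleEval ρ l ∘L toLaurent : Wiener ρ →L[ℂ] ℂ).continuous

theorem norm_eval_le (l : Circle) (T : Wiener ρ) : ‖eval l T‖ ≤ ‖T‖ :=
  ((circleEval ρ l).le_of_opNorm_le (norm_lpOneLift_le _ _) _).trans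
    ((one_mul _).trans_le (norm_toLaurent_le T))

/-- The Laurent coefficients. -/
def coeff (k : ℤ) : Wiener ρ →L[ℂ] ℂ :=
  (((ρ ^ k.natAbs : ℝ) : ℂ)⁻¹ • lp.evalCLM ℂ (fun _ : ℤ => ℂ) 1 k) ∘L toLaurent

theorem coeff_eq_inv_mul (k : ℤ) (T : Wiener ρ) :
    coeff k T = ((ρ ^ k.natAbs : ℝ) : ℂ)⁻¹ * toLaurent T k := rfl

theorem summable_norm_coeff (T : Wiener ρ) : Summable fun k => ‖coeff k T‖ :=
  summable_norm_rescale ρ (toLaurent T)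

theorem eval_eq_tsum (l : Circle) (T : Wiener ρ) : eval l T = ∑' k, coeff k T * (l : ℂ) ^ k :=
  circleEval_apply ρ l (toLaurent T)

theorem summable_mul_circle_zpow {f : ℤ → ℂ} (hf : Summable fun k => ‖f k‖) (l : Circle) :
    Summable fun k => f k * (l : ℂ) ^ k :=
  .of_norm (hf.congr fun k => by rw [norm_mul, norm_zpow, Circle.norm_coe, one_zpow, mul_one])

theorem eq_of_tsum_mul_circle_zpow_eq {f g : ℤ → ℂ} (hf : Summable fun k => ‖f k‖)
    (hg : Summable fun k => ‖g k‖)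
    (h : ∀ l : Circle, ∑' k, f k * (l : ℂ) ^ k = ∑' k, g k * (l : ℂ) ^ k) : f = g := by
  have hfg : Summable fun k => ‖f k - g k‖ :=
    .of_nonneg_of_le (fun k => norm_nonneg _) (fun k => norm_sub_le _ _) (hf.add hg)
  refine sub_eq_zero.1 (eq_zero_of_tsum_mul_zpow_eq_zero hfg fun l hl => ?_)
  obtain ⟨l, rfl⟩ : ∃ l' : Circle, (l' : ℂ) = l :=
    ⟨⟨l, by simpa [Submonoid.unitSphere] using hl⟩, rfl⟩
  refine (tsum_congr fun k => sub_mul (f k) (g k) ((l : ℂ) ^ k)).trans ?_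
  rw [(summable_mul_circle_zpow hf l).tsum_sub (summable_mul_circle_zpow hg l), h l, sub_self]

theorem coeff_eq_of_eval_eq {T : Wiener ρ} {f : ℤ → ℂ} (hf : Summable fun k => ‖f k‖)
    (h : ∀ l : Circle, eval l T = ∑' k, f k * (l : ℂ) ^ k) (k : ℤ) : coeff k T = f k :=
  congrFun (eq_of_tsum_mul_circle_zpow_eq T.summable_norm_coeff hf fun l => by
    rw [← eval_eq_tsum, h]) k

theorem ext_eval {S T : Wiener ρ} (h : ∀ l : Circle, eval l S = eval l T) : S = T := by
  refine Subtype.ext (ContinuousLinearMap.ext fun x => lp.ext (funext fun k => ?_))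
  refine mul_left_cancel₀ (inv_ne_zero (ofReal_rho_pow_ne_zero ρ k.natAbs)) (congrFun
    (eq_of_tsum_mul_circle_zpow_eq (summable_norm_rescale ρ (S.1 x))
      (summable_norm_rescale ρ (T.1 x)) fun l => ?_) k)
  rw [← circleEval_apply, ← circleEval_apply, S.2 l x, T.2 l x]
  exact congrArg (· * circleEval ρ l x) (h l)

theorem eval_eq_eval_inv_iff (S T : Wiener ρ) :
    (∀ l : Circle, eval l S = eval l⁻¹ T) ↔ ∀ k, coeff k S = coeff (-k) T := by
  have eval_inv (l : Circle) : eval l⁻¹ T = ∑' k, coeff (-k) T * (l : ℂ) ^ k := by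
    rw [eval_eq_tsum, ← (Equiv.neg ℤ).tsum_eq]
    simp
  have summable_neg : Summable fun k => ‖coeff (-k) T‖ :=
    T.summable_norm_coeff.comp_injective neg_injective
  constructor
  · exact fun h => coeff_eq_of_eval_eq summable_neg fun l => by rw [h, eval_inv]
  · intro h l
    simp_rw [eval_inv, eval_eq_tsum, h]

theorem norm_rescaled_shift_le (d k : ℤ) :
    ‖(((ρ ^ (k + d).natAbs : ℝ) : ℂ) / ((ρ ^ k.natAbs : ℝ) : ℂ)) •
      (lp.single 1 (k + d) 1 : Laurent)‖ ≤ ρ ^ d.natAbs := by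
  rw [norm_smul, lp.norm_single (by simp), norm_one, mul_one, norm_div, norm_ofReal_rho_pow,
    norm_ofReal_rho_pow, div_le_iff₀ (zero_lt_one.trans_le (one_le_rho_pow ρ _)), ← pow_add]
  exact pow_le_pow_right₀ hρ.out.le (by omega)

/-- The shift `f ↦ λᵈ f` of Laurent series. -/
def shift (ρ : ℝ) [hρ : Fact (1 < ρ)] (d : ℤ) : Laurent →L[ℂ] Laurent :=
  lpOneLift _ (pow_nonneg (zero_le_one.trans hρ.out.le) _) (norm_rescaled_shift_le (ρ := ρ) d)

theorem circleEval_shift (d : ℤ) (l : Circle) (x : Laurent) :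
    circleEval ρ l (shift ρ d x) = (l : ℂ) ^ d * circleEval ρ l x := by
  suffices h : circleEval ρ l ∘L shift ρ d = (l : ℂ) ^ d • circleEval ρ l from
    congrArg (· x) h
  refine lp.ext_continuousLinearMap (E := fun _ : ℤ => ℂ) (p := 1) ENNReal.one_ne_top
    fun k => ContinuousLinearMap.ext_ring ?_
  change circleEval ρ l (shift ρ d (lp.single 1 k 1)) =
    (l : ℂ) ^ d * circleEval ρ l (lp.single 1 k 1)
  have := ofReal_rho_pow_ne_zero ρ (k + d).natAbs
  rw [shift, lpOneLift_single, map_smul, circleEval_single, circleEval_single, smul_eq_mul,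
    zpow_add₀ (Circle.coe_ne_zero l)]
  field_simp

/-- The monomial `λᵈ`. -/
def monomial (d : ℤ) : Wiener ρ :=
  ⟨shift ρ d, fun l x => by rw [circleEval_shift, circleEval_shift, circleEval_one, mul_one]⟩

@[simp]
theorem eval_monomial (d : ℤ) (l : Circle) : eval l (monomial d : Wiener ρ) = (l : ℂ) ^ d :=
  (circleEval_shift d l (lp.single 1 0 1)).trans (by rw [circleEval_one, mul_one])

theorem norm_monomial_le (d : ℤ) : ‖(monomial d : Wiener ρ)‖ ≤ ρ ^ d.natAbs :=
  norm_lpOneLift_le _ (norm_rescaled_shift_le d)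

theorem coeff_monomial_mul (d k : ℤ) (T : Wiener ρ) :
    coeff k (monomial d * T) = coeff (k - d) T := by
  refine coeff_eq_of_eval_eq (T.summable_norm_coeff.comp_injective (sub_left_injective (b := d)))
    (fun l => ?_) k
  rw [map_mul, eval_monomial, eval_eq_tsum, ← (Equiv.subRight d).tsum_eq, ← tsum_mul_left]
  refine tsum_congr fun k => ?_
  have := zpow_ne_zero d (Circle.coe_ne_zero l)
  rw [Equiv.subRight_apply, zpow_sub₀ (Circle.coe_ne_zero l)]
  change _ = coeff (k - d) T * _
  field_simp

theorem coeff_one (k : ℤ) : coeff k (1 : Wiener ρ) = if k = 0 then 1 else 0 := by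
  refine coeff_eq_of_eval_eq (f := fun k : ℤ => if k = 0 then 1 else 0) ?_ (fun l => ?_) k
  · exact summable_of_ne_finset_zero (s := {0}) fun k hk => by
      rw [if_neg (Finset.mem_singleton.not.1 hk), norm_zero]
  · rw [map_one, tsum_eq_single 0 fun k hk => by rw [if_neg hk, zero_mul]]
    simp

theorem coeff_monomial (d k : ℤ) : coeff k (monomial d : Wiener ρ) = if k = d then 1 else 0 := by
  rw [← mul_one (monomial d), coeff_monomial_mul, coeff_one]
  simp only [sub_eq_zero]

theorem norm_neg_one_pow_smul_monomial_le (j k : ℕ) :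
    ‖((-1 : ℂ) ^ (j * k)) • (monomial k : Wiener ρ)‖ ≤ |ρ| ^ k := by
  rw [norm_smul, norm_pow, norm_neg, norm_one, one_pow, one_mul,
    abs_of_pos (zero_lt_one.trans hρ.out)]
  exact norm_monomial_le k

/-- The power series `f((-1)ʲ λ)` as an element of the Wiener algebra. -/
def ofW (j : ℕ) : W ρ →L[ℝ] Wiener ρ :=
  W.lift (fun k => ((-1 : ℂ) ^ (j * k)) • monomial k) (norm_neg_one_pow_smul_monomial_le j)

theorem eval_ofW (j : ℕ) (f : W ρ) (l : Circle) :
    eval l (ofW j f) = f.eval ((-1) ^ j * l) := by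
  have h := (W.hasSum_lift (norm_neg_one_pow_smul_monomial_le j) f).map (eval l)
    (eval (ρ := ρ) l).continuous
  refine h.tsum_eq.symm.trans (tsum_congr fun k => ?_)
  change eval l ((f.coeff k : ℂ) • ((-1 : ℂ) ^ (j * k)) • monomial (k : ℤ)) = _
  rw [map_smul, map_smul, eval_monomial, smul_eq_mul, smul_eq_mul, mul_pow, pow_mul, zpow_natCast]

theorem coeff_ofW (f : W ρ) (k : ℤ) :
    coeff k (ofW 0 f) = if 0 ≤ k then (f.coeff k.toNat : ℂ) else 0 := by
  have hinj : Function.Injective ((↑) : ℕ → ℤ) := Nat.cast_injective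
  have neg_of_notMem_range (k : ℤ) (hk : k ∉ Set.range ((↑) : ℕ → ℤ)) : ¬ 0 ≤ k := fun h =>
    hk ⟨k.toNat, Int.toNat_of_nonneg h⟩
  refine coeff_eq_of_eval_eq (f := fun k : ℤ => if 0 ≤ k then (f.coeff k.toNat : ℂ) else 0)
    ?_ (fun l => ?_) k
  · refine (hinj.summable_iff fun k hk => ?_).1 ?_
    · rw [if_neg (neg_of_notMem_range k hk), norm_zero]
    · simpa [Function.comp_def] using f.summable_norm_coeff
  · rw [eval_ofW, W.eval, pow_zero, one_mul, ← hinj.tsum_eq (f := fun k : ℤ =>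
      (if 0 ≤ k then (f.coeff k.toNat : ℂ) else 0) * (l : ℂ) ^ k)]
    · exact tsum_congr fun k => by simp
    · intro k hk
      by_contra h
      exact hk (by simp only [if_neg (neg_of_notMem_range k h), zero_mul])

theorem injective_units_mul_natCast (e : ℤˣ) : Function.Injective fun k : ℕ => (e : ℤ) * k :=
  (mul_right_injective₀ e.ne_zero).comp Nat.cast_injective

theorem abs_re_coeff_mul_le (e : ℤˣ) (T : Wiener ρ) (k : ℕ) :
    |(coeff (e * k) T).re| * |ρ| ^ k ≤ ‖toLaurent T (e * k)‖ := by
  have hρ' : (0 : ℝ) < ρ ^ k := zero_lt_one.trans_le (one_le_rho_pow ρ k)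
  rw [coeff_eq_inv_mul, Int.natAbs_mul, Int.natAbs_of_isUnit e.isUnit, one_mul, Int.natAbs_natCast,
    abs_of_pos (zero_lt_one.trans hρ.out), ← Complex.ofReal_inv, Complex.re_ofReal_mul, abs_mul,
    abs_of_pos (inv_pos.2 hρ'), mul_comm, ← mul_assoc, mul_inv_cancel₀ hρ'.ne', one_mul]
  exact Complex.abs_re_le_norm _

theorem summable_norm_toLaurent_units_mul (e : ℤˣ) (T : Wiener ρ) :
    Summable fun k : ℕ => ‖toLaurent T (e * k)‖ :=
  (summable_norm_lp_one (toLaurent T)).comp_injective (injective_units_mul_natCast e)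

theorem summable_abs_re_coeff_mul (e : ℤˣ) (T : Wiener ρ) :
    Summable fun k : ℕ => |(coeff (e * k) T).re| * |ρ| ^ k :=
  .of_nonneg_of_le (fun k => by positivity) (abs_re_coeff_mul_le e T)
    (summable_norm_toLaurent_units_mul e T)

/-- The real parts of the Laurent coefficients of index `0, e, 2e, …`, for a sign `e = ±1`: the
part of nonnegative degree, or the part of nonpositive degree as a power series in `λ⁻¹`. -/
def halfPart (e : ℤˣ) : Wiener ρ →L[ℝ] W ρ :=
  LinearMap.mkContinuous
    { toFun := fun T => ⟨fun k => (coeff (e * k) T).re, summable_abs_re_coeff_mul e T⟩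
      map_add' := fun S T => W.ext fun k => by
        change (coeff (e * k) (S + T)).re = _
        rw [map_add, Complex.add_re]
        rfl
      map_smul' := fun c T => W.ext fun k => by
        change (coeff (e * k) ((c : ℂ) • T)).re = _
        rw [map_smul, smul_eq_mul, Complex.re_ofReal_mul]
        rfl } 1 fun T => by
    rw [one_mul, W.norm_def]
    refine le_trans ?_ (norm_toLaurent_le T)
    rw [norm_lp_one_eq_tsum]
    refine ((summable_abs_re_coeff_mul e T).tsum_le_tsum (abs_re_coeff_mul_le e T)
      (summable_norm_toLaurent_units_mul e T)).trans ?_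
    exact tsum_comp_le_tsum_of_inj (summable_norm_lp_one (toLaurent T)) (fun _ => norm_nonneg _)
      (injective_units_mul_natCast e)

theorem coeff_halfPart (e : ℤˣ) (T : Wiener ρ) (k : ℕ) :
    (halfPart e T).coeff k = (coeff (e * k) T).re := rfl

end Wiener

/-! ### Matrix loops and their residues -/

/-- The Banach algebra of `2 × 2` matrices with entries in the Wiener algebra, with the operator
norm of `ℓ^∞`. -/
def LoopMat (ρ : ℝ) [Fact (1 < ρ)] : Type := Matrix (Fin 2) (Fin 2) (Wiener ρ)

namespace LoopMat

variable {ρ : ℝ} [hρ : Fact (1 < ρ)]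

instance : NormedRing (LoopMat ρ) :=
  Matrix.linftyOpNormedRing (n := Fin 2) (α := Wiener ρ)

instance : NormedAlgebra ℂ (LoopMat ρ) :=
  Matrix.linftyOpNormedAlgebra (n := Fin 2) (α := Wiener ρ) (R := ℂ)

instance : CompleteSpace (LoopMat ρ) :=
  inferInstanceAs (CompleteSpace (Matrix (Fin 2) (Fin 2) (Wiener ρ)))

/-- The entry of index `(i, j)`. -/
def entry (i j : Fin 2) : LoopMat ρ →L[ℂ] Wiener ρ where
  toLinearMap := Matrix.entryLinearMap ℂ (Wiener ρ) i j
  cont := continuous_apply_apply i j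

/-- The matrix whose only nonzero entry is at the index `(i, j)`. -/
def single (i j : Fin 2) : Wiener ρ →L[ℂ] LoopMat ρ where
  toLinearMap := Matrix.singleLinearMap ℂ i j
  cont := continuous_pi fun a => continuous_pi fun b => by
    change Continuous fun f => Matrix.single i j f a b
    simp only [Matrix.single_apply]
    split_ifs <;> fun_prop

/-- Evaluation at a point of the unit circle. -/
def eval (l : Circle) : LoopMat ρ →A[ℂ] Mat where
  toAlgHom := (Wiener.eval (ρ := ρ) l).toAlgHom.mapMatrix
  cont := Continuous.matrix_map (A := fun A : LoopMat ρ => A) continuous_id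
    (Wiener.eval (ρ := ρ) l).cont

theorem eval_apply (l : Circle) (A : LoopMat ρ) (i j : Fin 2) :
    eval l A i j = Wiener.eval l (entry i j A) := rfl

theorem eval_single (l : Circle) (i j : Fin 2) (f : Wiener ρ) :
    eval l (single i j f) = Matrix.single i j (Wiener.eval l f) :=
  Matrix.map_single i j f (Wiener.eval l)

theorem ext_eval {A B : LoopMat ρ} (h : ∀ l : Circle, eval l A = eval l B) : A = B :=
  Matrix.ext fun i j => Wiener.ext_eval fun l => congrFun (congrFun (h l) i) j

open scoped Matrix.Norms.Operator in
theorem norm_eval_le (l : Circle) (A : LoopMat ρ) : ‖eval l A‖ ≤ ‖A‖ := by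
  change _ ≤ ‖(show Matrix (Fin 2) (Fin 2) (Wiener ρ) from A)‖
  rw [Matrix.linfty_opNorm_def, Matrix.linfty_opNorm_def, NNReal.coe_le_coe]
  exact Finset.sup_mono_fun fun i _ => Finset.sum_le_sum fun j _ => Wiener.norm_eval_le l (A i j)

/-- An entry of the value at a point of the unit circle. -/
def evalEntry (l : Circle) (i j : Fin 2) : LoopMat ρ →L[ℂ] ℂ :=
  (Wiener.eval l).toContinuousLinearMap ∘L entry i j

end LoopMat

theorem exp_matD_sq (m : ℕ) :
    Complex.exp (Complex.I * Real.pi * m / (2 * m + 2)) ^ 2 = puncture m 1 ^ m := by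
  rw [puncture, ← Complex.exp_nat_mul, ← Complex.exp_nat_mul]
  congr 1
  push_cast
  ring

theorem inv_matD_mul_mul_matD (m : ℕ) (a b c d : ℂ) :
    (matD m)⁻¹ * !![a, b; c, d] * matD m =
      !![a, (puncture m 1 ^ m)⁻¹ * b; puncture m 1 ^ m * c, d] := by
  set e := Complex.exp (Complex.I * Real.pi * m / (2 * m + 2)) with he
  have he0 : e ≠ 0 := Complex.exp_ne_zero _
  have hD : matD m = !![e, 0; 0, e⁻¹] := by rw [matD, Complex.exp_neg]
  have hDinv : (matD m)⁻¹ = !![e⁻¹, 0; 0, e] := by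
    refine Matrix.inv_eq_left_inv ?_
    rw [hD, Matrix.mul_fin_two, Matrix.one_fin_two]
    simp [he0]
  rw [hDinv, hD, ← exp_matD_sq, ← he, Matrix.mul_fin_two, Matrix.mul_fin_two]
  ext i j
  fin_cases i <;> fin_cases j <;> simp <;> field_simp

theorem matA_eq {ρ : ℝ} (m : ℕ) (x : Params ρ) (j : ℕ) (l : ℂ) :
    matA m x j l = !![x.2.1.eval ((-1) ^ j * l),
      (puncture m j ^ m)⁻¹ * ((-1) ^ j * (l⁻¹ * x.2.2.1.eval ((-1) ^ j * l)));
      puncture m j ^ m * ((-1) ^ j * (l * x.2.2.2.eval ((-1) ^ j * l))),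
      -x.2.1.eval ((-1) ^ j * l)] := by
  induction j generalizing l with
  | zero => simp [matA, puncture_zero]
  | succ j ih =>
    have hsign : (-1 : ℂ) ^ j * -l = (-1) ^ (j + 1) * l := by ring
    rw [matA, ih, inv_matD_mul_mul_matD, hsign, puncture_succ m j, mul_pow, mul_inv, inv_neg]
    congr 1
    ext i k
    fin_cases i <;> fin_cases k <;> simp <;> ring

section Residue

variable {ρ : ℝ} [hρ : Fact (1 < ρ)]

/-- The residue `A_j` as a matrix loop depending linearly on the parameter. -/
def residue (m j : ℕ) : Params ρ →L[ℝ] LoopMat ρ :=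
  let a : Params ρ →L[ℝ] Wiener ρ := Wiener.ofW j ∘L .fst ℝ _ _ ∘L .snd ℝ _ _
  let b : Params ρ →L[ℝ] Wiener ρ := Wiener.ofW j ∘L .fst ℝ _ _ ∘L .snd ℝ _ _ ∘L .snd ℝ _ _
  let c : Params ρ →L[ℝ] Wiener ρ := Wiener.ofW j ∘L .snd ℝ _ _ ∘L .snd ℝ _ _ ∘L .snd ℝ _ _
  let mulLeft : Wiener ρ →L[ℝ] Wiener ρ →L[ℝ] Wiener ρ := .mul ℝ (Wiener ρ)
  (LoopMat.single 0 0).restrictScalars ℝ ∘L a +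
  (LoopMat.single 0 1).restrictScalars ℝ ∘L
    mulLeft (((puncture m j ^ m)⁻¹ * (-1) ^ j) • Wiener.monomial (-1)) ∘L b +
  (LoopMat.single 1 0).restrictScalars ℝ ∘L
    mulLeft ((puncture m j ^ m * (-1) ^ j) • Wiener.monomial 1) ∘L c +
  (LoopMat.single 1 1).restrictScalars ℝ ∘L (-a)

theorem residue_apply (m j : ℕ) (x : Params ρ) : residue m j x =
    LoopMat.single 0 0 (Wiener.ofW j x.2.1) +
    LoopMat.single 0 1
      ((((puncture m j ^ m)⁻¹ * (-1) ^ j) • Wiener.monomial (-1)) * Wiener.ofW j x.2.2.1) +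
    LoopMat.single 1 0
      (((puncture m j ^ m * (-1) ^ j) • Wiener.monomial 1) * Wiener.ofW j x.2.2.2) +
    LoopMat.single 1 1 (-Wiener.ofW j x.2.1) := rfl

theorem eval_residue (m j : ℕ) (x : Params ρ) (l : Circle) :
    LoopMat.eval l (residue m j x) = matA m x j l := by
  rw [residue_apply, matA_eq]
  simp only [map_neg, map_add, LoopMat.eval_single, map_mul, map_smul, Wiener.eval_ofW,
    Wiener.eval_monomial]
  ext i k
  fin_cases i <;> fin_cases k <;> simp [Matrix.single] <;> ring

end Residue

/-! ### The monodromy as a parallel transport -/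

section SmulConst

variable {𝒜 : Type*} [NormedRing 𝒜] [NormedAlgebra ℂ 𝒜]

/-- The path `s ↦ u(s) E` for a scalar path `u` and a constant `E`. -/
def PathAlgebra.smulConst (u : PathAlgebra ℂ) : 𝒜 →L[ℂ] PathAlgebra 𝒜 :=
  LinearMap.mkContinuous
    { toFun := fun E => (⟨fun s => u s • E, u.continuous.smul continuous_const⟩ : C(I, 𝒜))
      map_add' := fun E F => PathAlgebra.ext fun s => smul_add (u s) E F
      map_smul' := fun c E => PathAlgebra.ext fun s => smul_comm (u s) c E } ‖u‖ fun E =>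
    PathAlgebra.norm_le _ (by positivity) fun s => (norm_smul (u s) E).trans_le
      (mul_le_mul_of_nonneg_right (u.norm_apply_le s) (norm_nonneg _))

theorem PathAlgebra.smulConst_apply (u : PathAlgebra ℂ) (E : 𝒜) (s : I) :
    PathAlgebra.smulConst u E s = u s • E := rfl

theorem PathAlgebra.smulConst_mul_smulConst (u v : PathAlgebra ℂ) (E F : 𝒜) :
    PathAlgebra.smulConst u E * PathAlgebra.smulConst v F =
      PathAlgebra.smulConst (u * v) (E * F) :=
  PathAlgebra.ext fun _ => smul_mul_smul_comm _ _ _ _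

theorem PathAlgebra.sum_smulConst_smul {ι : Type*} (t : Finset ι) (c : ι → ℂ)
    (u : ι → PathAlgebra ℂ) (E : 𝒜) :
    ∑ j ∈ t, PathAlgebra.smulConst (u j) (c j • E) =
      PathAlgebra.smulConst (∑ j ∈ t, c j • u j) E :=
  PathAlgebra.ext fun s => by
    simp only [PathAlgebra.sum_apply, PathAlgebra.smulConst_apply, PathAlgebra.smul_apply,
      Finset.sum_smul, smul_smul, smul_eq_mul, mul_comm]

variable [CompleteSpace 𝒜]

theorem volterra_smulConst (u : PathAlgebra ℂ) (E : 𝒜) :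
    volterra 𝒜 (PathAlgebra.smulConst u E) = PathAlgebra.smulConst (volterra ℂ u) E :=
  PathAlgebra.ext fun s => by
    rw [PathAlgebra.smulConst_apply, volterra_apply, volterra_apply,
      ← intervalIntegral.integral_smul_const]
    rfl

theorem totalIntegral_smulConst (u : PathAlgebra ℂ) (E : 𝒜) :
    totalIntegral 𝒜 (PathAlgebra.smulConst u E) = totalIntegral ℂ u • E := by
  rw [totalIntegral_apply, volterra_smulConst]
  rfl

end SmulConst

theorem continuous_potential_loop (m : ℕ) (t : ℝ) {ρ : ℝ} (x : Params ρ) (l : ℂ) (i j : Fin 2) :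
    Continuous fun s => potential m t x l (loop m s) i j := by
  have hloop := continuous_loop m
  have hinv (p) : Continuous fun s => (loop m s - puncture m p)⁻¹ :=
    (hloop.sub continuous_const).inv₀ fun s => sub_ne_zero.2 (loop_ne_puncture m p s)
  simp only [potential, Matrix.add_apply, Matrix.smul_apply, Matrix.sum_apply, smul_eq_mul]
  refine Continuous.add ?_ (continuous_const.mul (continuous_finsetSum _ fun p _ =>
    (hinv p).mul continuous_const))
  fin_cases i <;> fin_cases j
  exacts [continuous_const, continuous_const, continuous_const.mul (hloop.pow _), continuous_const]

theorem continuousOn_deriv_loop_smul_potential (m : ℕ) (t : ℝ) {ρ : ℝ} (x : Params ρ) (l : ℂ)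
    (i j : Fin 2) :
    ContinuousOn (fun s => (deriv (loop m) s • potential m t x l (loop m s)) i j)
      (Set.Icc 0 1) :=
  ((continuous_deriv_loop m).mul (continuous_potential_loop m t x l i j)).continuousOn

theorem IsSolutionAlong.hasDerivWithinAt {η : ℂ → Mat} {γ : ℝ → ℂ} {Y : ℝ → Mat}
    (h : IsSolutionAlong η γ Y) : ∀ s ∈ Set.Icc (0 : ℝ) 1, ∀ i j,
      HasDerivWithinAt (fun u => Y u i j) ((Y s * (deriv γ s • η (γ s))) i j) (Set.Icc 0 1) s := by
  intro s hs i j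
  rw [mul_smul_comm, Matrix.smul_apply, smul_eq_mul]
  exact h.2 s hs i j

theorem M_eq_of_isSolutionAlong {m : ℕ} {t : ℝ} {ρ : ℝ} {x : Params ρ} {l : ℂ} {Y : ℝ → Mat}
    (h : IsSolutionAlong (potential m t x l) (loop m) Y) : M m t x l = Y 1 := by
  have hex : ∃ Y, IsSolutionAlong (potential m t x l) (loop m) Y := ⟨Y, h⟩
  rw [M, monodromy, dif_pos hex]
  exact eqOn_Icc_of_hasDerivWithinAt_matrix_mul (continuousOn_deriv_loop_smul_potential m t x l)
    hex.choose_spec.hasDerivWithinAt h.hasDerivWithinAt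
    (hex.choose_spec.1.trans h.1.symm) (Set.right_mem_Icc.2 zero_le_one)

/-- Here `B` is the pullback along `γ` of the gauged form `g η₁ g⁻¹`; the form of `hB` avoids
inverting `g`. -/
theorem isSolutionAlong_mul {γ : ℝ → ℂ} {η₀ η₁ : ℂ → Mat} {U B g : ℝ → Mat}
    (hU₀ : U 0 = 1) (hg : IsSolutionAlong η₀ γ g)
    (hU : ∀ s ∈ Set.Icc (0 : ℝ) 1, ∀ i j,
      HasDerivWithinAt (fun u => U u i j) ((U s * B s) i j) (Set.Icc 0 1) s)
    (hB : ∀ s ∈ Set.Icc (0 : ℝ) 1, B s * g s = deriv γ s • (g s * η₁ (γ s))) :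
    IsSolutionAlong (fun z => η₀ z + η₁ z) γ fun s => U s * g s := by
  refine ⟨by beta_reduce; rw [hU₀, hg.1, one_mul], fun s hs i j => ?_⟩
  have hprod : HasDerivWithinAt (fun u => (U u * g u) i j)
      ((U s * B s * g s + U s * (g s * (deriv γ s • η₀ (γ s)))) i j) (Set.Icc 0 1) s := by
    have hsum := HasDerivWithinAt.fun_sum (u := Finset.univ) fun k _ =>
      (hU s hs i k).mul (hg.hasDerivWithinAt s hs k j)
    rwa [Finset.sum_add_distrib] at hsum
  have hderiv : U s * B s * g s + U s * (g s * (deriv γ s • η₀ (γ s))) =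
      deriv γ s • (U s * g s * (η₀ (γ s) + η₁ (γ s))) := by
    rw [mul_assoc, hB s hs]
    simp only [mul_smul_comm, mul_add, smul_add, mul_assoc]
    exact add_comm _ _
  rwa [hderiv] at hprod

section Gauge

variable {ρ : ℝ} [hρ : Fact (1 < ρ)]

/-- The solution `(1, 0; r zᵐ, 1)` of `dΦ = Φ η` for `t = 0`. -/
def gauge (m : ℕ) (r : ℝ) (z : ℂ) : Mat := !![1, 0; r * z ^ m, 1]

theorem gauge_zero {m : ℕ} (hm : 1 ≤ m) (r : ℝ) : gauge m r 0 = 1 := by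
  rw [gauge, zero_pow (by omega), mul_zero, Matrix.one_fin_two]

theorem isSolutionAlong_gauge {m : ℕ} (hm : 1 ≤ m) (r : ℝ) :
    IsSolutionAlong (fun z => !![0, 0; m * r * z ^ (m - 1), 0]) (loop m)
      fun s => gauge m r (loop m s) := by
  refine ⟨by beta_reduce; rw [loop_zero, gauge_zero hm], fun s _ i j =>
    HasDerivAt.hasDerivWithinAt ?_⟩
  have hmul (z w : ℂ) : gauge m r z * !![0, 0; w, 0] = !![0, 0; w, 0] := by
    simp [gauge]
  have hpow : HasDerivAt (fun u => r * loop m u ^ m)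
      (deriv (loop m) s * (m * r * loop m s ^ (m - 1))) s := by
    convert! ((hasDerivAt_loop m s).differentiableAt.hasDerivAt.pow m).const_mul (r : ℂ) using 1
    ring
  rw [hmul]
  fin_cases i <;> fin_cases j
  · exact (hasDerivAt_const s 1).congr_deriv (mul_zero _).symm
  · exact (hasDerivAt_const s 0).congr_deriv (mul_zero _).symm
  · exact hpow
  · exact (hasDerivAt_const s 1).congr_deriv (mul_zero _).symm

/-- The nilpotent matrix `N = (0, 0; 1, 0)`, so that `gauge m r z = 1 + r zᵐ N`. -/
def nilp : LoopMat ρ := LoopMat.single 1 0 1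

theorem eval_nilp (l : Circle) : LoopMat.eval l (nilp : LoopMat ρ) = !![0, 0; 1, 0] := by
  rw [nilp, LoopMat.eval_single, map_one]
  ext i j
  fin_cases i <;> fin_cases j <;> simp [Matrix.single]

/-- The form `g (∑ⱼ Aⱼ dz / (z - pⱼ)) g⁻¹` along the loop, where `g = 1 + r zᵐ N` is the gauge. -/
def gaugedPotential (m : ℕ) (x : Params ρ) : PathAlgebra (LoopMat ρ) :=
  ∑ j ∈ Finset.range (2 * m + 2),
    (PathAlgebra.smulConst (loopForm m j 0) (residue m j x) +
      PathAlgebra.smulConst (loopForm m j m)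
        ((x.1 : ℂ) • (nilp * residue m j x - residue m j x * nilp)) -
      PathAlgebra.smulConst (loopForm m j (2 * m))
        (((x.1 : ℂ) ^ 2) • (nilp * residue m j x * nilp)))

theorem gaugedPotential_apply (m : ℕ) (x : Params ρ) (s : I) :
    gaugedPotential m x s = ∑ j ∈ Finset.range (2 * m + 2),
      (loopForm m j 0 s • residue m j x +
        loopForm m j m s • (x.1 : ℂ) • (nilp * residue m j x - residue m j x * nilp) -
        loopForm m j (2 * m) s • (x.1 : ℂ) ^ 2 • (nilp * residue m j x * nilp)) :=
  PathAlgebra.sum_apply _ _ s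

theorem eval_gaugedPotential_mul_gauge (m : ℕ) (x : Params ρ) (l : Circle) (s : I) :
    LoopMat.eval l (gaugedPotential m x s) * gauge m x.1 (loop m s) =
      deriv (loop m) s • (gauge m x.1 (loop m s) * ∑ j ∈ Finset.range (2 * m + 2),
        (loop m s - puncture m j)⁻¹ • matA m x j l) := by
  rw [gaugedPotential_apply, map_sum, Finset.sum_mul, Finset.mul_sum, Finset.smul_sum]
  refine Finset.sum_congr rfl fun j _ => ?_
  simp only [map_sub, map_add, map_smul, map_mul, eval_nilp, eval_residue, loopForm_apply]
  generalize matA m x j l = A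
  rw [Matrix.eta_fin_two A, gauge]
  generalize deriv (loop m) s = d
  generalize (loop m s - puncture m j)⁻¹ = q
  ext i k
  fin_cases i <;> fin_cases k <;> simp [Matrix.mul_apply, Fin.sum_univ_two] <;> ring

theorem isSolutionAlong_transport_mul_gauge {m : ℕ} (hm : 1 ≤ m) (t : ℝ) (x : Params ρ)
    (l : Circle) (h : ‖(t : ℂ) • gaugedPotential m x‖ < 1) :
    IsSolutionAlong (potential m t x l) (loop m) fun s => LoopMat.eval l
      (Set.IccExtend zero_le_one (transport ((t : ℂ) • gaugedPotential m x)) s) *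
        gauge m x.1 (loop m s) := by
  set B := gaugedPotential m x
  refine isSolutionAlong_mul
    (B := fun s => (t : ℂ) • LoopMat.eval l (Set.IccExtend zero_le_one B s)) ?_
    (isSolutionAlong_gauge hm x.1) (fun s hs i j => ?_) fun s hs => ?_
  · rw [Set.IccExtend_of_mem zero_le_one _ (Set.left_mem_Icc.2 zero_le_one)]
    exact (congrArg _ (transport_apply_zero h)).trans (map_one _)
  · rw [Set.IccExtend_of_mem zero_le_one _ hs, Set.IccExtend_of_mem zero_le_one B hs,
      ← map_smul, ← map_mul]
    exact ((LoopMat.evalEntry l i j).restrictScalars ℝ).hasFDerivAt.comp_hasDerivWithinAt s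
      (hasDerivWithinAt_transport h hs)
  · rw [Set.IccExtend_of_mem zero_le_one B hs, smul_mul_assoc,
      eval_gaugedPotential_mul_gauge m x l ⟨s, hs⟩, mul_smul_comm, smul_comm]

theorem M_eq_one_add {m : ℕ} (hm : 1 ≤ m) {t : ℝ} {x : Params ρ} (l : Circle)
    (h : ‖(t : ℂ) • gaugedPotential m x‖ < 1) :
    M m t x l = 1 + (t : ℂ) • LoopMat.eval l (transportQuot (t : ℂ) (gaugedPotential m x)) := by
  rw [M_eq_of_isSolutionAlong (isSolutionAlong_transport_mul_gauge hm t x l h),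
    Set.IccExtend_of_mem zero_le_one _ (Set.right_mem_Icc.2 zero_le_one), loop_one,
    gauge_zero hm, mul_one]
  refine (congrArg (LoopMat.eval l) (transport_smul_apply_one h)).trans ?_
  rw [map_add, map_one, map_smul]

end Gauge

/-! ### The logarithm of the monodromy -/

section MatLog

open scoped Matrix.Norms.Operator

theorem matLog_one_add_eq {X : Mat} (hX : ‖X‖ < 1) : matLog (1 + X) = X * logQuot X := by
  rw [mul_logQuot_eq_tsum hX, matLog]
  simp only [add_sub_cancel_left]
  rfl

theorem matLog_of_mul_eq_one {X Z : Mat} (hX : ‖X‖ < 1) (hZ : ‖Z‖ < 1)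
    (h : (1 + X) * (1 + Z) = 1) : matLog (1 + Z) = -matLog (1 + X) := by
  rw [matLog_one_add_eq hX, matLog_one_add_eq hZ, mul_logQuot_of_mul_eq_one hX hZ h]

/-- Complex conjugation of the entries of a matrix. -/
def matConj : Mat →+* Mat := (starRingEnd ℂ).mapMatrix

theorem matConj_apply (X : Mat) (i j : Fin 2) : matConj X i j = starRingEnd ℂ (X i j) := rfl

theorem matConj_smul (c : ℂ) (X : Mat) : matConj (c • X) = starRingEnd ℂ c • matConj X := by
  ext i j
  simp [matConj_apply]

theorem norm_matConj (X : Mat) : ‖matConj X‖ = ‖X‖ := by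
  simp [Matrix.linfty_opNorm_def, matConj_apply]

theorem matLog_matConj {X : Mat} (hX : ‖X‖ < 1) :
    matLog (1 + matConj X) = matConj (matLog (1 + X)) := by
  rw [matLog_one_add_eq hX, matLog_one_add_eq ((norm_matConj X).trans_lt hX), map_mul,
    map_logQuot matConj (continuous_id.matrix_map Complex.continuous_conj) hX]

end MatLog

section LogMonodromy

variable {ρ : ℝ} [hρ : Fact (1 < ρ)]

/-- The logarithm of the monodromy divided by `2πi t` (extended to `t = 0`), as a matrix loop. -/
def logMonodromy (m : ℕ) (t : ℝ) (x : Params ρ) : LoopMat ρ :=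
  (2 * Real.pi * Complex.I : ℂ)⁻¹ • logTransport (t : ℂ) (gaugedPotential m x)

/-- `(t, x)` is so small that the series for the monodromy and its logarithm converge. -/
def IsSmall (m : ℕ) (t : ℝ) (x : Params ρ) : Prop :=
  ‖(t : ℂ) • gaugedPotential m x‖ < 1 ∧
    ‖(t : ℂ) • transportQuot (t : ℂ) (gaugedPotential m x)‖ < 1

variable {m : ℕ} {t : ℝ} {x : Params ρ}

open scoped Matrix.Norms.Operator in
theorem IsSmall.norm_eval_lt_one (h : IsSmall m t x) (l : Circle) :
    ‖(t : ℂ) • LoopMat.eval l (transportQuot (t : ℂ) (gaugedPotential m x))‖ < 1 := by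
  rw [← map_smul]
  exact (LoopMat.norm_eval_le l _).trans_lt h.2

open scoped Matrix.Norms.Operator in
theorem matLog_M (hm : 1 ≤ m) (h : IsSmall m t x) (l : Circle) : matLog (M m t x l) =
    ((t : ℂ) * (2 * Real.pi * Complex.I)) • LoopMat.eval l (logMonodromy m t x) := by
  have hlog := map_logQuot (LoopMat.eval l) (LoopMat.eval l).cont h.2
  rw [map_smul] at hlog
  rw [M_eq_one_add hm l h.1, matLog_one_add_eq (h.norm_eval_lt_one l), ← hlog, logMonodromy,
    map_smul, smul_smul, mul_assoc, mul_inv_cancel₀ Complex.two_pi_I_ne_zero, mul_one,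
    logTransport, map_mul, smul_mul_assoc]

theorem hasDerivAt_M (hm : 1 ≤ m) (x : Params ρ) (l : Circle) (i j : Fin 2) :
    HasDerivAt (fun s : ℝ => M m s x l i j)
      (LoopMat.eval l (totalIntegral (LoopMat ρ) (gaugedPotential m x)) i j) 0 := by
  set B := gaugedPotential m x
  have hquot : DifferentiableAt ℝ
      (fun s : ℝ => LoopMat.evalEntry l i j (transportQuot (s : ℂ) B)) 0 := by
    have hdiff := (hasStrictFDerivAt_transportQuot B).hasFDerivAt.differentiableAt
      |>.restrictScalars ℝ
    rw [← Complex.ofReal_zero] at hdiff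
    have hpair : DifferentiableAt ℝ (fun s : ℝ => ((s : ℂ), B)) 0 :=
      Complex.ofRealCLM.differentiableAt.prodMk (differentiableAt_const B)
    have hcomp : DifferentiableAt ℝ (fun s : ℝ => transportQuot (s : ℂ) B) 0 :=
      DifferentiableAt.comp (g := fun p : ℂ × PathAlgebra (LoopMat ρ) => transportQuot p.1 p.2)
        (f := fun s : ℝ => ((s : ℂ), B)) 0 hdiff hpair
    exact DifferentiableAt.comp (g := LoopMat.evalEntry l i j)
      (f := fun s : ℝ => transportQuot (s : ℂ) B) 0
      ((LoopMat.evalEntry l i j).differentiableAt.restrictScalars ℝ) hcomp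
  have hofReal : HasDerivAt (fun s : ℝ => (s : ℂ)) 1 0 := Complex.ofRealCLM.hasDerivAt
  have hsmall : ∀ᶠ s : ℝ in nhds 0, ‖(s : ℂ) • B‖ < 1 := by
    have hcont : Continuous fun s : ℝ => ‖(s : ℂ) • B‖ :=
      (Complex.continuous_ofReal.smul continuous_const).norm
    exact hcont.continuousAt.eventually_lt continuousAt_const (by simp)
  have hderiv := (hofReal.mul hquot.hasDerivAt).const_add ((1 : Mat) i j)
  rw [Complex.ofReal_zero, transportQuot_zero_left, one_mul, zero_mul, add_zero] at hderiv
  refine hderiv.congr_of_eventuallyEq ?_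
  filter_upwards [hsmall] with s hs
  rw [M_eq_one_add hm l hs]
  rfl

theorem Mtilde_eq (hm : 1 ≤ m) (h : IsSmall m t x) (l : Circle) :
    Mtilde m t x l = (2 * Real.pi * Complex.I : ℂ) • LoopMat.eval l (logMonodromy m t x) := by
  rw [Mtilde]
  split_ifs with ht
  · subst ht
    rw [logMonodromy, map_smul, smul_smul, mul_inv_cancel₀ Complex.two_pi_I_ne_zero, one_smul]
    ext i j
    rw [Matrix.of_apply, (hasDerivAt_M hm x l i j).deriv, Complex.ofReal_zero,
      logTransport_zero_left]
  · rw [matLog_M hm h, smul_smul, inv_mul_cancel_left₀ (Complex.ofReal_ne_zero.2 ht)]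

theorem totalIntegral_gaugedPotential (hm : 1 ≤ m) (x : Params ρ) :
    totalIntegral (LoopMat ρ) (gaugedPotential m x) = (2 * Real.pi * Complex.I : ℂ) •
      (residue m 0 x + (x.1 : ℂ) • (nilp * residue m 0 x - residue m 0 x * nilp) -
        ((x.1 : ℂ) ^ 2) • (nilp * residue m 0 x * nilp)) := by
  have hterm (j : ℕ) (hj : j ∈ Finset.range (2 * m + 2)) (k : ℕ) (E : LoopMat ρ) :
      totalIntegral (LoopMat ρ) (PathAlgebra.smulConst (loopForm m j k) E) =
        if j = 0 then (2 * Real.pi * Complex.I : ℂ) • E else 0 := by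
    rw [totalIntegral_smulConst, totalIntegral_loopForm hm (Finset.mem_range.1 hj), ite_smul,
      zero_smul]
  rw [gaugedPotential, map_sum, Finset.sum_eq_single 0]
  · simp only [map_sub, map_add, hterm 0 (by simp), if_true, smul_sub, smul_add]
  · intro j hj hj0
    simp only [map_sub, map_add, hterm j hj, if_neg hj0, add_zero, sub_zero]
  · exact fun h => absurd (Finset.mem_range.2 (by omega)) h

theorem eval_logMonodromy_zero (hm : 1 ≤ m) (x : Params ρ) (l : Circle) :
    LoopMat.eval l (logMonodromy m 0 x) =
      !![x.2.1.eval l - x.1 * ((l : ℂ)⁻¹ * x.2.2.1.eval l), (l : ℂ)⁻¹ * x.2.2.1.eval l;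
        l * x.2.2.2.eval l + 2 * x.1 * x.2.1.eval l - x.1 ^ 2 * ((l : ℂ)⁻¹ * x.2.2.1.eval l),
        x.1 * ((l : ℂ)⁻¹ * x.2.2.1.eval l) - x.2.1.eval l] := by
  rw [logMonodromy, Complex.ofReal_zero, logTransport_zero_left, totalIntegral_gaugedPotential hm,
    smul_smul, inv_mul_cancel₀ Complex.two_pi_I_ne_zero, one_smul]
  simp only [map_sub, map_add, map_smul, map_mul, eval_nilp, eval_residue, matA]
  ext i k
  fin_cases i <;> fin_cases k <;> simp <;> ring

end LogMonodromy

/-! ### Reality of the logarithm of the monodromy -/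

section Reality

open ComplexConjugate

theorem conj_W_eval {ρ : ℝ} (f : W ρ) (l : ℂ) : conj (f.eval (conj l)) = f.eval l := by
  rw [W.eval, W.eval, Complex.conj_tsum]
  exact tsum_congr fun k => by rw [map_mul, map_pow, Complex.conj_conj, Complex.conj_ofReal]

theorem conj_puncture {m j : ℕ} (hj : j ≤ 2 * m + 2) :
    conj (puncture m j) = puncture m (2 * m + 2 - j) := by
  rw [← Complex.inv_eq_conj (norm_puncture m j), puncture_eq_pow m j, puncture_eq_pow m (_ - _),
    eq_comm, ← mul_eq_one_iff_eq_inv₀ (pow_ne_zero _ (puncture_ne_zero m 1)), ← pow_add,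
    Nat.sub_add_cancel hj, ← puncture_eq_pow]
  rw [← puncture_mod_card, Nat.mod_self, puncture_zero]

theorem neg_one_pow_sub {m j : ℕ} (hj : j ≤ 2 * m + 2) :
    (-1 : ℂ) ^ (2 * m + 2 - j) = (-1) ^ j := by
  rw [← mul_left_inj' (pow_ne_zero j (neg_ne_zero.2 one_ne_zero)), ← pow_add,
    Nat.sub_add_cancel hj, ← mul_pow, neg_mul_neg, one_mul, one_pow]
  exact Even.neg_one_pow ⟨m + 1, by ring⟩

theorem matConj_matA {ρ : ℝ} {m j : ℕ} (hj : j ≤ 2 * m + 2) (x : Params ρ) (l : ℂ) :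
    matConj (matA m x j (conj l)) = matA m x (2 * m + 2 - j) l := by
  have hconj (f : W ρ) : conj (f.eval ((-1) ^ j * conj l)) = f.eval ((-1) ^ j * l) := by
    rw [← conj_W_eval f ((-1) ^ j * l)]
    simp
  rw [matA_eq, matA_eq, neg_one_pow_sub hj, ← conj_puncture hj]
  ext i k
  fin_cases i <;> fin_cases k <;> simp [matConj_apply, hconj]

theorem sum_range_reflect_of_eq {A : Type*} [AddCommGroup A] {f : ℕ → A} {n : ℕ}
    (h : f n = f 0) : ∑ j ∈ Finset.range n, f (n - j) = ∑ j ∈ Finset.range n, f j := by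
  have hreflect := Finset.sum_range_reflect f (n + 1)
  rw [Finset.sum_range_succ, Finset.sum_range_succ f] at hreflect
  simp only [Nat.add_sub_cancel, Nat.sub_self, ← h] at hreflect
  exact add_right_cancel hreflect

theorem matConj_potential {ρ : ℝ} (m : ℕ) (t : ℝ) (x : Params ρ) (l z : ℂ) :
    matConj (potential m t x (conj l) (conj z)) = potential m t x l z := by
  let f : ℕ → Mat := fun j => (z - puncture m j)⁻¹ • matA m x j l
  have hterm (j : ℕ) (hj : j ∈ Finset.range (2 * m + 2)) :
      matConj ((conj z - puncture m j)⁻¹ • matA m x j (conj l)) = f (2 * m + 2 - j) := by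
    have hle := (Finset.mem_range.1 hj).le
    rw [matConj_smul, matConj_matA hle, map_inv₀, map_sub, Complex.conj_conj, conj_puncture hle]
  have hperiod : f (2 * m + 2) = f 0 := by
    have hpuncture : puncture m (2 * m + 2) = puncture m 0 := by
      simpa using (puncture_mod_card m (2 * m + 2)).symm
    have hsign := neg_one_pow_sub (Nat.zero_le (2 * m + 2))
    rw [Nat.sub_zero] at hsign
    simp only [f, matA_eq, hpuncture, hsign]
  rw [potential, potential, map_add, matConj_smul, map_sum, Complex.conj_ofReal,
    Finset.sum_congr rfl hterm, sum_range_reflect_of_eq hperiod]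
  congr 1
  ext i j
  fin_cases i <;> fin_cases j <;> simp [matConj_apply]

theorem conj_loop (m : ℕ) (s : ℝ) : conj (loop m (1 - s)) = loop m s := by
  have hexp : conj (2 * Real.pi * Complex.I * ((1 - s : ℝ) : ℂ)) =
      2 * Real.pi * Complex.I * s - 2 * Real.pi * Complex.I := by
    simp only [map_mul, map_ofNat, Complex.conj_ofReal, Complex.conj_I]
    push_cast
    ring
  rw [loop, loop, map_mul, Complex.conj_ofReal, map_sub, map_one, ← Complex.exp_conj, hexp,
    Complex.exp_sub, Complex.exp_two_pi_mul_I, div_one]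

theorem conj_deriv_of_conj_eq {γ : ℝ → ℂ} (hγ : ∀ s, conj (γ (1 - s)) = γ s) (s : ℝ) :
    conj (deriv γ (1 - s)) = -deriv γ s := by
  have hderiv : deriv (fun u => star (γ (1 - u))) s = deriv γ s :=
    congrArg (deriv · s) (funext hγ)
  rw [← hderiv, deriv.star, deriv_comp_const_sub, star_neg, neg_neg]
  rfl

section Symmetry

variable {η η' : ℂ → Mat} {γ : ℝ → ℂ} {Y Y' : ℝ → Mat}

theorem IsSolutionAlong.hasDerivWithinAt_matConj_reverse (hY : IsSolutionAlong η' γ Y)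
    (hη : ∀ z, matConj (η' (conj z)) = η z) (hγ : ∀ s, conj (γ (1 - s)) = γ s) :
    ∀ s ∈ Set.Icc (0 : ℝ) 1, ∀ i j, HasDerivWithinAt (fun u => matConj (Y (1 - u)) i j)
      ((matConj (Y (1 - s)) * (deriv γ s • η (γ s))) i j) (Set.Icc 0 1) s := by
  intro s hs i j
  have hmaps : Set.MapsTo (fun u : ℝ => 1 - u) (Set.Icc 0 1) (Set.Icc 0 1) := fun u hu =>
    ⟨sub_nonneg.2 hu.2, sub_le_self 1 hu.1⟩
  have hsub : HasDerivWithinAt (fun u : ℝ => 1 - u) (-1) (Set.Icc 0 1) s := by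
    simpa using (hasDerivWithinAt_id s (Set.Icc (0 : ℝ) 1)).const_sub 1
  refine ((hY.2 (1 - s) (hmaps hs) i j).scomp s hsub hmaps).star.congr_deriv ?_
  have hη' : matConj (η' (γ (1 - s))) = η (γ s) := by
    rw [← hη, ← hγ s, Complex.conj_conj]
  rw [neg_one_smul, star_neg, star_mul', Complex.star_def, conj_deriv_of_conj_eq hγ,
    ← matConj_apply, map_mul, hη', mul_smul_comm, Matrix.smul_apply, smul_eq_mul, neg_mul, neg_neg]

theorem IsSolutionAlong.matConj_mul_eq_one
    (hcont : ∀ i j, ContinuousOn (fun s => (deriv γ s • η (γ s)) i j) (Set.Icc 0 1))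
    (hη : ∀ z, matConj (η' (conj z)) = η z) (hγ : ∀ s, conj (γ (1 - s)) = γ s)
    (hY' : IsSolutionAlong η' γ Y') (hY : IsSolutionAlong η γ Y) :
    matConj (Y' 1) * Y 1 = 1 := by
  have hmul : ∀ s ∈ Set.Icc (0 : ℝ) 1, ∀ i j,
      HasDerivWithinAt (fun u => (matConj (Y' 1) * Y u) i j)
        ((matConj (Y' 1) * Y s * (deriv γ s • η (γ s))) i j) (Set.Icc 0 1) s := by
    intro s hs i j
    have hsum := HasDerivWithinAt.fun_sum (u := Finset.univ) fun k _ =>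
      (hY.hasDerivWithinAt s hs k j).const_mul (matConj (Y' 1) i k)
    rw [mul_assoc]
    exact hsum
  have hinit : matConj (Y' 1) * Y 0 = matConj (Y' (1 - 0)) := by rw [hY.1, mul_one, sub_zero]
  have hend := eqOn_Icc_of_hasDerivWithinAt_matrix_mul hcont hmul
    (hY'.hasDerivWithinAt_matConj_reverse hη hγ) hinit (Set.right_mem_Icc.2 zero_le_one)
  beta_reduce at hend
  rwa [sub_self, hY'.1, map_one] at hend

end Symmetry

variable {ρ : ℝ} [hρ : Fact (1 < ρ)] {m : ℕ} {t : ℝ} {x : Params ρ}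

theorem exists_isSolutionAlong (hm : 1 ≤ m) (l : Circle) (h : IsSmall m t x) :
    ∃ Y, IsSolutionAlong (potential m t x l) (loop m) Y ∧ M m t x l = Y 1 :=
  have hY := isSolutionAlong_transport_mul_gauge hm t x l h.1
  ⟨_, hY, M_eq_of_isSolutionAlong hY⟩

theorem matConj_M_mul (hm : 1 ≤ m) (h : IsSmall m t x) (l : Circle) :
    matConj (M m t x (l⁻¹ : Circle)) * M m t x l = 1 := by
  obtain ⟨Y, hY, hM⟩ := exists_isSolutionAlong hm l h
  obtain ⟨Y', hY', hM'⟩ := exists_isSolutionAlong hm l⁻¹ h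
  rw [hM, hM']
  rw [Circle.coe_inv_eq_conj] at hY'
  exact IsSolutionAlong.matConj_mul_eq_one (continuousOn_deriv_loop_smul_potential m t x l)
    (matConj_potential m t x l) (conj_loop m) hY' hY

theorem matConj_matLog_M (hm : 1 ≤ m) (h : IsSmall m t x) (l : Circle) :
    matConj (matLog (M m t x (l⁻¹ : Circle))) = -matLog (M m t x l) := by
  have hmul := mul_eq_one_comm.1 (matConj_M_mul hm h l)
  rw [M_eq_one_add hm l h.1, M_eq_one_add hm l⁻¹ h.1, map_add, map_one] at hmul
  rw [M_eq_one_add hm l h.1, M_eq_one_add hm l⁻¹ h.1,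
    ← matLog_matConj (h.norm_eval_lt_one l⁻¹)]
  exact matLog_of_mul_eq_one (h.norm_eval_lt_one l)
    ((norm_matConj _).trans_lt (h.norm_eval_lt_one l⁻¹)) hmul

theorem matConj_eval_logMonodromy (hm : 1 ≤ m) (h : IsSmall m t x) (l : Circle) :
    matConj (LoopMat.eval l⁻¹ (logMonodromy m t x)) = LoopMat.eval l (logMonodromy m t x) := by
  rcases eq_or_ne t 0 with rfl | ht
  · rw [eval_logMonodromy_zero hm, eval_logMonodromy_zero hm, Circle.coe_inv_eq_conj]
    have htwo : conj (2 : ℂ) = 2 := map_ofNat _ 2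
    ext i j
    fin_cases i <;> fin_cases j <;> simp [matConj_apply, conj_W_eval, htwo]
  · have hlog := matConj_matLog_M hm h l
    have hconj : conj ((t : ℂ) * (2 * Real.pi * Complex.I)) =
        -((t : ℂ) * (2 * Real.pi * Complex.I)) := by
      simp only [map_mul, map_ofNat, Complex.conj_ofReal, Complex.conj_I, mul_neg]
    rw [matLog_M hm h, matLog_M hm h, matConj_smul, hconj, neg_smul, neg_inj] at hlog
    exact (smul_right_inj (mul_ne_zero (Complex.ofReal_ne_zero.2 ht)
      Complex.two_pi_I_ne_zero)).1 hlog

theorem conj_coeff_logMonodromy (hm : 1 ≤ m) (h : IsSmall m t x) (i j : Fin 2) (k : ℤ) :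
    conj (Wiener.coeff k (LoopMat.entry i j (logMonodromy m t x))) =
      Wiener.coeff k (LoopMat.entry i j (logMonodromy m t x)) := by
  set T := LoopMat.entry i j (logMonodromy m t x) with hT
  have hsum : Summable fun k => ‖conj (Wiener.coeff k T)‖ := by
    simpa only [RCLike.norm_conj] using Wiener.summable_norm_coeff T
  refine (Wiener.coeff_eq_of_eval_eq hsum (fun l => ?_) k).symm
  have heval := congrFun (congrFun (matConj_eval_logMonodromy hm h l) i) j
  rw [matConj_apply, LoopMat.eval_apply, LoopMat.eval_apply, ← hT] at heval
  rw [← heval, Wiener.eval_eq_tsum, Complex.conj_tsum]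
  exact tsum_congr fun k => by
    rw [map_mul, map_zpow₀, Circle.coe_inv_eq_conj, Complex.conj_conj]

end Reality

/-! ### The monodromy problem in terms of Laurent coefficients -/

section Coefficients

open ComplexConjugate

variable {ρ : ℝ} [hρ : Fact (1 < ρ)] {m : ℕ} {t : ℝ} {x : Params ρ}

theorem one_div_conj_circle (l : Circle) : 1 / conj (l : ℂ) = l := by
  rw [← Circle.coe_inv_eq_conj, Circle.coe_inv, one_div, inv_inv]

theorem forall_norm_eq_one_iff_forall_circle {p : ℂ → Prop} :
    (∀ l : ℂ, ‖l‖ = 1 → p l) ↔ ∀ l : Circle, p l :=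
  ⟨fun h l => h l l.norm_coe, fun h l hl => h ⟨l, mem_sphere_zero_iff_norm.2 hl⟩⟩

theorem one_div_mul_Mtilde (hm : 1 ≤ m) (h : IsSmall m t x) (l : Circle) (i j : Fin 2) :
    1 / (2 * Real.pi * Complex.I) * Mtilde m t x l i j =
      Wiener.eval l (LoopMat.entry i j (logMonodromy m t x)) := by
  rw [Mtilde_eq hm h, Matrix.smul_apply, smul_eq_mul, LoopMat.eval_apply, ← mul_assoc,
    one_div_mul_cancel Complex.two_pi_I_ne_zero, one_mul]

theorem one_div_mul_starLoop_Mtilde (hm : 1 ≤ m) (h : IsSmall m t x) (l : Circle)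
    (i j : Fin 2) :
    1 / (2 * Real.pi * Complex.I) * starLoop (fun w => Mtilde m t x w i j) l =
      -Wiener.eval l⁻¹ (LoopMat.entry i j (logMonodromy m t x)) := by
  have hreal := congrFun (congrFun (matConj_eval_logMonodromy hm h l⁻¹) i) j
  rw [inv_inv, matConj_apply, LoopMat.eval_apply, LoopMat.eval_apply] at hreal
  have hconj : conj (2 * Real.pi * Complex.I : ℂ) = -(2 * Real.pi * Complex.I) := by
    simp only [map_mul, map_ofNat, Complex.conj_ofReal, Complex.conj_I, mul_neg]
  rw [starLoop, one_div_conj_circle, Mtilde_eq hm h, Matrix.smul_apply, smul_eq_mul,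
    LoopMat.eval_apply, map_mul, hreal, hconj, neg_mul, mul_neg, ← mul_assoc,
    one_div_mul_cancel Complex.two_pi_I_ne_zero, one_mul]

theorem F_eq (hm : 1 ≤ m) (h : IsSmall m t x) (l : Circle) :
    F m t x l = Wiener.eval l (LoopMat.entry 0 0 (logMonodromy m t x)) -
      Wiener.eval l⁻¹ (LoopMat.entry 0 0 (logMonodromy m t x)) := by
  rw [F, mul_add, one_div_mul_Mtilde hm h, one_div_mul_starLoop_Mtilde hm h, sub_eq_add_neg]

theorem G_eq (hm : 1 ≤ m) (h : IsSmall m t x) (l : Circle) :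
    G m t x l = Wiener.eval l (LoopMat.entry 1 0 (logMonodromy m t x)) -
      Wiener.eval l⁻¹ (LoopMat.entry 0 1 (logMonodromy m t x)) := by
  rw [G, mul_add, one_div_mul_Mtilde hm h, one_div_mul_starLoop_Mtilde hm h, sub_eq_add_neg]

theorem H₁_eq (hm : 1 ≤ m) (h : IsSmall m t x) :
    H₁ m t x = Wiener.eval 1 (LoopMat.entry 0 1 (logMonodromy m t x)) := by
  rw [← one_div_mul_Mtilde hm h, H₁, Circle.coe_one]

theorem H₂_eq (hm : 1 ≤ m) (h : IsSmall m t x) :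
    H₂ m t x = Wiener.eval (-1) (LoopMat.entry 0 1 (logMonodromy m t x)) := by
  rw [← one_div_mul_Mtilde hm h, H₂, Circle.coe_neg, Circle.coe_one]

theorem solvesMonodromyProblem_iff (hm : 1 ≤ m) (h : IsSmall m t x) :
    SolvesMonodromyProblem m t x ↔
      (∀ k, Wiener.coeff k (LoopMat.entry 0 0 (logMonodromy m t x)) =
        Wiener.coeff (-k) (LoopMat.entry 0 0 (logMonodromy m t x))) ∧
      (∀ k, Wiener.coeff k (LoopMat.entry 1 0 (logMonodromy m t x)) =
        Wiener.coeff (-k) (LoopMat.entry 0 1 (logMonodromy m t x))) ∧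
      Wiener.eval 1 (LoopMat.entry 0 1 (logMonodromy m t x)) = 0 ∧
      Wiener.eval (-1) (LoopMat.entry 0 1 (logMonodromy m t x)) = 0 ∧ K x = 1 := by
  rw [SolvesMonodromyProblem, forall_norm_eq_one_iff_forall_circle,
    forall_norm_eq_one_iff_forall_circle, ← Wiener.eval_eq_eval_inv_iff,
    ← Wiener.eval_eq_eval_inv_iff, H₁_eq hm h, H₂_eq hm h]
  simp only [F_eq hm h, G_eq hm h, sub_eq_zero]

end Coefficients

/-! ### The defect of a matrix loop -/

section Defect

variable {ρ : ℝ} [hρ : Fact (1 < ρ)]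

/-- The space of values of the equations of the monodromy problem. -/
abbrev Target (ρ : ℝ) := W ρ × W ρ × W ρ × ℝ × ℝ

/-- The power series with coefficients `re T_{e (k + 1)}`, for a sign `e`. -/
def Wiener.strictHalfPart (e : ℤˣ) : Wiener ρ →L[ℝ] W ρ :=
  Wiener.halfPart e ∘L .mul ℝ (Wiener ρ) (Wiener.monomial (-e))

theorem Wiener.coeff_strictHalfPart (e : ℤˣ) (T : Wiener ρ) (k : ℕ) :
    (Wiener.strictHalfPart e T).coeff k = (Wiener.coeff (e * (k + 1)) T).re := by
  rw [Wiener.strictHalfPart, ContinuousLinearMap.comp_apply, ContinuousLinearMap.mul_apply',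
    Wiener.coeff_halfPart, Wiener.coeff_monomial_mul, sub_neg_eq_add, mul_add_one]

/-- The equations of the monodromy problem for a matrix loop `(u, v; w, *)` with real
coefficients: the components are `u_{k+1} - u_{-k-1}`, `w_k - v_{-k}` and `w_{-k-1} - v_{k+1}` for
`k ≥ 0`, and the values `v(1)` and `v(-1)`. -/
def defect : LoopMat ρ →L[ℝ] Target ρ :=
  let u : LoopMat ρ →L[ℝ] Wiener ρ := (LoopMat.entry 0 0).restrictScalars ℝ
  let v : LoopMat ρ →L[ℝ] Wiener ρ := (LoopMat.entry 0 1).restrictScalars ℝ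
  let w : LoopMat ρ →L[ℝ] Wiener ρ := (LoopMat.entry 1 0).restrictScalars ℝ
  let reEval (l : Circle) : Wiener ρ →L[ℝ] ℝ :=
    Complex.reCLM ∘L (Wiener.eval l).toContinuousLinearMap.restrictScalars ℝ
  (Wiener.strictHalfPart 1 ∘L u + (-1 : ℝ) • Wiener.strictHalfPart (-1) ∘L u).prod <|
    (Wiener.halfPart 1 ∘L w + (-1 : ℝ) • Wiener.halfPart (-1) ∘L v).prod <|
    (Wiener.strictHalfPart (-1) ∘L w + (-1 : ℝ) • Wiener.strictHalfPart 1 ∘L v).prod <|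
    (reEval 1 ∘L v).prod (reEval (-1) ∘L v)

theorem coeff_defect_diag (A : LoopMat ρ) (k : ℕ) : (defect A).1.coeff k =
    (Wiener.coeff (k + 1) (LoopMat.entry 0 0 A)).re -
      (Wiener.coeff (-(k + 1)) (LoopMat.entry 0 0 A)).re := by
  change (Wiener.strictHalfPart 1 (LoopMat.entry 0 0 A)).coeff k +
    (-1 : ℝ) * (Wiener.strictHalfPart (-1) (LoopMat.entry 0 0 A)).coeff k = _
  rw [Wiener.coeff_strictHalfPart, Wiener.coeff_strictHalfPart, Units.val_one, Units.val_neg,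
    Units.val_one, neg_one_mul, ← sub_eq_add_neg, one_mul, neg_one_mul]

theorem coeff_defect_pos (A : LoopMat ρ) (k : ℕ) : (defect A).2.1.coeff k =
    (Wiener.coeff k (LoopMat.entry 1 0 A)).re - (Wiener.coeff (-k) (LoopMat.entry 0 1 A)).re := by
  change (Wiener.coeff (1 * k) (LoopMat.entry 1 0 A)).re +
    (-1 : ℝ) * (Wiener.coeff (-1 * k) (LoopMat.entry 0 1 A)).re = _
  rw [neg_one_mul, ← sub_eq_add_neg, one_mul, neg_one_mul]

theorem coeff_defect_neg (A : LoopMat ρ) (k : ℕ) : (defect A).2.2.1.coeff k =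
    (Wiener.coeff (-(k + 1)) (LoopMat.entry 1 0 A)).re -
      (Wiener.coeff (k + 1) (LoopMat.entry 0 1 A)).re := by
  change (Wiener.strictHalfPart (-1) (LoopMat.entry 1 0 A)).coeff k +
    (-1 : ℝ) * (Wiener.strictHalfPart 1 (LoopMat.entry 0 1 A)).coeff k = _
  rw [Wiener.coeff_strictHalfPart, Wiener.coeff_strictHalfPart, Units.val_one, Units.val_neg,
    Units.val_one, neg_one_mul, neg_one_mul, one_mul, ← sub_eq_add_neg]

theorem defect_eval_one (A : LoopMat ρ) :
    (defect A).2.2.2.1 = (Wiener.eval 1 (LoopMat.entry 0 1 A)).re := rfl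

theorem defect_eval_neg_one (A : LoopMat ρ) :
    (defect A).2.2.2.2 = (Wiener.eval (-1) (LoopMat.entry 0 1 A)).re := rfl

theorem forall_int_iff {P : ℤ → Prop} :
    (∀ k, P k) ↔ (∀ k : ℕ, P k) ∧ ∀ k : ℕ, P (-(k + 1)) := by
  refine ⟨fun h => ⟨fun k => h _, fun k => h _⟩, fun ⟨hnat, hneg⟩ k => ?_⟩
  obtain ⟨n, rfl | rfl⟩ := k.eq_nat_or_neg
  · exact hnat n
  · cases n with
    | zero => exact hnat 0
    | succ n => exact_mod_cast hneg n

theorem forall_int_iff_of_neg_iff {P : ℤ → Prop} (h : ∀ k, P (-k) ↔ P k) (h0 : P 0) :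
    (∀ k, P k) ↔ ∀ k : ℕ, P (k + 1) := by
  simp only [forall_int_iff, h]
  refine ⟨And.right, fun hsucc => ⟨fun k => ?_, hsucc⟩⟩
  cases k with
  | zero => exact h0
  | succ k => exact_mod_cast hsucc k

theorem eq_iff_re_sub_re_eq_zero {z w : ℂ} (hz : z.im = 0) (hw : w.im = 0) :
    z = w ↔ z.re - w.re = 0 := by
  rw [Complex.ext_iff, hz, hw, sub_eq_zero, and_iff_left rfl]

variable {m : ℕ} {t : ℝ} {x : Params ρ}

theorem im_coeff_logMonodromy (hm : 1 ≤ m) (h : IsSmall m t x) (i j : Fin 2) (k : ℤ) :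
    (Wiener.coeff k (LoopMat.entry i j (logMonodromy m t x))).im = 0 :=
  Complex.conj_eq_iff_im.1 (conj_coeff_logMonodromy hm h i j k)

theorem im_eval_logMonodromy (hm : 1 ≤ m) (h : IsSmall m t x) (i j : Fin 2) {l : Circle}
    (hl : l⁻¹ = l) : (Wiener.eval l (LoopMat.entry i j (logMonodromy m t x))).im = 0 := by
  have hconj := congrFun (congrFun (matConj_eval_logMonodromy hm h l) i) j
  rw [hl, matConj_apply, LoopMat.eval_apply] at hconj
  exact Complex.conj_eq_iff_im.1 hconj

theorem solvesMonodromyProblem_iff_defect (hm : 1 ≤ m) (h : IsSmall m t x) :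
    SolvesMonodromyProblem m t x ↔ defect (logMonodromy m t x) = 0 ∧ K x = 1 := by
  have hcoeff (i j i' j' : Fin 2) (k k' : ℤ) :=
    eq_iff_re_sub_re_eq_zero (im_coeff_logMonodromy hm h i j k)
      (im_coeff_logMonodromy hm h i' j' k')
  have heval {l : Circle} (hl : l⁻¹ = l) :
      Wiener.eval l (LoopMat.entry 0 1 (logMonodromy m t x)) = 0 ↔
        (Wiener.eval l (LoopMat.entry 0 1 (logMonodromy m t x))).re = 0 := by
    simpa using eq_iff_re_sub_re_eq_zero (im_eval_logMonodromy hm h 0 1 hl) Complex.zero_im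
  rw [solvesMonodromyProblem_iff hm h, forall_int_iff_of_neg_iff
    (P := fun k => Wiener.coeff k _ = Wiener.coeff (-k) _) (fun k => by rw [neg_neg, eq_comm]) rfl,
    forall_int_iff (P := fun k => Wiener.coeff k (LoopMat.entry 1 0 _) = Wiener.coeff (-k) _),
    heval inv_one, heval (by rw [inv_neg, inv_one]), ← defect_eval_one, ← defect_eval_neg_one]
  simp only [neg_neg, hcoeff, ← coeff_defect_diag, ← coeff_defect_pos, ← coeff_defect_neg,
    Prod.ext_iff, W.ext_iff, Prod.fst_zero, Prod.snd_zero, W.coeff_zero]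
  tauto

end Defect

/-! ### Smoothness of the logarithm of the monodromy -/

section Smoothness

variable {ρ : ℝ} [hρ : Fact (1 < ρ)]

theorem hasStrictFDerivAt_logTransport_comp {𝒜 V : Type*} [NormedRing 𝒜] [NormedAlgebra ℂ 𝒜]
    [CompleteSpace 𝒜] [NormedAddCommGroup V] [NormedSpace ℝ V]
    {B : V → PathAlgebra 𝒜} {B' : V →L[ℝ] PathAlgebra 𝒜} {x : V} (hB : HasStrictFDerivAt B B' x) :
    HasStrictFDerivAt (fun p : ℝ × V => logTransport (p.1 : ℂ) (B p.2))
      ((totalIntegral 𝒜).restrictScalars ℝ ∘L B' ∘L .snd ℝ ℝ V +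
        (ContinuousLinearMap.fst ℝ ℝ V).smulRight (magnusTerm (B x))) (0, x) := by
  have hpair : HasStrictFDerivAt (fun p : ℝ × V => ((p.1 : ℂ), B p.2))
      ((Complex.ofRealCLM ∘L .fst ℝ ℝ V).prod (B' ∘L .snd ℝ ℝ V)) (0, x) :=
    (Complex.ofRealCLM ∘L .fst ℝ ℝ V).hasStrictFDerivAt.prodMk
      (HasStrictFDerivAt.comp (0, x) hB hasStrictFDerivAt_snd)
  have hlog := (hasStrictFDerivAt_logTransport (B x)).restrictScalars ℝ
  rw [← Complex.ofReal_zero] at hlog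
  refine (HasStrictFDerivAt.comp (g := fun q : ℂ × PathAlgebra 𝒜 => logTransport q.1 q.2)
    ((0 : ℝ), x) hlog hpair).congr_fderiv (ContinuousLinearMap.ext fun p => ?_)
  simp

theorem contDiff_gaugedPotential (m : ℕ) :
    ContDiff ℝ 1 (gaugedPotential m : Params ρ → PathAlgebra (LoopMat ρ)) := by
  have hr : ContDiff ℝ 1 fun x : Params ρ => (x.1 : ℂ) :=
    Complex.ofRealCLM.contDiff.comp contDiff_fst
  have hsmulConst (u : PathAlgebra ℂ) :
      ContDiff ℝ 1 (PathAlgebra.smulConst u : LoopMat ρ → PathAlgebra (LoopMat ρ)) :=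
    (PathAlgebra.smulConst (𝒜 := LoopMat ρ) u).contDiff.restrict_scalars ℝ
  have hres (j : ℕ) : ContDiff ℝ 1 (residue m j : Params ρ → LoopMat ρ) :=
    (residue (ρ := ρ) m j).contDiff
  refine ContDiff.sum fun j _ => ContDiff.sub (ContDiff.add ?_ ?_) ?_
  · exact (hsmulConst _).comp (hres j)
  · exact (hsmulConst _).comp
      (hr.smul ((contDiff_const.mul (hres j)).sub ((hres j).mul contDiff_const)))
  · exact (hsmulConst _).comp
      ((hr.pow 2).smul ((contDiff_const.mul (hres j)).mul contDiff_const))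

theorem eventually_isSmall (m : ℕ) (x : Params ρ) :
    ∀ᶠ p : ℝ × Params ρ in nhds (0, x), IsSmall m p.1 p.2 := by
  have ht : Continuous fun p : ℝ × Params ρ => (p.1 : ℂ) :=
    Complex.continuous_ofReal.comp continuous_fst
  have hB : Continuous fun p : ℝ × Params ρ => gaugedPotential m p.2 :=
    (contDiff_gaugedPotential m).continuous.comp continuous_snd
  have hquot : ContinuousAt (fun p : ℝ × Params ρ =>
      transportQuot (p.1 : ℂ) (gaugedPotential m p.2)) (0, x) := by
    refine ContinuousAt.comp (f := fun p : ℝ × Params ρ => ((p.1 : ℂ), gaugedPotential m p.2))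
      (g := fun q : ℂ × PathAlgebra (LoopMat ρ) => transportQuot q.1 q.2) ?_
      (ht.prodMk hB).continuousAt
    rw [Complex.ofReal_zero]
    exact (hasStrictFDerivAt_transportQuot _).continuousAt
  refine ((ht.smul hB).norm.continuousAt.eventually_lt continuousAt_const ?_).and
    ((ht.continuousAt.fun_smul hquot).norm.eventually_lt continuousAt_const ?_)
  · simp
  · simp

/-- The derivative of the logarithm of the monodromy with respect to `t` at `t = 0`. -/
def logMonodromyDeriv (m : ℕ) (x : Params ρ) : LoopMat ρ :=
  (2 * Real.pi * Complex.I : ℂ)⁻¹ • magnusTerm (gaugedPotential m x)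

theorem hasStrictFDerivAt_logMonodromy {m : ℕ} {x : Params ρ} {E : Params ρ →L[ℝ] LoopMat ρ}
    (hE : HasStrictFDerivAt (logMonodromy m 0) E x) :
    HasStrictFDerivAt (fun p : ℝ × Params ρ => logMonodromy m p.1 p.2)
      (E ∘L .snd ℝ ℝ (Params ρ) +
        (ContinuousLinearMap.fst ℝ ℝ (Params ρ)).smulRight (logMonodromyDeriv m x)) (0, x) := by
  have hB := (contDiff_gaugedPotential (ρ := ρ) m).contDiffAt.hasStrictFDerivAt (x := x) one_ne_zero
  have hlog := (hasStrictFDerivAt_logTransport_comp hB).const_smul (2 * Real.pi * Complex.I : ℂ)⁻¹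
  have hE_apply (ξ : Params ρ) : E ξ = (2 * Real.pi * Complex.I : ℂ)⁻¹ •
      totalIntegral (LoopMat ρ) (fderiv ℝ (gaugedPotential m) x ξ) := by
    have hinr := (ContinuousLinearMap.inr ℝ ℝ (Params ρ)).hasStrictFDerivAt (x := x)
    have hcomp := HasStrictFDerivAt.comp (f := ContinuousLinearMap.inr ℝ ℝ (Params ρ)) x hlog hinr
    rw [hE.hasFDerivAt.unique hcomp.hasFDerivAt]
    change (2 * Real.pi * Complex.I : ℂ)⁻¹ • (totalIntegral (LoopMat ρ)
      (fderiv ℝ (gaugedPotential m) x ξ) + (0 : ℝ) • magnusTerm (gaugedPotential m x)) = _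
    rw [zero_smul, add_zero]
  refine hlog.congr_fderiv (ContinuousLinearMap.ext fun p => ?_)
  change (2 * Real.pi * Complex.I : ℂ)⁻¹ • (totalIntegral (LoopMat ρ)
    (fderiv ℝ (gaugedPotential m) x p.2) + p.1 • magnusTerm (gaugedPotential m x)) =
    E p.2 + p.1 • logMonodromyDeriv m x
  rw [hE_apply, smul_add, smul_comm _ p.1, logMonodromyDeriv]

end Smoothness

/-! ### The second order term at the initial value -/

section SecondOrderTerm

theorem W.coeff_ofPoly {ρ : ℝ} (p : ℝ[X]) (k : ℕ) : (W.ofPoly p : W ρ).coeff k = p.coeff k := rfl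

theorem W.eval_ofPoly {ρ : ℝ} (p : ℝ[X]) (l : ℂ) :
    (W.ofPoly p : W ρ).eval l = Polynomial.aeval l p := by
  rw [Polynomial.aeval_eq_sum_range, W.eval,
    tsum_eq_sum (s := Finset.range (p.natDegree + 1)) fun k hk => ?_]
  · exact Finset.sum_congr rfl fun k _ => Complex.real_smul.symm
  · rw [W.coeff_ofPoly, Polynomial.coeff_eq_zero_of_natDegree_lt (by simpa using hk),
      Complex.ofReal_zero, zero_mul]

theorem puncture_pow_half (m j : ℕ) : puncture m j ^ (m + 1) = (-1) ^ j := by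
  rw [puncture, ← Complex.exp_nat_mul, ← Complex.exp_pi_mul_I, ← Complex.exp_nat_mul]
  congr 1
  have : (2 * m + 2 : ℂ) ≠ 0 := by exact_mod_cast (by omega : 2 * m + 2 ≠ 0)
  push_cast
  field_simp

theorem matA_x₀ {ρ : ℝ} (m j : ℕ) {l : ℂ} (hl : l ≠ 0) : matA m (x₀ ρ) j l =
    !![puncture m j ^ (m + 1) * l, puncture m j ^ (0 + 1) * (1 / 2 * (l - l⁻¹));
      -(puncture m j ^ (2 * m + 1) * (2 * l)), -(puncture m j ^ (m + 1) * l)] := by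
  have hsign : ((-1 : ℂ) ^ j) ^ 2 = 1 := by rw [← pow_mul, mul_comm, pow_mul]; simp
  have hpow : puncture m j ^ (2 * m + 1) = puncture m j ^ m * (-1) ^ j := by
    rw [← puncture_pow_half m j, ← pow_add]
    congr 1
    ring
  have hpuncture : puncture m j = (puncture m j ^ m)⁻¹ * (-1) ^ j := by
    rw [← puncture_pow_half m j, pow_succ,
      inv_mul_cancel_left₀ (pow_ne_zero _ (puncture_ne_zero m j))]
  rw [matA_eq, hpow, puncture_pow_half, zero_add, pow_one]
  simp only [x₀, W.eval_ofPoly]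
  ext i k
  fin_cases i <;> fin_cases k
  · simp
  · simp only [map_mul, map_sub, map_pow, aeval_X, map_one, aeval_C, Fin.zero_eta, Fin.mk_one,
      Matrix.of_apply, Matrix.cons_val', Matrix.cons_val_one, Matrix.cons_val_zero,
      Matrix.cons_val_fin_one, Complex.coe_algebraMap]
    conv_rhs => rw [hpuncture]
    rw [mul_pow, hsign]
    push_cast
    field_simp
  · simp
    ring
  · simp

variable {ρ : ℝ} [hρ : Fact (1 < ρ)]

/-- The loop `μ = (λ + λ⁻¹) / 2`. -/
def mu : Wiener ρ := (1 / 2 : ℂ) • (Wiener.monomial 1 + Wiener.monomial (-1))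

/-- The loop `ν = (λ - λ⁻¹) / 2`. -/
def nu : Wiener ρ := (1 / 2 : ℂ) • (Wiener.monomial 1 - Wiener.monomial (-1))

theorem eval_mu (l : Circle) : Wiener.eval l (mu : Wiener ρ) = 1 / 2 * (l + (l : ℂ)⁻¹) := by
  rw [mu, map_smul, map_add, Wiener.eval_monomial, Wiener.eval_monomial, smul_eq_mul, zpow_one,
    zpow_neg_one]

theorem eval_nu (l : Circle) : Wiener.eval l (nu : Wiener ρ) = 1 / 2 * (l - (l : ℂ)⁻¹) := by
  rw [nu, map_smul, map_sub, Wiener.eval_monomial, Wiener.eval_monomial, smul_eq_mul, zpow_one,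
    zpow_neg_one]

theorem mu_add_nu : (mu + nu : Wiener ρ) = Wiener.monomial 1 := by
  refine Wiener.ext_eval fun l => ?_
  rw [map_add, eval_mu, eval_nu, Wiener.eval_monomial, zpow_one]
  ring

theorem mu_mul_nu :
    (mu * nu : Wiener ρ) = (1 / 4 : ℂ) • (Wiener.monomial 2 - Wiener.monomial (-2)) := by
  refine Wiener.ext_eval fun l => ?_
  rw [map_mul, eval_mu, eval_nu, map_smul, map_sub, Wiener.eval_monomial, Wiener.eval_monomial,
    smul_eq_mul, zpow_neg, zpow_ofNat]
  ring

theorem coeff_mu_mul_nu (k : ℤ) : Wiener.coeff k (mu * nu : Wiener ρ) =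
    1 / 4 * ((if k = 2 then 1 else 0) - if k = -2 then 1 else 0) := by
  rw [mu_mul_nu, map_smul, map_sub, Wiener.coeff_monomial, Wiener.coeff_monomial, smul_eq_mul]

/-- The matrix `diag (f, -f)`. -/
def diagLoop (f : Wiener ρ) : LoopMat ρ := LoopMat.single 0 0 f - LoopMat.single 1 1 f

theorem eval_diagLoop (l : Circle) (f : Wiener ρ) :
    LoopMat.eval l (diagLoop f) = !![Wiener.eval l f, 0; 0, -Wiener.eval l f] := by
  rw [diagLoop, map_sub, LoopMat.eval_single, LoopMat.eval_single]
  ext i j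
  fin_cases i <;> fin_cases j <;> simp [Matrix.single]

theorem eval_single_zero_one (l : Circle) (f : Wiener ρ) :
    LoopMat.eval l (LoopMat.single 0 1 f) = !![0, Wiener.eval l f; 0, 0] := by
  rw [LoopMat.eval_single]
  ext i j
  fin_cases i <;> fin_cases j <;> simp [Matrix.single]

theorem eval_single_one_zero (l : Circle) (f : Wiener ρ) :
    LoopMat.eval l (LoopMat.single 1 0 f) = !![0, 0; Wiener.eval l f, 0] := by
  rw [LoopMat.eval_single]
  ext i j
  fin_cases i <;> fin_cases j <;> simp [Matrix.single]

theorem residue_x₀ (m j : ℕ) : residue m j (x₀ ρ) =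
    puncture m j ^ (m + 1) • diagLoop (mu + nu) +
      puncture m j ^ (0 + 1) • LoopMat.single 0 1 nu -
      puncture m j ^ (2 * m + 1) • LoopMat.single 1 0 ((2 : ℂ) • (mu + nu)) := by
  refine LoopMat.ext_eval fun l => ?_
  simp only [map_add, map_sub, map_smul (LoopMat.eval l), eval_residue,
    matA_x₀ m j (Circle.coe_ne_zero l), eval_diagLoop, eval_single_zero_one, eval_single_one_zero,
    mu_add_nu, Wiener.eval_monomial, zpow_one, eval_nu, map_smul (Wiener.eval l)]
  ext i k
  fin_cases i <;> fin_cases k <;> simp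

theorem commutator_residue_x₀ (m j : ℕ) :
    nilp * residue m j (x₀ ρ) - residue m j (x₀ ρ) * nilp =
      puncture m j ^ (m + 1) • LoopMat.single 1 0 ((2 : ℂ) • (mu + nu)) -
        puncture m j ^ (0 + 1) • diagLoop nu := by
  refine LoopMat.ext_eval fun l => ?_
  simp only [map_sub, map_mul, map_smul (LoopMat.eval l), eval_residue, eval_nilp,
    matA_x₀ m j (Circle.coe_ne_zero l), eval_diagLoop, eval_single_one_zero,
    mu_add_nu, Wiener.eval_monomial, zpow_one, eval_nu, map_smul (Wiener.eval l)]
  ext i k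
  fin_cases i <;> fin_cases k <;> simp
  ring

theorem nilp_mul_residue_x₀_mul_nilp (m j : ℕ) :
    nilp * residue m j (x₀ ρ) * nilp = puncture m j ^ (0 + 1) • LoopMat.single 1 0 nu := by
  refine LoopMat.ext_eval fun l => ?_
  simp only [map_mul, map_smul (LoopMat.eval l), eval_residue, eval_nilp,
    matA_x₀ m j (Circle.coe_ne_zero l), eval_single_one_zero, eval_nu]
  ext i k
  fin_cases i <;> fin_cases k <;> simp

theorem sum_smulConst_loopForm {𝒜 : Type*} [NormedRing 𝒜] [NormedAlgebra ℂ 𝒜] {m i : ℕ}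
    (hi : i < 2 * m + 2) (k : ℕ) (E : 𝒜) :
    ∑ j ∈ Finset.range (2 * m + 2),
        PathAlgebra.smulConst (loopForm m j k) (puncture m j ^ (i + 1) • E) =
      PathAlgebra.smulConst (cyclotomicForm m (i + k)) E := by
  rw [PathAlgebra.sum_smulConst_smul, sum_puncture_pow_smul_loopForm hi]

theorem gaugedPotential_x₀ (m : ℕ) : gaugedPotential m (x₀ ρ) =
    PathAlgebra.smulConst (cyclotomicForm m m) (diagLoop mu) +
      PathAlgebra.smulConst (cyclotomicForm m 0) (LoopMat.single 0 1 nu) -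
      PathAlgebra.smulConst (cyclotomicForm m (2 * m)) (LoopMat.single 1 0 nu) := by
  have hr : (((x₀ ρ).1 : ℝ) : ℂ) = 1 := Complex.ofReal_one
  have hm : m < 2 * m + 2 := by omega
  have hm₂ : 2 * m < 2 * m + 2 := by omega
  have hdiag : diagLoop (mu + nu : Wiener ρ) = diagLoop mu + diagLoop nu := by
    simp only [diagLoop, map_add, add_sub_add_comm]
  simp only [gaugedPotential, hr, one_pow, one_smul, commutator_residue_x₀,
    nilp_mul_residue_x₀_mul_nilp]
  simp only [residue_x₀, map_add, map_sub, Finset.sum_add_distrib, Finset.sum_sub_distrib]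
  rw [sum_smulConst_loopForm hm, sum_smulConst_loopForm (2 * m + 1).succ_pos,
    sum_smulConst_loopForm hm₂, sum_smulConst_loopForm hm,
    sum_smulConst_loopForm (2 * m + 1).succ_pos, sum_smulConst_loopForm (2 * m + 1).succ_pos]
  simp only [hdiag, map_add, add_zero, zero_add, ← two_mul]
  module

theorem totalIntegral_volterra_smulConst_mul {𝒜 : Type*} [NormedRing 𝒜] [NormedAlgebra ℂ 𝒜]
    [CompleteSpace 𝒜] (u v : PathAlgebra ℂ) (E F : 𝒜) :
    totalIntegral 𝒜 (PathAlgebra.smulConst (volterra ℂ u) E * PathAlgebra.smulConst v F) =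
      iterInt u v • (E * F) := by
  rw [PathAlgebra.smulConst_mul_smulConst, totalIntegral_smulConst, iterInt]

theorem eval_magnusTerm (u v w : PathAlgebra ℂ) (p q : Wiener ρ) (l : Circle) :
    LoopMat.eval l (magnusTerm (PathAlgebra.smulConst u (diagLoop p) +
        PathAlgebra.smulConst v (LoopMat.single 0 1 q) -
        PathAlgebra.smulConst w (LoopMat.single 1 0 q))) =
      !![(iterInt u u - 1 / 2 * totalIntegral ℂ u ^ 2) * Wiener.eval l p ^ 2 -
          (iterInt v w - 1 / 2 * (totalIntegral ℂ v * totalIntegral ℂ w)) * Wiener.eval l q ^ 2,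
        (iterInt u v - iterInt v u) * Wiener.eval l (p * q);
        (iterInt u w - iterInt w u) * Wiener.eval l (p * q),
        (iterInt u u - 1 / 2 * totalIntegral ℂ u ^ 2) * Wiener.eval l p ^ 2 -
          (iterInt w v - 1 / 2 * (totalIntegral ℂ v * totalIntegral ℂ w)) *
            Wiener.eval l q ^ 2] := by
  simp only [magnusTerm, map_add (volterra (LoopMat ρ)), map_sub (volterra (LoopMat ρ)),
    volterra_smulConst, mul_add, mul_sub, add_mul, sub_mul, map_add (totalIntegral (LoopMat ρ)),
    map_sub (totalIntegral (LoopMat ρ)), totalIntegral_volterra_smulConst_mul,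
    totalIntegral_smulConst, smul_mul_smul_comm]
  simp only [map_add (LoopMat.eval l), map_sub (LoopMat.eval l), map_smul (LoopMat.eval l),
    map_mul, eval_diagLoop, eval_single_zero_one, eval_single_one_zero]
  ext i k
  fin_cases i <;> fin_cases k <;> simp <;> ring

theorem coeff_neg_entry_logMonodromyDeriv_x₀ (m : ℕ) (k : ℤ) :
    Wiener.coeff k (LoopMat.entry 0 0 (logMonodromyDeriv m (x₀ ρ))) =
      Wiener.coeff (-k) (LoopMat.entry 0 0 (logMonodromyDeriv m (x₀ ρ))) := by
  refine (Wiener.eval_eq_eval_inv_iff _ _).1 (fun l => ?_) k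
  rw [← LoopMat.eval_apply, ← LoopMat.eval_apply, logMonodromyDeriv, map_smul, map_smul,
    gaugedPotential_x₀, eval_magnusTerm, eval_magnusTerm, Matrix.smul_apply, Matrix.smul_apply,
    eval_mu, eval_nu, eval_mu, eval_nu]
  simp only [Matrix.of_apply, Matrix.cons_val', Matrix.cons_val_zero, Matrix.cons_val_fin_one,
    Circle.coe_inv, inv_inv]
  ring

theorem entry_zero_one_logMonodromyDeriv_x₀ (m : ℕ) :
    LoopMat.entry 0 1 (logMonodromyDeriv m (x₀ ρ)) = ((2 * Real.pi * Complex.I : ℂ)⁻¹ *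
      (iterInt (cyclotomicForm m m) (cyclotomicForm m 0) -
        iterInt (cyclotomicForm m 0) (cyclotomicForm m m))) • (mu * nu) := by
  refine Wiener.ext_eval fun l => ?_
  rw [← LoopMat.eval_apply, logMonodromyDeriv, map_smul, map_smul, gaugedPotential_x₀,
    eval_magnusTerm, Matrix.smul_apply, smul_eq_mul, smul_eq_mul]
  exact (mul_assoc _ _ _).symm

theorem entry_one_zero_logMonodromyDeriv_x₀ (m : ℕ) :
    LoopMat.entry 1 0 (logMonodromyDeriv m (x₀ ρ)) = ((2 * Real.pi * Complex.I : ℂ)⁻¹ *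
      (iterInt (cyclotomicForm m m) (cyclotomicForm m (2 * m)) -
        iterInt (cyclotomicForm m (2 * m)) (cyclotomicForm m m))) • (mu * nu) := by
  refine Wiener.ext_eval fun l => ?_
  rw [← LoopMat.eval_apply, logMonodromyDeriv, map_smul, map_smul, gaugedPotential_x₀,
    eval_magnusTerm, Matrix.smul_apply, smul_eq_mul, smul_eq_mul]
  exact (mul_assoc _ _ _).symm

theorem coeff_logMonodromyDeriv_x₀_sub {m : ℕ} (hm : 1 ≤ m) (k : ℤ) :
    Wiener.coeff k (LoopMat.entry 1 0 (logMonodromyDeriv m (x₀ ρ))) -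
      Wiener.coeff (-k) (LoopMat.entry 0 1 (logMonodromyDeriv m (x₀ ρ))) =
    ((kappa m * ((if k = 2 then 1 else 0) - if k = -2 then 1 else 0) : ℝ) : ℂ) := by
  have hI := iterInt_cyclotomicForm hm
  have hpi := inv_mul_cancel₀ Complex.two_pi_I_ne_zero
  rw [entry_zero_one_logMonodromyDeriv_x₀, entry_one_zero_logMonodromyDeriv_x₀, map_smul, map_smul,
    coeff_mu_mul_nu, coeff_mu_mul_nu]
  simp only [neg_inj, neg_eq_iff_eq_neg (b := (2 : ℤ)), smul_eq_mul, Complex.ofReal_mul,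
    Complex.ofReal_sub, apply_ite Complex.ofReal, Complex.ofReal_one, Complex.ofReal_zero]
  linear_combination (1 / 4 * ((if k = 2 then 1 else 0) - if k = -2 then 1 else 0)) *
    ((2 * Real.pi * Complex.I : ℂ)⁻¹ * hI + 4 * kappa m * hpi)

theorem re_eval_entry_logMonodromyDeriv_x₀ (m : ℕ) {l : Circle} (hl : l⁻¹ = l) :
    (Wiener.eval l (LoopMat.entry 0 1 (logMonodromyDeriv m (x₀ ρ)))).re = 0 := by
  rw [entry_zero_one_logMonodromyDeriv_x₀, map_smul, map_mul, eval_nu, ← Circle.coe_inv, hl,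
    sub_self, mul_zero, mul_zero, smul_zero, Complex.zero_re]

theorem defect_logMonodromyDeriv_x₀ {m : ℕ} (hm : 1 ≤ m) :
    defect (logMonodromyDeriv m (x₀ ρ)) =
      (0, W.ofPoly (C (kappa m) * X ^ 2), W.ofPoly (C (-kappa m) * X), 0, 0) := by
  refine Prod.ext (W.ext fun k => ?_) (Prod.ext (W.ext fun k => ?_)
    (Prod.ext (W.ext fun k => ?_) (Prod.ext ?_ ?_)))
  · rw [coeff_defect_diag, coeff_neg_entry_logMonodromyDeriv_x₀, sub_self, W.coeff_zero]
  · rw [coeff_defect_pos, ← Complex.sub_re, coeff_logMonodromyDeriv_x₀_sub hm, Complex.ofReal_re,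
      W.coeff_ofPoly, coeff_C_mul, coeff_X_pow, if_neg (by omega : ¬(k : ℤ) = -2), sub_zero]
    norm_cast
  · have hdiff := coeff_logMonodromyDeriv_x₀_sub (ρ := ρ) hm (-(k + 1))
    rw [neg_neg] at hdiff
    rw [coeff_defect_neg, ← Complex.sub_re, hdiff, Complex.ofReal_re, W.coeff_ofPoly, coeff_C_mul,
      coeff_X, if_neg (by omega : ¬(-((k : ℤ) + 1) = 2)), zero_sub]
    simp only [show (-((k : ℤ) + 1) = -2) = (1 = k) from propext (by omega)]
    ring
  · exact re_eval_entry_logMonodromyDeriv_x₀ m inv_one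
  · exact re_eval_entry_logMonodromyDeriv_x₀ m (by rw [inv_neg, inv_one])

end SecondOrderTerm

/-! ### Implicit curves -/

section ImplicitCurve

variable {E F : Type*} [NormedAddCommGroup E]

theorem exists_implicit_curve [NormedSpace ℝ E] [CompleteSpace E] [NormedAddCommGroup F]
    [NormedSpace ℝ F] [CompleteSpace F] {f : ℝ × E → F} {x x' : E} {D : ℝ × E →L[ℝ] F}
    (hf : HasStrictFDerivAt f D (0, x)) (hD : Function.Bijective (D ∘L .inr ℝ ℝ E))
    (hx' : D (1, x') = 0) :
    ∃ φ : ℝ → E, φ 0 = x ∧ HasDerivAt φ x' 0 ∧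
      ∀ᶠ p in nhds ((0 : ℝ), x), f p = f (0, x) ↔ p.2 = φ p.1 := by
  have hinv : (D ∘L .inr ℝ ℝ E).IsInvertible :=
    ⟨.ofBijective _ (LinearMap.ker_eq_bot.2 hD.1) (LinearMap.range_eq_top.2 hD.2),
      ContinuousLinearEquiv.coe_ofBijective _ _ _⟩
  refine ⟨hf.implicitFunctionOfProdDomain hinv,
    eq_of_tendsto_nhds (hf.tendsto_implicitFunctionOfProdDomain hinv), ?_, ?_⟩
  · convert! (hf.hasStrictFDerivAt_implicitFunctionOfProdDomain hinv).hasFDerivAt.hasDerivAt using 1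
    have hsum : D (1, 0) + D (0, x') = 0 := by
      rw [← map_add, Prod.mk_add_mk, add_zero, zero_add, hx']
    change x' = -((D ∘L .inr ℝ ℝ E).inverse (D (1, 0)))
    rw [eq_neg_of_add_eq_zero_left hsum, map_neg, neg_neg]
    exact (hinv.inverse_apply_eq.2 rfl).symm
  · filter_upwards [hf.eventually_apply_eq_iff_implicitFunctionOfProdDomain hinv] with p hp
    rw [hp, eq_comm]

theorem exists_uniform_neighbourhood {P : ℝ → E → Prop} {φ : ℝ → E} (hφ : ContinuousAt φ 0)
    (h : ∀ᶠ p in nhds ((0 : ℝ), φ 0), P p.1 p.2 ↔ p.2 = φ p.1) :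
    ∃ ε > 0, ∃ δ > 0, ∀ t : ℝ, |t| < ε → ‖φ t - φ 0‖ < δ ∧
      ∀ y : E, ‖y - φ 0‖ < δ → (P t y ↔ y = φ t) := by
  obtain ⟨δ, hδ, hP⟩ := Metric.eventually_nhds_iff_ball.1 h
  obtain ⟨ε, hε, hc⟩ := Metric.continuousAt_iff.1 hφ δ hδ
  refine ⟨min ε δ, lt_min hε hδ, δ, hδ, fun t ht => ⟨?_, fun y hy => hP (t, y) ?_⟩⟩
  · rw [← dist_eq_norm]
    exact hc (by rw [Real.dist_eq, sub_zero]; exact ht.trans_le (min_le_left _ _))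
  · rw [← ball_prod_same, Set.mem_prod, Metric.mem_ball, Metric.mem_ball, Real.dist_eq,
      sub_zero, dist_eq_norm]
    exact ⟨ht.trans_le (min_le_right _ _), hy⟩

end ImplicitCurve

/-! ### Shifts of power series -/

section Shift

variable {ρ : ℝ} [hρ : Fact (1 < ρ)]

theorem coeff_ofW_natCast (f : W ρ) (k : ℕ) :
    Wiener.coeff k (Wiener.ofW 0 f) = (f.coeff k : ℂ) := by
  rw [Wiener.coeff_ofW, if_pos k.cast_nonneg, Int.toNat_natCast]

theorem coeff_ofW_neg_natCast (f : W ρ) (k : ℕ) :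
    Wiener.coeff (-k) (Wiener.ofW 0 f) = if k = 0 then (f.coeff 0 : ℂ) else 0 := by
  rcases k with _ | k
  · exact coeff_ofW_natCast f 0
  · rw [Wiener.coeff_ofW, if_neg (by omega), if_neg k.succ_ne_zero]

/-- The power series `(f - f₀) / λ`. -/
def W.divX (f : W ρ) : W ρ := Wiener.halfPart 1 (Wiener.monomial (-1) * Wiener.ofW 0 f)

@[simp]
theorem W.coeff_divX (f : W ρ) (k : ℕ) : f.divX.coeff k = f.coeff (k + 1) := by
  rw [W.divX, Wiener.coeff_halfPart, Wiener.coeff_monomial_mul, Units.val_one, one_mul,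
    sub_neg_eq_add, ← Nat.cast_succ, coeff_ofW_natCast, Complex.ofReal_re]

/-- The power series `c + λ f`. -/
def W.cons (c : ℝ) (f : W ρ) : W ρ :=
  W.ofPoly (C c) + Wiener.halfPart 1 (Wiener.monomial 1 * Wiener.ofW 0 f)

@[simp]
theorem W.coeff_cons_zero (c : ℝ) (f : W ρ) : (W.cons c f).coeff 0 = c := by
  rw [W.cons, W.coeff_add, Wiener.coeff_halfPart, Wiener.coeff_monomial_mul, W.coeff_ofPoly,
    coeff_C_zero, Wiener.coeff_ofW, if_neg (by simp), Complex.zero_re, add_zero]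

@[simp]
theorem W.coeff_cons_succ (c : ℝ) (f : W ρ) (k : ℕ) : (W.cons c f).coeff (k + 1) = f.coeff k := by
  rw [W.cons, W.coeff_add, Wiener.coeff_halfPart, Wiener.coeff_monomial_mul, W.coeff_ofPoly,
    coeff_C_succ, zero_add, Units.val_one, one_mul, Nat.cast_succ, add_sub_cancel_right,
    coeff_ofW_natCast, Complex.ofReal_re]

@[simp]
theorem W.divX_cons (c : ℝ) (f : W ρ) : (W.cons c f).divX = f :=
  W.ext fun k => by rw [W.coeff_divX, W.coeff_cons_succ]

theorem W.eval_eq_coeff_zero_add (f : W ρ) (l : Circle) :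
    f.eval l = f.coeff 0 + l * f.divX.eval l := by
  have hsum : Summable fun k => (f.coeff k : ℂ) * (l : ℂ) ^ k :=
    .of_norm <| f.summable_norm_coeff.congr fun k => by
      rw [norm_mul, norm_pow, Circle.norm_coe, one_pow, mul_one]
  rw [W.eval, hsum.tsum_eq_zero_add, pow_zero, mul_one, W.eval, ← tsum_mul_left]
  refine congrArg _ (tsum_congr fun k => ?_)
  rw [W.coeff_divX, pow_succ']
  ring

/-- The real part of the value at a point of the unit circle. -/
def W.reEval (l : Circle) : W ρ →L[ℝ] ℝ :=
  Complex.reCLM ∘L (Wiener.eval l).toContinuousLinearMap.restrictScalars ℝ ∘L Wiener.ofW 0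

theorem W.reEval_apply (l : Circle) (f : W ρ) : W.reEval l f = (f.eval l).re := by
  change (Wiener.eval l (Wiener.ofW 0 f)).re = _
  rw [Wiener.eval_ofW, pow_zero, one_mul]

theorem W.reEval_one_eq_add (f : W ρ) :
    W.reEval 1 f = f.coeff 0 + f.coeff 1 + W.reEval 1 f.divX.divX := by
  rw [W.reEval_apply, W.reEval_apply, W.eval_eq_coeff_zero_add f, W.eval_eq_coeff_zero_add f.divX,
    Circle.coe_one, one_mul, one_mul, Complex.add_re, Complex.add_re, Complex.ofReal_re,
    Complex.ofReal_re, W.coeff_divX, add_assoc]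

theorem W.reEval_neg_one_eq_sub_add (f : W ρ) :
    W.reEval (-1) f = f.coeff 0 - f.coeff 1 + W.reEval (-1) f.divX.divX := by
  rw [W.reEval_apply, W.reEval_apply, W.eval_eq_coeff_zero_add f, W.eval_eq_coeff_zero_add f.divX,
    Circle.coe_neg, Circle.coe_one, neg_one_mul, neg_one_mul, Complex.add_re, Complex.neg_re,
    Complex.add_re, Complex.neg_re, Complex.ofReal_re, Complex.ofReal_re, W.coeff_divX]
  ring

theorem W.reEval_ofPoly_C (l : Circle) (c : ℝ) : W.reEval l (W.ofPoly (C c) : W ρ) = c := by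
  rw [W.reEval_apply, W.eval_ofPoly, aeval_C, Complex.coe_algebraMap, Complex.ofReal_re]

/-- The `k`-th coefficient, as a continuous linear functional. -/
def W.coeffCLM (k : ℕ) : W ρ →L[ℝ] ℝ :=
  Complex.reCLM ∘L (Wiener.coeff k).restrictScalars ℝ ∘L Wiener.ofW 0

theorem W.coeffCLM_apply (k : ℕ) (f : W ρ) : W.coeffCLM k f = f.coeff k := by
  change (Wiener.coeff k (Wiener.ofW 0 f)).re = _
  rw [coeff_ofW_natCast, Complex.ofReal_re]

end Shift

/-! ### The linearised equations at the initial value -/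

section Linearisation

variable {ρ : ℝ} [hρ : Fact (1 < ρ)] {m : ℕ}

theorem logMonodromy_zero (hm : 1 ≤ m) (x : Params ρ) : logMonodromy m 0 x =
    (1 + x.1 • nilp) * residue m 0 x * (1 + x.1 • -nilp) := by
  refine LoopMat.ext_eval fun l => ?_
  rw [eval_logMonodromy_zero hm, ← Complex.coe_smul, ← Complex.coe_smul, map_mul, map_mul, map_add,
    map_add, map_smul, map_smul, map_neg, map_one, eval_nilp, eval_residue, matA,
    Matrix.one_fin_two]
  ext i k
  fin_cases i <;> fin_cases k <;> simp <;> ring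

theorem exists_hasStrictFDerivAt_logMonodromy_zero (hm : 1 ≤ m) (x : Params ρ) :
    ∃ D : Params ρ →L[ℝ] LoopMat ρ, HasStrictFDerivAt (logMonodromy m 0) D x ∧
      ∀ ξ, D ξ = (1 + x.1 • nilp) * residue m 0 x * (ξ.1 • -nilp) +
        ((1 + x.1 • nilp) * residue m 0 ξ + (ξ.1 • nilp) * residue m 0 x) *
          (1 + x.1 • -nilp) := by
  have hgauge (N : LoopMat ρ) : HasStrictFDerivAt (fun y : Params ρ => 1 + y.1 • N)
      ((ContinuousLinearMap.fst ℝ ℝ (W ρ × W ρ × W ρ)).smulRight N) x :=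
    ((ContinuousLinearMap.fst ℝ ℝ (W ρ × W ρ × W ρ)).smulRight N).hasStrictFDerivAt.const_add 1
  have hprod := ((hgauge nilp).mul' (residue m 0).hasStrictFDerivAt).mul' (hgauge (-nilp))
  exact ⟨_, hprod.congr_of_eventuallyEq (.of_forall fun y => (logMonodromy_zero hm y).symm),
    fun ξ => rfl⟩

theorem hasStrictFDerivAt_logMonodromy_zero (hm : 1 ≤ m) (x : Params ρ) :
    HasStrictFDerivAt (logMonodromy m 0) (fderiv ℝ (logMonodromy m 0) x) x := by
  obtain ⟨D, hD, -⟩ := exists_hasStrictFDerivAt_logMonodromy_zero hm x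
  exact hD.congr_fderiv hD.hasFDerivAt.fderiv.symm

theorem fderiv_logMonodromy_zero_apply (hm : 1 ≤ m) (x ξ : Params ρ) :
    fderiv ℝ (logMonodromy m 0) x ξ = (1 + x.1 • nilp) * residue m 0 x * (ξ.1 • -nilp) +
      ((1 + x.1 • nilp) * residue m 0 ξ + (ξ.1 • nilp) * residue m 0 x) *
        (1 + x.1 • -nilp) := by
  obtain ⟨D, hD, hD_apply⟩ := exists_hasStrictFDerivAt_logMonodromy_zero hm x
  exact (congrArg (fun L : Params ρ →L[ℝ] LoopMat ρ => L ξ) hD.hasFDerivAt.fderiv).trans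
    (hD_apply ξ)

theorem eval_fderiv_logMonodromy_x₀ (hm : 1 ≤ m) (ξ : Params ρ) (l : Circle) :
    LoopMat.eval l (fderiv ℝ (logMonodromy m 0) (x₀ ρ) ξ) =
      !![ξ.2.1.eval l - (l : ℂ)⁻¹ * ξ.2.2.1.eval l - ξ.1 * (1 / 2 * (l - (l : ℂ)⁻¹)),
        (l : ℂ)⁻¹ * ξ.2.2.1.eval l;
        l * ξ.2.2.2.eval l + 2 * ξ.2.1.eval l - (l : ℂ)⁻¹ * ξ.2.2.1.eval l +
          ξ.1 * (l + (l : ℂ)⁻¹),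
        -(ξ.2.1.eval l - (l : ℂ)⁻¹ * ξ.2.2.1.eval l - ξ.1 * (1 / 2 * (l - (l : ℂ)⁻¹)))] := by
  have hr : (x₀ ρ).1 = 1 := rfl
  rw [fderiv_logMonodromy_zero_apply hm, hr, one_smul, one_smul, ← Complex.coe_smul,
    ← Complex.coe_smul]
  simp only [map_add, map_mul, map_smul (LoopMat.eval l), map_neg, map_one, eval_nilp,
    eval_residue, matA_x₀ m 0 (Circle.coe_ne_zero l), puncture_zero, one_pow, one_mul]
  simp only [Matrix.one_fin_two, matA]
  ext i k
  fin_cases i <;> fin_cases k <;> simp <;> ring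

theorem entry_zero_zero_fderiv_logMonodromy_x₀ (hm : 1 ≤ m) (ξ : Params ρ) :
    LoopMat.entry 0 0 (fderiv ℝ (logMonodromy m 0) (x₀ ρ) ξ) =
      Wiener.ofW 0 ξ.2.1 - Wiener.monomial (-1) * Wiener.ofW 0 ξ.2.2.1 - (ξ.1 : ℂ) • nu := by
  refine Wiener.ext_eval fun l => ?_
  rw [← LoopMat.eval_apply, eval_fderiv_logMonodromy_x₀ hm]
  simp only [map_sub, map_mul, map_smul, Wiener.eval_monomial, Wiener.eval_ofW, eval_nu, pow_zero,
    one_mul, smul_eq_mul, zpow_neg_one]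
  rfl

theorem entry_zero_one_fderiv_logMonodromy_x₀ (hm : 1 ≤ m) (ξ : Params ρ) :
    LoopMat.entry 0 1 (fderiv ℝ (logMonodromy m 0) (x₀ ρ) ξ) =
      Wiener.monomial (-1) * Wiener.ofW 0 ξ.2.2.1 := by
  refine Wiener.ext_eval fun l => ?_
  rw [← LoopMat.eval_apply, eval_fderiv_logMonodromy_x₀ hm, map_mul, Wiener.eval_monomial,
    Wiener.eval_ofW, pow_zero, one_mul, zpow_neg_one]
  rfl

theorem entry_one_zero_fderiv_logMonodromy_x₀ (hm : 1 ≤ m) (ξ : Params ρ) :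
    LoopMat.entry 1 0 (fderiv ℝ (logMonodromy m 0) (x₀ ρ) ξ) =
      Wiener.monomial 1 * Wiener.ofW 0 ξ.2.2.2 + (2 : ℂ) • Wiener.ofW 0 ξ.2.1 -
        Wiener.monomial (-1) * Wiener.ofW 0 ξ.2.2.1 +
        (ξ.1 : ℂ) • (Wiener.monomial 1 + Wiener.monomial (-1)) := by
  refine Wiener.ext_eval fun l => ?_
  rw [← LoopMat.eval_apply, eval_fderiv_logMonodromy_x₀ hm]
  simp only [map_add, map_sub, map_mul, map_smul, Wiener.eval_monomial, Wiener.eval_ofW, pow_zero,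
    one_mul, smul_eq_mul, zpow_one, zpow_neg_one]
  rfl

theorem coeff_nu (k : ℤ) : Wiener.coeff k (nu : Wiener ρ) =
    1 / 2 * ((if k = 1 then 1 else 0) - if k = -1 then 1 else 0) := by
  rw [nu, map_smul, map_sub, Wiener.coeff_monomial, Wiener.coeff_monomial, smul_eq_mul]

theorem defect_fderiv_logMonodromy_x₀_diag (hm : 1 ≤ m) (ξ : Params ρ) (k : ℕ) :
    (defect (fderiv ℝ (logMonodromy m 0) (x₀ ρ) ξ)).1.coeff k =
      ξ.2.1.coeff (k + 1) - ξ.2.2.1.coeff (k + 2) +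
        if k = 0 then ξ.2.2.1.coeff 0 - ξ.1 else 0 := by
  have ha := coeff_ofW_natCast ξ.2.1 (k + 1)
  have ha' := coeff_ofW_neg_natCast ξ.2.1 (k + 1)
  have hb := coeff_ofW_natCast ξ.2.2.1 (k + 2)
  have hb' := coeff_ofW_neg_natCast ξ.2.2.1 k
  push_cast at ha ha' hb
  rw [coeff_defect_diag, entry_zero_zero_fderiv_logMonodromy_x₀ hm]
  simp only [map_sub, map_smul, Wiener.coeff_monomial_mul, coeff_nu, smul_eq_mul, ha, ha',
    show (k : ℤ) + 1 - -1 = k + 2 by ring, hb, show -((k : ℤ) + 1) - -1 = -k by ring, hb']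
  rcases k with _ | k
  · norm_num
    ring
  · rw [if_neg (by omega), if_neg (by omega), if_neg (by omega), if_neg (by omega),
      if_neg (by omega), if_neg (by omega)]
    simp

theorem defect_fderiv_logMonodromy_x₀_pos_zero (hm : 1 ≤ m) (ξ : Params ρ) :
    (defect (fderiv ℝ (logMonodromy m 0) (x₀ ρ) ξ)).2.1.coeff 0 =
      2 * ξ.2.1.coeff 0 - 2 * ξ.2.2.1.coeff 1 := by
  have ha := coeff_ofW_natCast ξ.2.1 0
  have hb := coeff_ofW_natCast ξ.2.2.1 1
  have hc := coeff_ofW_neg_natCast ξ.2.2.2 1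
  push_cast at ha hb hc
  rw [coeff_defect_pos, entry_one_zero_fderiv_logMonodromy_x₀ hm,
    entry_zero_one_fderiv_logMonodromy_x₀ hm, Nat.cast_zero, neg_zero]
  simp only [map_sub, map_add, map_smul, Wiener.coeff_monomial_mul, Wiener.coeff_monomial,
    smul_eq_mul, ha, zero_sub, neg_neg, hb, hc]
  norm_num
  ring

theorem defect_fderiv_logMonodromy_x₀_pos_succ (hm : 1 ≤ m) (ξ : Params ρ) (k : ℕ) :
    (defect (fderiv ℝ (logMonodromy m 0) (x₀ ρ) ξ)).2.1.coeff (k + 1) =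
      ξ.2.2.2.coeff k + 2 * ξ.2.1.coeff (k + 1) - ξ.2.2.1.coeff (k + 2) +
        if k = 0 then ξ.1 - ξ.2.2.1.coeff 0 else 0 := by
  have ha := coeff_ofW_natCast ξ.2.1 (k + 1)
  have hb := coeff_ofW_natCast ξ.2.2.1 (k + 2)
  have hb' := coeff_ofW_neg_natCast ξ.2.2.1 k
  have hc := coeff_ofW_natCast ξ.2.2.2 k
  push_cast at ha hb
  rw [coeff_defect_pos, entry_one_zero_fderiv_logMonodromy_x₀ hm,
    entry_zero_one_fderiv_logMonodromy_x₀ hm, Nat.cast_succ]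
  simp only [map_sub, map_add, map_smul, Wiener.coeff_monomial_mul, Wiener.coeff_monomial,
    smul_eq_mul, ha, show (k : ℤ) + 1 - -1 = k + 2 by ring, hb,
    show -((k : ℤ) + 1) - -1 = -k by ring, hb', add_sub_cancel_right, hc]
  rcases k with _ | k
  · norm_num
    ring
  · rw [if_neg (by omega), if_neg (by omega), if_neg (by omega), if_neg (by omega)]
    simp

theorem defect_fderiv_logMonodromy_x₀_neg (hm : 1 ≤ m) (ξ : Params ρ) (k : ℕ) :
    (defect (fderiv ℝ (logMonodromy m 0) (x₀ ρ) ξ)).2.2.1.coeff k =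
      -ξ.2.2.1.coeff (k + 2) + if k = 0 then ξ.1 - ξ.2.2.1.coeff 0 else 0 := by
  have ha := coeff_ofW_neg_natCast ξ.2.1 (k + 1)
  have hb := coeff_ofW_natCast ξ.2.2.1 (k + 2)
  have hb' := coeff_ofW_neg_natCast ξ.2.2.1 k
  have hc := coeff_ofW_neg_natCast ξ.2.2.2 (k + 2)
  push_cast at ha hb hc
  rw [coeff_defect_neg, entry_one_zero_fderiv_logMonodromy_x₀ hm,
    entry_zero_one_fderiv_logMonodromy_x₀ hm]
  simp only [map_sub, map_add, map_smul, Wiener.coeff_monomial_mul, Wiener.coeff_monomial,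
    smul_eq_mul, ha, show (k : ℤ) + 1 - -1 = k + 2 by ring, hb,
    show -((k : ℤ) + 1) - -1 = -k by ring, hb', show -((k : ℤ) + 1) - 1 = -(k + 2) by ring, hc]
  rcases k with _ | k
  · norm_num
    ring
  · rw [if_neg (by omega), if_neg (by omega), if_neg (by omega), if_neg (by omega)]
    simp

theorem defect_fderiv_logMonodromy_x₀_eval_one (hm : 1 ≤ m) (ξ : Params ρ) :
    (defect (fderiv ℝ (logMonodromy m 0) (x₀ ρ) ξ)).2.2.2.1 = W.reEval 1 ξ.2.2.1 := by
  rw [defect_eval_one, entry_zero_one_fderiv_logMonodromy_x₀ hm, map_mul, Wiener.eval_monomial,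
    Circle.coe_one, one_zpow, one_mul]
  rfl

theorem defect_fderiv_logMonodromy_x₀_eval_neg_one (hm : 1 ≤ m) (ξ : Params ρ) :
    (defect (fderiv ℝ (logMonodromy m 0) (x₀ ρ) ξ)).2.2.2.2 = -W.reEval (-1) ξ.2.2.1 := by
  rw [defect_eval_neg_one, entry_zero_one_fderiv_logMonodromy_x₀ hm, map_mul,
    Wiener.eval_monomial, Circle.coe_neg, Circle.coe_one, zpow_neg_one, inv_neg, inv_one,
    neg_one_mul, Complex.neg_re]
  rfl

end Linearisation

theorem K_x₀ {ρ : ℝ} : K (x₀ ρ) = 1 := by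
  simp only [K, x₀, W.coeff_ofPoly, coeff_C_mul, coeff_sub, coeff_X_pow, coeff_one, coeff_X_zero,
    coeff_C_zero]
  norm_num

section LinearisedEquations

variable {ρ : ℝ} [hρ : Fact (1 < ρ)] {m : ℕ}

theorem exists_hasStrictFDerivAt_K (x : Params ρ) :
    ∃ D : Params ρ →L[ℝ] ℝ, HasStrictFDerivAt K D x ∧
      ∀ ξ, D ξ = 2 * x.2.1.coeff 0 * ξ.2.1.coeff 0 +
        (x.2.2.1.coeff 0 * ξ.2.2.2.coeff 0 + x.2.2.2.coeff 0 * ξ.2.2.1.coeff 0) := by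
  let a : Params ρ →L[ℝ] ℝ := W.coeffCLM 0 ∘L .fst ℝ _ _ ∘L .snd ℝ _ _
  let b : Params ρ →L[ℝ] ℝ := W.coeffCLM 0 ∘L .fst ℝ _ _ ∘L .snd ℝ _ _ ∘L .snd ℝ _ _
  let c : Params ρ →L[ℝ] ℝ := W.coeffCLM 0 ∘L .snd ℝ _ _ ∘L .snd ℝ _ _ ∘L .snd ℝ _ _
  have ha (y : Params ρ) : a y = y.2.1.coeff 0 := W.coeffCLM_apply 0 _
  have hb (y : Params ρ) : b y = y.2.2.1.coeff 0 := W.coeffCLM_apply 0 _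
  have hc (y : Params ρ) : c y = y.2.2.2.coeff 0 := W.coeffCLM_apply 0 _
  have hderiv := (a.hasStrictFDerivAt (x := x).pow 2).add
    (b.hasStrictFDerivAt.mul c.hasStrictFDerivAt)
  refine ⟨_, hderiv.congr_of_eventuallyEq (.of_forall fun y => ?_), fun ξ => ?_⟩
  · change a y ^ 2 + b y * c y = K y
    rw [K, ha, hb, hc]
  · rw [← ha, ← ha, ← hb, ← hb, ← hc, ← hc]
    simp

theorem hasStrictFDerivAt_K (x : Params ρ) : HasStrictFDerivAt K (fderiv ℝ K x) x := by
  obtain ⟨D, hD, -⟩ := exists_hasStrictFDerivAt_K x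
  exact hD.congr_fderiv hD.hasFDerivAt.fderiv.symm

theorem fderiv_K_apply (x ξ : Params ρ) : fderiv ℝ K x ξ = 2 * x.2.1.coeff 0 * ξ.2.1.coeff 0 +
    (x.2.2.1.coeff 0 * ξ.2.2.2.coeff 0 + x.2.2.2.coeff 0 * ξ.2.2.1.coeff 0) := by
  obtain ⟨D, hD, hD_apply⟩ := exists_hasStrictFDerivAt_K x
  rw [hD.hasFDerivAt.fderiv, hD_apply]

theorem fderiv_K_x₀_apply (ξ : Params ρ) :
    fderiv ℝ K (x₀ ρ) ξ = -2 * ξ.2.2.1.coeff 0 - 1 / 2 * ξ.2.2.2.coeff 0 := by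
  rw [fderiv_K_apply]
  simp only [x₀, W.coeff_ofPoly, coeff_C_mul, coeff_sub, coeff_X_pow, coeff_one, coeff_X_zero,
    coeff_C_zero]
  norm_num
  ring

/-- The derivative in `x` of the equations of the monodromy problem, at `t = 0` and the initial
value. -/
def linearisedEquations (m : ℕ) : Params ρ →L[ℝ] Target ρ × ℝ :=
  (defect ∘L fderiv ℝ (logMonodromy m 0) (x₀ ρ)).prod (fderiv ℝ K (x₀ ρ))

theorem divX_divX_eq_of_defect_neg_eq_zero (hm : 1 ≤ m) {ξ : Params ρ}
    (h : (defect (fderiv ℝ (logMonodromy m 0) (x₀ ρ) ξ)).2.2.1 = 0) :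
    ξ.2.2.1.divX.divX = W.ofPoly (C (ξ.1 - ξ.2.2.1.coeff 0)) := by
  refine W.ext fun k => ?_
  have hk := defect_fderiv_logMonodromy_x₀_neg hm ξ k
  rw [h, W.coeff_zero] at hk
  rw [W.coeff_divX, W.coeff_divX, W.coeff_ofPoly, coeff_C]
  linarith

theorem low_order_eq_zero_of_linearisedEquations_eq_zero (hm : 1 ≤ m) {ξ : Params ρ}
    (h : linearisedEquations m ξ = 0) :
    ξ.1 = 0 ∧ ξ.2.2.1.coeff 0 = 0 ∧ ξ.2.2.1.coeff 1 = 0 := by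
  have hdefect : defect (fderiv ℝ (logMonodromy m 0) (x₀ ρ) ξ) = 0 := congrArg Prod.fst h
  have hK : -2 * ξ.2.2.1.coeff 0 - 1 / 2 * ξ.2.2.2.coeff 0 = 0 :=
    (fderiv_K_x₀_apply ξ).symm.trans (congrArg Prod.snd h)
  have hdiag := defect_fderiv_logMonodromy_x₀_diag hm ξ 0
  have hpos := defect_fderiv_logMonodromy_x₀_pos_succ hm ξ 0
  have hneg := defect_fderiv_logMonodromy_x₀_neg hm ξ 0
  have hone := defect_fderiv_logMonodromy_x₀_eval_one hm ξ
  have hneg_one := defect_fderiv_logMonodromy_x₀_eval_neg_one hm ξ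
  have hb := divX_divX_eq_of_defect_neg_eq_zero hm
    (congrArg (fun y : Target ρ => y.2.2.1) hdefect)
  rw [W.reEval_one_eq_add, hb, W.reEval_ofPoly_C] at hone
  rw [W.reEval_neg_one_eq_sub_add, hb, W.reEval_ofPoly_C] at hneg_one
  simp only [hdefect, Prod.fst_zero, Prod.snd_zero, W.coeff_zero, if_true, zero_add]
    at hdiag hpos hneg hone hneg_one
  exact ⟨by linarith, by linarith, by linarith⟩

theorem linearisedEquations_injective (hm : 1 ≤ m) :
    Function.Injective (linearisedEquations (ρ := ρ) m) := by
  refine (injective_iff_map_eq_zero _).2 fun ξ h => ?_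
  obtain ⟨hr, hb₀, hb₁⟩ := low_order_eq_zero_of_linearisedEquations_eq_zero hm h
  have hdefect : defect (fderiv ℝ (logMonodromy m 0) (x₀ ρ) ξ) = 0 := congrArg Prod.fst h
  have hdiag := defect_fderiv_logMonodromy_x₀_diag hm ξ
  have hpos_zero := defect_fderiv_logMonodromy_x₀_pos_zero hm ξ
  have hpos := defect_fderiv_logMonodromy_x₀_pos_succ hm ξ
  have hneg := defect_fderiv_logMonodromy_x₀_neg hm ξ
  simp only [hdefect, Prod.fst_zero, Prod.snd_zero, W.coeff_zero, hr, hb₀, hb₁, sub_zero, ite_self,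
    add_zero] at hdiag hpos_zero hpos hneg
  have ha (k : ℕ) : ξ.2.1.coeff (k + 1) = 0 := by linarith [hdiag k, hneg k]
  refine Prod.ext hr (Prod.ext (W.ext fun k => ?_) (Prod.ext (W.ext fun k => ?_)
    (W.ext fun k => ?_)))
  · rcases k with _ | k
    · change ξ.2.1.coeff 0 = 0
      linarith
    · exact ha k
  · rcases k with _ | _ | k
    · exact hb₀
    · exact hb₁
    · change ξ.2.2.1.coeff (k + 2) = 0
      linarith [hneg k]
  · change ξ.2.2.2.coeff k = 0
    linarith [hpos k, ha k, hneg k]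

/-- The preimage of `(y, κ)` under the linearised equations, found by solving for `b` from the
negative part of the second equation, `r` and the coefficients `b₁`, `b₀` from the scalar
equations, and then `a` and `c`. -/
def linearisedSolution (y : Target ρ) (κ : ℝ) : Params ρ :=
  let (φ, p, g, y₁, y₂) := y
  let r := (y₁ - y₂ + W.reEval 1 g + W.reEval (-1) g) / 2
  let b₁ := (y₁ + y₂ + W.reEval 1 g - W.reEval (-1) g) / 2
  let b₀ := (2 * r - κ - 1 / 2 * (p.coeff 1 - 2 * φ.coeff 0 + g.coeff 0)) / 4
  (r, W.cons (b₁ + p.coeff 0 / 2) (φ + (-1 : ℝ) • g + W.ofPoly (C (2 * (r - b₀)))),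
    W.cons b₀ (W.cons b₁ (W.ofPoly (C (r - b₀)) + (-1 : ℝ) • g)),
    p.divX + (-2 : ℝ) • φ + g + W.ofPoly (C (-4 * (r - b₀))))

theorem linearisedEquations_linearisedSolution (hm : 1 ≤ m) (y : Target ρ) (κ : ℝ) :
    linearisedEquations m (linearisedSolution y κ) = (y, κ) := by
  obtain ⟨φ, p, g, y₁, y₂⟩ := y
  refine Prod.ext (Prod.ext (W.ext fun k => ?_) (Prod.ext (W.ext fun k => ?_)
    (Prod.ext (W.ext fun k => ?_) (Prod.ext ?_ ?_)))) ?_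
  · refine (defect_fderiv_logMonodromy_x₀_diag hm _ k).trans ?_
    simp only [linearisedSolution, W.coeff_cons_succ, W.coeff_cons_zero, W.coeff_add, W.coeff_smul,
      W.coeff_ofPoly, coeff_C]
    split_ifs <;> ring
  · rcases k with _ | k
    · refine (defect_fderiv_logMonodromy_x₀_pos_zero hm _).trans ?_
      simp only [linearisedSolution, W.coeff_cons_succ, W.coeff_cons_zero]
      ring
    · refine (defect_fderiv_logMonodromy_x₀_pos_succ hm _ k).trans ?_
      simp only [linearisedSolution, W.coeff_cons_succ, W.coeff_cons_zero, W.coeff_add,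
        W.coeff_smul, W.coeff_ofPoly, coeff_C, W.coeff_divX]
      split_ifs <;> ring
  · refine (defect_fderiv_logMonodromy_x₀_neg hm _ k).trans ?_
    simp only [linearisedSolution, W.coeff_cons_succ, W.coeff_cons_zero, W.coeff_add, W.coeff_smul,
      W.coeff_ofPoly, coeff_C]
    split_ifs <;> ring
  · refine (defect_fderiv_logMonodromy_x₀_eval_one hm _).trans ?_
    simp only [linearisedSolution, W.reEval_one_eq_add (W.cons _ _), W.divX_cons,
      W.coeff_cons_succ, W.coeff_cons_zero, map_add, map_smul, W.reEval_ofPoly_C, smul_eq_mul]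
    ring
  · refine (defect_fderiv_logMonodromy_x₀_eval_neg_one hm _).trans ?_
    simp only [linearisedSolution, W.reEval_neg_one_eq_sub_add (W.cons _ _), W.divX_cons,
      W.coeff_cons_succ, W.coeff_cons_zero, map_add, map_smul, W.reEval_ofPoly_C, smul_eq_mul]
    ring
  · refine (fderiv_K_x₀_apply _).trans ?_
    simp only [linearisedSolution, W.coeff_cons_zero, W.coeff_add, W.coeff_smul,
      W.coeff_ofPoly, coeff_C_zero, W.coeff_divX]
    ring

theorem linearisedEquations_bijective (hm : 1 ≤ m) :
    Function.Bijective (linearisedEquations (ρ := ρ) m) :=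
  ⟨linearisedEquations_injective hm,
    fun y => ⟨linearisedSolution y.1 y.2, linearisedEquations_linearisedSolution hm y.1 y.2⟩⟩

end LinearisedEquations

/-! ### Solution of the monodromy problem -/

section Solution

variable {ρ : ℝ} [hρ : Fact (1 < ρ)] {m : ℕ}

theorem logMonodromy_zero_x₀ (hm : 1 ≤ m) :
    logMonodromy m 0 (x₀ ρ) = fderiv ℝ (logMonodromy m 0) (x₀ ρ) (0, (x₀ ρ).2) := by
  refine LoopMat.ext_eval fun l => ?_
  rw [eval_fderiv_logMonodromy_x₀ hm, eval_logMonodromy_zero hm]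
  simp [x₀]

theorem defect_logMonodromy_x₀ (hm : 1 ≤ m) : defect (logMonodromy m 0 (x₀ ρ)) = 0 := by
  have hb (k : ℕ) : (x₀ ρ).2.2.1.coeff k = 1 / 2 * ((if k = 2 then 1 else 0) -
      if k = 0 then 1 else 0) := by
    change (C (1 / 2) * (X ^ 2 - 1) : ℝ[X]).coeff k = _
    rw [coeff_C_mul, coeff_sub, coeff_X_pow, coeff_one]
  have ha (k : ℕ) : (x₀ ρ).2.1.coeff k = if k = 1 then 1 else 0 := by
    change (X : ℝ[X]).coeff k = _
    rw [coeff_X]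
    simp only [eq_comm]
  have hc (k : ℕ) : (x₀ ρ).2.2.2.coeff k = if k = 0 then -2 else 0 := coeff_C
  have hb_eval : (x₀ ρ).2.2.1 = W.ofPoly (C (1 / 2) * (X ^ 2 - 1)) := rfl
  rw [logMonodromy_zero_x₀ hm]
  refine Prod.ext (W.ext fun k => ?_) (Prod.ext (W.ext fun k => ?_)
    (Prod.ext (W.ext fun k => ?_) (Prod.ext ?_ ?_)))
  · refine (defect_fderiv_logMonodromy_x₀_diag hm _ k).trans ?_
    rcases k with _ | k <;> norm_num [ha, hb]
  · rcases k with _ | k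
    · refine (defect_fderiv_logMonodromy_x₀_pos_zero hm _).trans ?_
      norm_num [ha, hb]
    · refine (defect_fderiv_logMonodromy_x₀_pos_succ hm _ k).trans ?_
      rcases k with _ | k <;> norm_num [ha, hb, hc]
  · refine (defect_fderiv_logMonodromy_x₀_neg hm _ k).trans ?_
    rcases k with _ | k <;> norm_num [hb]
  · refine (defect_fderiv_logMonodromy_x₀_eval_one hm _).trans ?_
    simp [hb_eval, W.reEval_apply, W.eval_ofPoly]
  · refine (defect_fderiv_logMonodromy_x₀_eval_neg_one hm _).trans ?_
    simp [hb_eval, W.reEval_apply, W.eval_ofPoly]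

/-- The derivative of the solution at `t = 0`. -/
def initialVelocity (m : ℕ) (ρ : ℝ) : Params ρ :=
  (0, W.ofPoly (C (kappa m) * (1 - X ^ 2)), W.ofPoly (C (kappa m) * (X - X ^ 3)), 0)

theorem linearisedEquations_initialVelocity (hm : 1 ≤ m) :
    linearisedEquations m (initialVelocity m ρ) =
      ((0, W.ofPoly (C (-kappa m) * X ^ 2), W.ofPoly (C (kappa m) * X), 0, 0), 0) := by
  have ha (k : ℕ) : (initialVelocity m ρ).2.1.coeff k =
      kappa m * ((if k = 0 then 1 else 0) - if k = 2 then 1 else 0) := by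
    change (C (kappa m) * (1 - X ^ 2) : ℝ[X]).coeff k = _
    rw [coeff_C_mul, coeff_sub, coeff_X_pow, coeff_one]
  have hb (k : ℕ) : (initialVelocity m ρ).2.2.1.coeff k =
      kappa m * ((if 1 = k then 1 else 0) - if k = 3 then 1 else 0) := by
    change (C (kappa m) * (X - X ^ 3) : ℝ[X]).coeff k = _
    rw [coeff_C_mul, coeff_sub, coeff_X_pow, coeff_X]
  have hb_eval : (initialVelocity m ρ).2.2.1 = W.ofPoly (C (kappa m) * (X - X ^ 3)) := rfl
  have hr : (initialVelocity m ρ).1 = 0 := rfl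
  have hc (k : ℕ) : (initialVelocity m ρ).2.2.2.coeff k = 0 := rfl
  refine Prod.ext (Prod.ext (W.ext fun k => ?_) (Prod.ext (W.ext fun k => ?_)
    (Prod.ext (W.ext fun k => ?_) (Prod.ext ?_ ?_)))) ?_
  · refine (defect_fderiv_logMonodromy_x₀_diag hm _ k).trans ?_
    simp [ha, hb, hr]
  · rcases k with _ | k
    · refine (defect_fderiv_logMonodromy_x₀_pos_zero hm _).trans ?_
      simp [ha, hb, W.coeff_ofPoly]
    · refine (defect_fderiv_logMonodromy_x₀_pos_succ hm _ k).trans ?_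
      simp [ha, hb, hc, hr, W.coeff_ofPoly, coeff_X_pow]
      split_ifs <;> ring
  · refine (defect_fderiv_logMonodromy_x₀_neg hm _ k).trans ?_
    simp [hb, hr, eq_comm, W.coeff_ofPoly, coeff_X]
  · refine (defect_fderiv_logMonodromy_x₀_eval_one hm _).trans ?_
    simp [hb_eval, W.reEval_apply, W.eval_ofPoly]
  · refine (defect_fderiv_logMonodromy_x₀_eval_neg_one hm _).trans ?_
    norm_num [hb_eval, W.reEval_apply, W.eval_ofPoly]
  · refine (fderiv_K_x₀_apply _).trans ?_
    simp [hb, hc]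

/-- The equations of the monodromy problem, as a map of `(t, x)`. -/
def equations (m : ℕ) (p : ℝ × Params ρ) : Target ρ × ℝ :=
  (defect (logMonodromy m p.1 p.2), K p.2)

/-- The derivative of `equations` at `t = 0` and the initial value. -/
def equationsFDeriv (m : ℕ) : ℝ × Params ρ →L[ℝ] Target ρ × ℝ :=
  linearisedEquations m ∘L .snd ℝ ℝ (Params ρ) + (ContinuousLinearMap.fst ℝ ℝ (Params ρ)).smulRight
    (defect (logMonodromyDeriv m (x₀ ρ)), 0)

theorem hasStrictFDerivAt_equations (hm : 1 ≤ m) :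
    HasStrictFDerivAt (equations (ρ := ρ) m) (equationsFDeriv m) (0, x₀ ρ) := by
  have hdefect := defect.hasStrictFDerivAt.comp ((0 : ℝ), x₀ ρ)
    (hasStrictFDerivAt_logMonodromy (hasStrictFDerivAt_logMonodromy_zero hm (x₀ ρ)))
  have hsnd : HasStrictFDerivAt (fun p : ℝ × Params ρ => p.2)
    (ContinuousLinearMap.snd ℝ ℝ (Params ρ)) (0, x₀ ρ) := hasStrictFDerivAt_snd
  have hK := (hasStrictFDerivAt_K (x₀ ρ)).comp ((0 : ℝ), x₀ ρ) hsnd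
  refine (hdefect.prodMk hK).congr_fderiv (ContinuousLinearMap.ext fun p => ?_)
  refine Prod.ext ((map_add defect _ _).trans (congrArg _ (map_smul defect _ _))) ?_
  exact (add_zero _).symm.trans (congrArg _ (mul_zero p.1).symm)

theorem equationsFDeriv_comp_inr_bijective (hm : 1 ≤ m) :
    Function.Bijective (equationsFDeriv m ∘L .inr ℝ ℝ (Params ρ)) := by
  have hcomp : equationsFDeriv m ∘L .inr ℝ ℝ (Params ρ) = linearisedEquations m := by
    ext ξ <;> simp [equationsFDeriv]
  rw [hcomp]
  exact linearisedEquations_bijective hm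

theorem equationsFDeriv_one_initialVelocity (hm : 1 ≤ m) :
    equationsFDeriv m (1, initialVelocity m ρ) = 0 := by
  change linearisedEquations m (initialVelocity m ρ) +
    (1 : ℝ) • (defect (logMonodromyDeriv m (x₀ ρ)), (0 : ℝ)) = 0
  rw [linearisedEquations_initialVelocity hm, defect_logMonodromyDeriv_x₀ hm, one_smul]
  have hcancel (p : ℝ[X]) : W.ofPoly (-p) + W.ofPoly p = (0 : W ρ) := W.ext fun k => by
    rw [W.coeff_add, W.coeff_ofPoly, W.coeff_ofPoly, coeff_neg, neg_add_cancel, W.coeff_zero]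
  rw [C_neg, neg_mul, neg_mul]
  refine Prod.ext (Prod.ext (add_zero _) (Prod.ext (hcancel _) (Prod.ext ?_ (Prod.ext (add_zero _)
    (add_zero _))))) (add_zero _)
  exact (add_comm _ _).trans (hcancel _)

theorem exists_solution_curve (hm : 1 ≤ m) : ∃ φ : ℝ → Params ρ, φ 0 = x₀ ρ ∧
    HasDerivAt φ (initialVelocity m ρ) 0 ∧
    ∀ᶠ p in nhds ((0 : ℝ), x₀ ρ), SolvesMonodromyProblem m p.1 p.2 ↔ p.2 = φ p.1 := by
  obtain ⟨φ, hφ, hφ', hev⟩ := exists_implicit_curve (F := Target ρ × ℝ)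
    (f := equations m) (hasStrictFDerivAt_equations hm) (equationsFDeriv_comp_inr_bijective hm)
    (equationsFDeriv_one_initialVelocity hm)
  refine ⟨φ, hφ, hφ', ?_⟩
  filter_upwards [hev, eventually_isSmall m (x₀ ρ)] with p hp hsmall
  rw [solvesMonodromyProblem_iff_defect hm hsmall, ← hp, equations, equations,
    defect_logMonodromy_x₀ hm, K_x₀]
  exact Prod.mk_inj.symm

end Solution

end LawsonDPW

end

open Polynomial LawsonDPW in
/-- For all small `t` the monodromy problem has exactly one solution `x(t) = (r, a, b, c)(t)` near
`x₀`, and `r'(0) = 0`, `a'(0) = (1 - λ²) κ_m`, `b'(0) = (λ - λ³) κ_m`, `c'(0) = 0`. -/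
theorem mainTheorem5 (m : ℕ) (hm : 1 ≤ m) (ρ : ℝ) [Fact (1 < ρ)] :
    ∃ ε > 0, ∃ δ > 0, ∃ x : ℝ → Params ρ,
      (∀ t : ℝ, |t| < ε → ‖x t - x₀ ρ‖ < δ ∧
        ∀ y : Params ρ, ‖y - x₀ ρ‖ < δ → (SolvesMonodromyProblem m t y ↔ y = x t)) ∧
      x 0 = x₀ ρ ∧
      HasDerivAt (fun t => (x t).2.1) (W.ofPoly (C (kappa m) * (1 - X ^ 2))) 0 ∧
      HasDerivAt (fun t => (x t).2.2.1) (W.ofPoly (C (kappa m) * (X - X ^ 3))) 0 ∧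
      HasDerivAt (fun t => (x t).2.2.2) 0 0 ∧
      HasDerivAt (fun t => (x t).1) 0 0 := by
  obtain ⟨x, hx₀, hderiv, hsol⟩ := exists_solution_curve (ρ := ρ) hm
  rw [← hx₀] at hsol
  obtain ⟨ε, hε, δ, hδ, hunique⟩ := exists_uniform_neighbourhood hderiv.continuousAt hsol
  rw [hx₀] at hunique
  exact ⟨ε, hε, δ, hδ, x, hunique, hx₀, hderiv.snd.fst, hderiv.snd.snd.fst, hderiv.snd.snd.snd,
    hderiv.fst⟩
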